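/- Let $(\Sigma,h)$ be a Riemannian manifold of dimension $n\ge 1$ (of class $C^2$, with a $C^1$ metric; in particular any smooth Riemannian manifold), with volume measure $\mu_h$ and distance $\operatorname{dist}_h$. Let $p\in\Sigma$, let $0<r<\operatorname{inj}(p)$, where $\operatorname{inj}(p)$ is the supremum of the $R>0$ such that the exponential map at $p$ is a $C^1$ diffeomorphism of the ball of radius $R$ in $T_p\Sigma$ onto its image with minimizing radial geodesics, and let $B=\{x:\operatorname{dist}_h(x,p)<r\}$ and $\rho(x)=\operatorname{dist}_h(x,p)$. Suppose that $B$ is weakly mean-convex in the sense that $\Delta_h\rho\ge 0$ on $B\setminus\{p\}$ in the distributional sense, i.e. $-\int_B h(\nabla\rho,\nabla\varphi)\,d\mu_h\ge 0$ for all nonnegative $\varphi\in C^1_c(B\setminus\{p\})$. Let $H^1_0(B)$ be the closure in the $H^1$ norm of the complex-valued $C^1$ functions with compact support in $B$, and let $$\lambda_1(B)=\inf\Big\{\frac{\int_B\|\nabla u\|_h^2\,d\mu_h}{\int_B|u|^2\,d\mu_h}\;:\;0\ne u\in H^1_0(B)\Big\}$$ be the first Dirichlet eigenvalue of $-\Delta_h$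 on $B$. Then $$\lambda_1(B)\ \ge\ \frac{\pi^2}{4r^2}.$$ Moreover, let $\hbar>0$ and let $X_1,\dots,X_n$ be an $h$-orthonormal $C^1$ frame on $B$ whose divergences $f_a=\operatorname{div}_hX_a$ are $C^1$ and bounded on $B$ and whose potential $V=\tfrac12\sum_aX_a(f_a)+\tfrac14\sum_af_a^2$ is bounded on $B$. For $\psi\in H^1_0(B)$ with $\|\psi\|_{L^2(B)}=1$ put $P_a\psi=-i\hbar\,(X_a\psi+\tfrac12f_a\psi)$, $\langle P_a\rangle=\int_B\overline{\psi}\,P_a\psi\,d\mu_h$ and $$\sigma_p(\psi)=\Big(\sum_{a=1}^n\big(\|P_a\psi\|_{L^2(B)}^2-|\langle P_a\rangle|^2\big)+\hbar^2\int_BV|\psi|^2\,d\mu_h\Big)^{1/2}.$$ Then $\sigma_p(\psi)\,r\ge\dfrac{\pi\hbar}{2}$ for all $\psi\in H^1_0(B)$ with $\|\psi\|_{L^2(B)}=1$. -/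

import Mathlib

open scoped Manifold ContDiff Topology ENNReal Bundle

noncomputable section

namespace GeodesicBall

open MeasureTheory Manifold Bundle

variable {n : ℕ} {M : Type*} [TopologicalSpace M] [ChartedSpace (EuclideanSpace ℝ (Fin n)) M]

instance instFiniteDimensionalTangentSpace (x : M) :
    FiniteDimensional ℝ (TangentSpace (𝓡 n) x) :=
  inferInstanceAs (FiniteDimensional ℝ (EuclideanSpace ℝ (Fin n)))

section Metric

variable [RiemannianBundle (fun x : M => TangentSpace (𝓡 n) x)]

/-! ### Pointwise algebra on cotangent spaces -/

/-- The inner product `⟨α, β⟩ = ∑ₐ α(eₐ) β(eₐ)` of two real covectors at `x`, where `(eₐ)` is an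
orthonormal basis of the tangent space. For `α = df`, `β = dg` this is `h(∇f, ∇g)`. -/
def covectorInner {x : M} (α β : TangentSpace (𝓡 n) x →L[ℝ] ℝ) : ℝ :=
  ∑ a, α (stdOrthonormalBasis ℝ (TangentSpace (𝓡 n) x) a) *
    β (stdOrthonormalBasis ℝ (TangentSpace (𝓡 n) x) a)

/-- The squared norm `∑ₐ |α(eₐ)|²` of a complex covector at `x`. For `α = dψ` this is the squared
gradient norm `‖∇ψ(x)‖² = ∑ₐ |Xₐψ(x)|²`. -/
def covectorNormSq {x : M} (α : TangentSpace (𝓡 n) x →L[ℝ] ℂ) : ℝ :=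
  ∑ a, ‖α (stdOrthonormalBasis ℝ (TangentSpace (𝓡 n) x) a)‖ ^ 2

/-! ### Riemannian volume and divergence -/

/-- The coordinate vector field `∂ᵢ` of the preferred chart at `x₀`, at the point with
coordinates `y`. -/
def coordVector (x₀ : M) (y : EuclideanSpace ℝ (Fin n)) (i : Fin n) :
    TangentSpace (𝓡 n) ((chartAt (EuclideanSpace ℝ (Fin n)) x₀).symm y) :=
  mfderiv (𝓡 n) (𝓡 n) (chartAt (EuclideanSpace ℝ (Fin n)) x₀).symm y
    (EuclideanSpace.single i (1 : ℝ))

/-- The density `√det (h_ij)` in the preferred chart at `x₀`, as a function of the coordinates. -/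
def chartDensity (x₀ : M) (y : EuclideanSpace ℝ (Fin n)) : ℝ :=
  Real.sqrt (Matrix.det (Matrix.of fun i j : Fin n =>
    inner ℝ (coordVector x₀ y i) (coordVector x₀ y j)))

/-- The measure `√|h| dx` of the preferred chart at `x₀`, extended by zero outside the domain of
the chart. -/
def chartVolume [MeasurableSpace M] (x₀ : M) : Measure M :=
  Measure.map (chartAt (EuclideanSpace ℝ (Fin n)) x₀).symm
    ((volume.restrict (chartAt (EuclideanSpace ℝ (Fin n)) x₀).target).withDensity
      fun y => ENNReal.ofReal (chartDensity x₀ y))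

variable (n M) in
/-- The Riemannian volume measure `μ_h`: the chart measures agree on overlaps of charts, and their
supremum in the lattice of measures is the measure that restricts to each of them. -/
def riemannianVolume [MeasurableSpace M] : Measure M :=
  ⨆ x₀ : M, chartVolume (n := n) x₀

/-- The coordinate expression in the preferred chart at `x₀` of a vector field. -/
def coordField (x₀ : M) (X : ∀ x : M, TangentSpace (𝓡 n) x) (y : EuclideanSpace ℝ (Fin n)) :
    EuclideanSpace ℝ (Fin n) :=
  mfderiv (𝓡 n) (𝓡 n) (chartAt (EuclideanSpace ℝ (Fin n)) x₀)
    ((chartAt (EuclideanSpace ℝ (Fin n)) x₀).symm y)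
    (X ((chartAt (EuclideanSpace ℝ (Fin n)) x₀).symm y))

/-- The Riemannian divergence `div X = |h|^{-1/2} ∑ᵢ ∂ᵢ(|h|^{1/2} Xⁱ)`, computed at `x` in the
preferred chart at `x`. -/
def divergence (X : ∀ x : M, TangentSpace (𝓡 n) x) (x : M) : ℝ :=
  (chartDensity x (chartAt (EuclideanSpace ℝ (Fin n)) x x))⁻¹ *
    ∑ i : Fin n,
      fderiv ℝ (fun y : EuclideanSpace ℝ (Fin n) => chartDensity x y * coordField x X y i)
        (chartAt (EuclideanSpace ℝ (Fin n)) x x) (EuclideanSpace.single i (1 : ℝ))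

/-! ### Geodesic balls -/

/-- The distance function `ρ(x) = dist_h(p, x)`. -/
def rho (p x : M) : ℝ := (riemannianEDist (𝓡 n) p x).toReal

variable (n) in
/-- The open geodesic ball `B(p, r)`. -/
def geodBall (p : M) (r : ℝ) : Set M :=
  {x | riemannianEDist (𝓡 n) p x < ENNReal.ofReal r}

/-- `Φ` is the exponential map at `p` on the ball of radius `R` in the tangent space at `p`, and it
is a diffeomorphism onto its (open) image: `Φ(0) = p`, the differential of `Φ` at `0` is the
identity, and each radial curve `t ↦ Φ(t v)`, `t ∈ [0, 1]`, is a minimizing geodesic parametrized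
proportionally to arc length. -/
structure IsExpDiffeo (p : M) (R : ℝ)
    (Φ : OpenPartialHomeomorph (TangentSpace (𝓡 n) p) M) : Prop where
  source_eq : Φ.source = Metric.ball 0 R
  contMDiffOn : ContMDiffOn 𝓘(ℝ, TangentSpace (𝓡 n) p) (𝓡 n) 1 Φ Φ.source
  contMDiffOn_symm : ContMDiffOn (𝓡 n) 𝓘(ℝ, TangentSpace (𝓡 n) p) 1 Φ.symm Φ.target
  map_zero : Φ 0 = p
  mfderiv_zero : ∀ v : TangentSpace (𝓡 n) p,
    mfderiv 𝓘(ℝ, TangentSpace (𝓡 n) p) (𝓡 n) Φ 0 v = v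
  minimizing : ∀ v ∈ Metric.ball (0 : TangentSpace (𝓡 n) p) R,
    ∀ s ∈ Set.Icc (0 : ℝ) 1, ∀ t ∈ Set.Icc (0 : ℝ) 1,
      riemannianEDist (𝓡 n) (Φ (s • v)) (Φ (t • v)) = ENNReal.ofReal (|s - t| * ‖v‖)

variable (n) in
/-- The injectivity radius at `p`: the supremum of the radii `R > 0` such that the exponential map
at `p` is a diffeomorphism of the ball of radius `R` onto its image. -/
def injectivityRadius (p : M) : ℝ≥0∞ :=
  ⨆ (R : ℝ) (_ : 0 < R ∧ ∃ Φ : OpenPartialHomeomorph (TangentSpace (𝓡 n) p) M,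
    IsExpDiffeo p R Φ), ENNReal.ofReal R

/-- The differential of a complex-valued function, as a complex covector field. -/
def differential (ψ : M → ℂ) (x : M) : TangentSpace (𝓡 n) x →L[ℝ] ℂ :=
  mfderiv (𝓡 n) 𝓘(ℝ, ℂ) ψ x

section Volume

variable [MeasurableSpace M]

/-- Weak mean-convexity of `B(p, r)`: `Δρ ≥ 0` on `B(p, r) ∖ {p}` in the distributional sense, i.e.
`-∫ h(∇ρ, ∇φ) dμ_h ≥ 0` for all nonnegative test functions `φ` with compact support in
`B(p, r) ∖ {p}`. -/
def IsWeaklyMeanConvexBall (p : M) (r : ℝ) : Prop :=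
  ∀ φ : M → ℝ, ContMDiff (𝓡 n) 𝓘(ℝ, ℝ) 1 φ → HasCompactSupport φ →
    tsupport φ ⊆ geodBall n p r \ {p} → (∀ x, 0 ≤ φ x) →
      0 ≤ -∫ x in geodBall n p r,
        covectorInner (mfderiv (𝓡 n) 𝓘(ℝ, ℝ) (rho (n := n) p) x) (mfderiv (𝓡 n) 𝓘(ℝ, ℝ) φ x)
          ∂(riemannianVolume n M)

/-! ### The space `H¹₀` and the first Dirichlet eigenvalue -/

/-- `ψ ∈ H¹₀(B)` with weak differential `dψ = G`: `ψ ∈ L²(B)`, `G` is a measurable section over `B`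
(its pairing with each continuous vector field on `B` is measurable), and there are compactly
supported continuously differentiable functions `φₖ` on `B` with `φₖ → ψ` and `dφₖ → G` in
`L²(B)`. So `H¹₀(B)` is the closure of the test functions in the `H¹` norm, and `G` is determined
by `ψ` almost everywhere. -/
structure MemH10 [IsManifold (𝓡 n) 1 M] (B : Set M) (ψ : M → ℂ) (G : ∀ x : M, TangentSpace (𝓡 n) x →L[ℝ] ℂ) : Prop where
  memLp : MemLp ψ 2 ((riemannianVolume n M).restrict B)
  aestronglyMeasurable : ∀ Y : ∀ x : M, TangentSpace (𝓡 n) x,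
    ContinuousOn (fun x => (⟨x, Y x⟩ : TangentBundle (𝓡 n) M)) B →
      AEStronglyMeasurable (fun x => G x (Y x)) ((riemannianVolume n M).restrict B)
  approx : ∃ φ : ℕ → M → ℂ,
    (∀ k, ContMDiff (𝓡 n) 𝓘(ℝ, ℂ) 1 (φ k) ∧ HasCompactSupport (φ k) ∧ tsupport (φ k) ⊆ B) ∧
    Filter.Tendsto (fun k => ∫⁻ x in B, ENNReal.ofReal (‖φ k x - ψ x‖ ^ 2) ∂(riemannianVolume n M))
      Filter.atTop (𝓝 0) ∧
    Filter.Tendsto (fun k => ∫⁻ x in B,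
        ENNReal.ofReal (covectorNormSq (differential (n := n) (φ k) x - G x))
          ∂(riemannianVolume n M))
      Filter.atTop (𝓝 0)

variable (n) in
/-- The first Dirichlet eigenvalue of `-Δ_h` on `B`: the infimum of the Rayleigh quotients
`∫_B ‖∇u‖² / ∫_B |u|²` over `0 ≠ u ∈ H¹₀(B)`. -/
def lambda1 [IsManifold (𝓡 n) 1 M] (B : Set M) : ℝ :=
  sInf {q : ℝ | ∃ (u : M → ℂ) (G : ∀ x : M, TangentSpace (𝓡 n) x →L[ℝ] ℂ), MemH10 B u G ∧
    0 < ∫ x in B, ‖u x‖ ^ 2 ∂(riemannianVolume n M) ∧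
    q = (∫ x in B, covectorNormSq (G x) ∂(riemannianVolume n M)) /
      ∫ x in B, ‖u x‖ ^ 2 ∂(riemannianVolume n M)}

end Volume

/-! ### Frames, momenta and the geometric momentum variance -/

/-- The geometric potential `V = ½ ∑ₐ Xₐ(div Xₐ) + ¼ ∑ₐ (div Xₐ)²` of a frame. -/
def potential (X : Fin n → ∀ x : M, TangentSpace (𝓡 n) x) (x : M) : ℝ :=
  (1 / 2) * ∑ a, (mfderiv (𝓡 n) 𝓘(ℝ, ℝ) (divergence (X a)) x : TangentSpace (𝓡 n) x →L[ℝ] ℝ)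
    (X a x) + (1 / 4) * ∑ a, divergence (X a) x ^ 2

/-- `X` is an `h`-orthonormal frame over `B` that is regular enough for the momenta and the
potential `V` to be classical, with bounded divergences and potential, so that the momentum forms
are continuous on `H¹₀(B)`. (If `B` has compact closure, the boundedness holds for every frame that
is regular on a neighbourhood of the closure.) -/
structure IsOrthonormalFrameOn [IsManifold (𝓡 n) 1 M] (B : Set M)
    (X : Fin n → ∀ x : M, TangentSpace (𝓡 n) x) :
    Prop where
  orthonormal : ∀ x ∈ B, Orthonormal ℝ fun a => X a x
  contMDiffOn : ∀ a, ContMDiffOn (𝓡 n) ((𝓡 n).prod 𝓘(ℝ, EuclideanSpace ℝ (Fin n))) 1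
    (fun x => (⟨x, X a x⟩ : TangentBundle (𝓡 n) M)) B
  contMDiffOn_divergence : ∀ a, ContMDiffOn (𝓡 n) 𝓘(ℝ, ℝ) 1 (divergence (X a)) B
  bounded : ∃ C : ℝ, ∀ x ∈ B, (∀ a, |divergence (X a) x| ≤ C) ∧ |potential X x| ≤ C

/-- `Pₐψ = -iħ (Xₐψ + ½ (div Xₐ) ψ)` for the frame field `Y = Xₐ`, where `G = dψ`. -/
def momentum (ħ : ℝ) (Y : ∀ x : M, TangentSpace (𝓡 n) x) (ψ : M → ℂ)
    (G : ∀ x : M, TangentSpace (𝓡 n) x →L[ℝ] ℂ) (x : M) : ℂ :=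
  -Complex.I * (ħ : ℂ) * (G x (Y x) + (1 / 2) * (divergence Y x : ℂ) * ψ x)

variable [MeasurableSpace M]

/-- The mean momentum component `⟨Pₐ⟩ = ⟨ψ, Pₐψ⟩_{L²(B)}` (a real number). -/
def meanMomentum (ħ : ℝ) (B : Set M) (Y : ∀ x : M, TangentSpace (𝓡 n) x) (ψ : M → ℂ)
    (G : ∀ x : M, TangentSpace (𝓡 n) x →L[ℝ] ℂ) : ℂ :=
  ∫ x in B, (starRingEnd ℂ) (ψ x) * momentum ħ Y ψ G x ∂(riemannianVolume n M)

/-- The naive momentum variance `∑ₐ (⟨Pₐ²⟩ - ⟨Pₐ⟩²)`, with `⟨Pₐ²⟩ = ‖Pₐψ‖²` in the sense of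
quadratic forms. -/
def naiveVariance (ħ : ℝ) (B : Set M) (X : Fin n → ∀ x : M, TangentSpace (𝓡 n) x) (ψ : M → ℂ)
    (G : ∀ x : M, TangentSpace (𝓡 n) x →L[ℝ] ℂ) : ℝ :=
  ∑ a, ((∫ x in B, ‖momentum ħ (X a) ψ G x‖ ^ 2 ∂(riemannianVolume n M)) -
    ‖meanMomentum ħ B (X a) ψ G‖ ^ 2)

/-- The geometric momentum variance `Var_ψ(P)`: the naive variance plus `ħ² ⟨V⟩`. -/
def geometricVariance (ħ : ℝ) (B : Set M) (X : Fin n → ∀ x : M, TangentSpace (𝓡 n) x)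
    (ψ : M → ℂ) (G : ∀ x : M, TangentSpace (𝓡 n) x →L[ℝ] ℂ) : ℝ :=
  naiveVariance ħ B X ψ G +
    ħ ^ 2 * ∫ x in B, potential X x * ‖ψ x‖ ^ 2 ∂(riemannianVolume n M)

/-- The momentum uncertainty `σ_p(ψ) = √Var_ψ(P)`. -/
def sigmaP (ħ : ℝ) (B : Set M) (X : Fin n → ∀ x : M, TangentSpace (𝓡 n) x) (ψ : M → ℂ)
    (G : ∀ x : M, TangentSpace (𝓡 n) x →L[ℝ] ℂ) : ℝ :=
  Real.sqrt (geometricVariance ħ B X ψ G)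

end Metric

end GeodesicBall

end

/-! Put k = π/(2r) and η(t) = k tan(kt), so that η' = η² + k² on [0, r); -η is the logarithmic
derivative of cos(kt). For a test function u on the ball, weak mean-convexity applied to η(ρ)|u|²
gives ∫ h(∇ρ, ∇(η(ρ)|u|²)) ≤ 0. Completing the square, |du + η(ρ) u dρ|² ≥ 0, and using |dρ| ≥ 1,
the integrand is at least k²|u|² - |du|², hence k² ∫|u|² ≤ ∫|du|². Since ρ need not be
differentiable at p, η is multiplied by an increasing cutoff that vanishes near 0; this preserves
the differential inequality in the direction needed, and the cutoff is then removed by dominated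
convergence. The steps are `sq_add_le_deriv_profile`, `le_covectorInner_add_covectorNormSq` and
`mul_integral_cutoff_le_lintegral`. The bound |dρ| ≥ 1 (`one_le_covectorInner_rho`) comes from
comparing lengths of curves, not from the geodesic equation, which a C¹ metric hardly supports.

The square involves du only through |du|² and Re(ū du). So du may be replaced by any D with Re(ū D)
= Re(ū du), in particular by du - iθu with θ a real covector field. This gauged Poincaré inequality
extends to H¹₀ when θ is bounded (`mul_lintegral_norm_sq_le`). The case θ = 0 is the eigenvalue
bound.

For the uncertainty bound put c_a = Im ∫ ψ̄ X_aψ. The divergence theorem for |ψ|² X_a shows that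
⟨P_a⟩ = ħ c_a, and for f_a |ψ|² X_a, summed over a, that ħ²⟨V⟩ cancels every term of the naive
variance that contains some f_a. What remains is ħ² ∑ₐ ∫ |X_aψ - i c_a ψ|² (`geometricVariance_eq`),
the gauged Dirichlet energy for θ = ∑ₐ c_a h(X_a, ·), whose norm is constant. It is therefore at
least ħ² k².

Volume and divergence are given by charts, so both must first be shown independent of the chart: the
volume by change of variables, the divergence by its weak characterization through integration by
parts. -/

open scoped Manifold ContDiff Topology ENNReal Bundle

noncomputable section

set_option linter.unusedSectionVars false

namespace GeodesicBall

open MeasureTheory Manifold Bundle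

/-! ### Inner products of covectors -/

section CovectorAlgebra

variable {n : ℕ} {M : Type*} [TopologicalSpace M] [ChartedSpace (EuclideanSpace ℝ (Fin n)) M]
  [RiemannianBundle (fun x : M => TangentSpace (𝓡 n) x)] {x : M}

/-- The vector that represents a covector. -/
def sharp (α : TangentSpace (𝓡 n) x →L[ℝ] ℝ) : TangentSpace (𝓡 n) x :=
  (InnerProductSpace.toDual ℝ (TangentSpace (𝓡 n) x)).symm α

lemma inner_sharp (α : TangentSpace (𝓡 n) x →L[ℝ] ℝ) (v : TangentSpace (𝓡 n) x) :
    inner ℝ (sharp α) v = α v := by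
  simp [sharp]

lemma covectorInner_eq_inner_sharp (α β : TangentSpace (𝓡 n) x →L[ℝ] ℝ) :
    covectorInner α β = inner ℝ (sharp α) (sharp β) := by
  rw [← (stdOrthonormalBasis ℝ (TangentSpace (𝓡 n) x)).sum_inner_mul_inner]
  refine Finset.sum_congr rfl fun a _ => ?_
  rw [inner_sharp, real_inner_comm, inner_sharp]

/-- `stdOrthonormalBasis` is chosen pointwise, with no regularity in `x`. Independence of the basis
allows the given frame `X` to be used instead. -/
lemma covectorInner_eq_sum {ι : Type*} [Fintype ι]
    (b : OrthonormalBasis ι ℝ (TangentSpace (𝓡 n) x)) (α β : TangentSpace (𝓡 n) x →L[ℝ] ℝ) :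
    covectorInner α β = ∑ a, α (b a) * β (b a) := by
  rw [covectorInner_eq_inner_sharp, ← b.sum_inner_mul_inner]
  refine Finset.sum_congr rfl fun a _ => ?_
  rw [inner_sharp, real_inner_comm, inner_sharp]

lemma covectorNormSq_eq_add (α : TangentSpace (𝓡 n) x →L[ℝ] ℂ) :
    covectorNormSq α = covectorInner (Complex.reCLM.comp α) (Complex.reCLM.comp α) +
      covectorInner (Complex.imCLM.comp α) (Complex.imCLM.comp α) := by
  simp only [covectorNormSq, covectorInner, ← Finset.sum_add_distrib, Complex.sq_norm,
    Complex.normSq_apply]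
  rfl

lemma covectorNormSq_eq_sum {ι : Type*} [Fintype ι]
    (b : OrthonormalBasis ι ℝ (TangentSpace (𝓡 n) x)) (α : TangentSpace (𝓡 n) x →L[ℝ] ℂ) :
    covectorNormSq α = ∑ a, ‖α (b a)‖ ^ 2 := by
  rw [covectorNormSq_eq_add, covectorInner_eq_sum b, covectorInner_eq_sum b]
  simp only [← Finset.sum_add_distrib, Complex.sq_norm, Complex.normSq_apply]
  rfl

lemma covectorNormSq_nonneg (α : TangentSpace (𝓡 n) x →L[ℝ] ℂ) : 0 ≤ covectorNormSq α :=
  Finset.sum_nonneg fun _ _ => by positivity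

lemma covectorInner_self_nonneg (α : TangentSpace (𝓡 n) x →L[ℝ] ℝ) : 0 ≤ covectorInner α α :=
  Finset.sum_nonneg fun _ _ => mul_self_nonneg _

lemma covectorNormSq_le_two_mul (α β : TangentSpace (𝓡 n) x →L[ℝ] ℂ) :
    covectorNormSq β ≤ 2 * covectorNormSq (α - β) + 2 * covectorNormSq α := by
  simp only [covectorNormSq, Finset.mul_sum, ← Finset.sum_add_distrib]
  refine Finset.sum_le_sum fun a _ => ?_
  set e := stdOrthonormalBasis ℝ (TangentSpace (𝓡 n) x) a
  have h : ‖β e‖ ≤ ‖(α - β) e‖ + ‖α e‖ := by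
    rw [sub_apply]
    simpa [norm_sub_rev] using norm_add_le (β e - α e) (α e)
  nlinarith [sq_nonneg (‖(α - β) e‖ - ‖α e‖), norm_nonneg (β e)]

lemma abs_apply_le_sqrt_covectorInner_mul_norm (α : TangentSpace (𝓡 n) x →L[ℝ] ℝ)
    (v : TangentSpace (𝓡 n) x) : |α v| ≤ Real.sqrt (covectorInner α α) * ‖v‖ := by
  rw [covectorInner_eq_inner_sharp, ← norm_eq_sqrt_real_inner, ← inner_sharp]
  exact abs_real_inner_le_norm _ _

/-- Inverse Gram matrix formula for the inner product of covectors. -/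
lemma covectorInner_eq_gram {ι : Type*} [Fintype ι] [DecidableEq ι]
    (Y : Module.Basis ι ℝ (TangentSpace (𝓡 n) x)) (α β : TangentSpace (𝓡 n) x →L[ℝ] ℝ) :
    covectorInner α β =
      (fun i => α (Y i)) ⬝ᵥ ((Matrix.gram ℝ Y)⁻¹).mulVec (fun i => β (Y i)) := by
  have hdet : IsUnit (Matrix.gram ℝ Y).det :=
    (Matrix.det_gram_ne_zero_iff_linearIndependent.2 Y.linearIndependent).isUnit
  have h1 : (fun i => β (Y i)) = (Matrix.gram ℝ Y).mulVec (Y.repr (sharp β)) := by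
    ext i
    rw [← inner_sharp]
    conv_lhs => rw [← Y.sum_repr (sharp β), real_inner_comm, inner_sum]
    simp [Matrix.mulVec, dotProduct, inner_smul_right, mul_comm]
  rw [h1, Matrix.mulVec_mulVec, Matrix.nonsing_inv_mul _ hdet, Matrix.one_mulVec,
    covectorInner_eq_inner_sharp, inner_sharp]
  have h2 := congrArg α (Y.sum_repr (sharp β))
  rw [map_sum] at h2
  simpa [dotProduct, mul_comm] using h2.symm

end CovectorAlgebra

/-! ### Continuity of the metric and of the inverse Gram matrix -/

section Continuity

variable {n : ℕ} {M : Type*} [TopologicalSpace M] [ChartedSpace (EuclideanSpace ℝ (Fin n)) M]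
  [RiemannianBundle (fun x : M => TangentSpace (𝓡 n) x)] [IsManifold (𝓡 n) 2 M]

/-- The section of the tangent bundle given by a vector field. -/
abbrev toSection (Y : ∀ x : M, TangentSpace (𝓡 n) x) (x : M) : TangentBundle (𝓡 n) M := ⟨x, Y x⟩

lemma isContinuousRiemannianBundle_tangentSpace
    [IsContMDiffRiemannianBundle (𝓡 n) 1 (EuclideanSpace ℝ (Fin n))
      (fun x : M => TangentSpace (𝓡 n) x)] :
    IsContinuousRiemannianBundle (EuclideanSpace ℝ (Fin n))
      (fun x : M => TangentSpace (𝓡 n) x) := by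
  obtain ⟨g, hg, h⟩ := IsContMDiffRiemannianBundle.exists_contMDiff (IB := 𝓡 n) (n := 1)
    (F := EuclideanSpace ℝ (Fin n)) (E := fun x : M => TangentSpace (𝓡 n) x)
  exact ⟨g, hg.continuous, h⟩

lemma continuousOn_inner [IsContMDiffRiemannianBundle (𝓡 n) 1 (EuclideanSpace ℝ (Fin n))
      (fun x : M => TangentSpace (𝓡 n) x)] {S : Set M} {Y Z : ∀ x : M, TangentSpace (𝓡 n) x}
    (hY : ContinuousOn (toSection Y) S) (hZ : ContinuousOn (toSection Z) S) :
    ContinuousOn (fun x => inner ℝ (Y x) (Z x)) S := by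
  have := isContinuousRiemannianBundle_tangentSpace (n := n) (M := M)
  exact ContinuousOn.inner_bundle hY hZ

lemma continuousOn_gram_inv {S : Set M} {ι : Type*} [Fintype ι] [DecidableEq ι]
    [IsContMDiffRiemannianBundle (𝓡 n) 1 (EuclideanSpace ℝ (Fin n))
      (fun x : M => TangentSpace (𝓡 n) x)]
    {Y : ι → ∀ x : M, TangentSpace (𝓡 n) x}
    (hY : ∀ i, ContinuousOn (toSection (Y i)) S)
    (hli : ∀ x ∈ S, LinearIndependent ℝ (fun i => Y i x)) :
    ContinuousOn (fun x => (Matrix.gram ℝ (fun i => Y i x))⁻¹) S := by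
  have hg : ContinuousOn (fun x => Matrix.gram ℝ (fun i => Y i x)) S :=
    continuousOn_pi.2 fun i => continuousOn_pi.2 fun j => continuousOn_inner (hY i) (hY j)
  have hdet : ContinuousOn (fun x => (Matrix.gram ℝ (fun i => Y i x)).det) S :=
    (continuous_id.matrix_det).comp_continuousOn hg
  have hadj : ContinuousOn (fun x => (Matrix.gram ℝ (fun i => Y i x)).adjugate) S :=
    (continuous_id.matrix_adjugate).comp_continuousOn hg
  simp only [Matrix.inv_def, Ring.inverse_eq_inv']
  exact (hdet.inv₀ fun x hx =>
    Matrix.det_gram_ne_zero_iff_linearIndependent.2 (hli x hx)).smul hadj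

end Continuity

/-! ### Regularity of tangent maps along sections -/

section TangentMaps

variable {E : Type*} [NormedAddCommGroup E] [NormedSpace ℝ E] {H : Type*} [TopologicalSpace H]
  {I : ModelWithCorners ℝ E H} {N : Type*} [TopologicalSpace N] [ChartedSpace H N]
  [IsManifold I 1 N]
  {E' : Type*} [NormedAddCommGroup E'] [NormedSpace ℝ E'] {H' : Type*} [TopologicalSpace H']
  {I' : ModelWithCorners ℝ E' H'} {N' : Type*} [TopologicalSpace N'] [ChartedSpace H' N']
  [IsManifold I' 1 N']
  {E'' : Type*} [NormedAddCommGroup E''] [NormedSpace ℝ E''] {H'' : Type*} [TopologicalSpace H'']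
  {J : ModelWithCorners ℝ E'' H''} {P : Type*} [TopologicalSpace P] [ChartedSpace H'' P]

/-- The section `s` is parametrized by a third manifold, so that its base point may move through an
inverse chart or through `Φ.symm`. One derivative is lost to the differential of `f`. -/
lemma contMDiffOn_tangentMap_comp {f : N → N'} {U : Set N} {S : Set P} {m k : WithTop ℕ∞}
    {s : P → TangentBundle I N} (hf : ContMDiffOn I I' k f U) (hU : IsOpen U) (hmk : m + 1 ≤ k)
    (hs : ContMDiffOn J I.tangent m s S) (hsU : ∀ z ∈ S, (s z).1 ∈ U) :
    ContMDiffOn J I'.tangent m (fun z => tangentMap I I' f (s z)) S := by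
  refine ((hf.contMDiffOn_tangentMapWithin hmk hU.uniqueMDiffOn).comp hs hsU).congr
    fun z hz => ?_
  simp only [Function.comp_apply, tangentMapWithin, tangentMap]
  rw [mfderivWithin_of_isOpen hU (hsU z hz)]

lemma contMDiffOn_mfderiv_apply {F : Type*} [NormedAddCommGroup F] [NormedSpace ℝ F]
    {f : N → F} {U : Set N} {S : Set P} {m k : WithTop ℕ∞}
    {s : P → TangentBundle I N} (hf : ContMDiffOn I 𝓘(ℝ, F) k f U) (hU : IsOpen U)
    (hmk : m + 1 ≤ k) (hs : ContMDiffOn J I.tangent m s S) (hsU : ∀ z ∈ S, (s z).1 ∈ U) :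
    ContMDiffOn J 𝓘(ℝ, F) m (fun z => (mfderiv I 𝓘(ℝ, F) f (s z).1 (s z).2 : F)) S :=
  (contMDiff_snd_tangentBundle_modelSpace F 𝓘(ℝ, F)).comp_contMDiffOn
    (contMDiffOn_tangentMap_comp hf hU hmk hs hsU)

end TangentMaps

lemma det_gram_pos {E ι : Type*} [NormedAddCommGroup E] [InnerProductSpace ℝ E] [Fintype ι]
    [DecidableEq ι] {v : ι → E} (hv : LinearIndependent ℝ v) : 0 < (Matrix.gram ℝ v).det :=
  (Matrix.posDef_gram_of_linearIndependent hv).det_pos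

/-! ### Coordinate vector fields and the density in a chart -/

section Charts

variable {n : ℕ} {M : Type*} [TopologicalSpace M] [ChartedSpace (EuclideanSpace ℝ (Fin n)) M]

lemma continuousOn_mfderiv_apply [IsManifold (𝓡 n) 2 M] {F : Type*} [NormedAddCommGroup F]
    [NormedSpace ℝ F] {f : M → F}
    {U : Set M} (hf : ContMDiffOn (𝓡 n) 𝓘(ℝ, F) 1 f U) (hU : IsOpen U)
    {X : ∀ x : M, TangentSpace (𝓡 n) x} (hX : ContinuousOn (toSection X) U) :
    ContinuousOn (fun x => (mfderiv (𝓡 n) 𝓘(ℝ, F) f x (X x) : F)) U := by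
  have := contMDiffOn_mfderiv_apply (J := 𝓡 n) (S := U) (m := 0) hf hU (by simp)
    (s := toSection X) (contMDiffOn_zero_iff.2 hX) (fun z hz => hz)
  exact this.continuousOn

/-- The coordinate vector fields along the inverse chart, as a map into the tangent bundle. -/
lemma contMDiffOn_coordVector [IsManifold (𝓡 n) 2 M] (x₀ : M) (i : Fin n) :
    ContMDiffOn (𝓡 n) (𝓡 n).tangent 1
      (fun y => (⟨(chartAt (EuclideanSpace ℝ (Fin n)) x₀).symm y, coordVector x₀ y i⟩ :
        TangentBundle (𝓡 n) M)) (chartAt (EuclideanSpace ℝ (Fin n)) x₀).target := by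
  have h := contMDiffOn_tangentMap_comp (J := 𝓡 n) (m := 1)
    (S := (chartAt (EuclideanSpace ℝ (Fin n)) x₀).target)
    (s := fun y => (⟨y, EuclideanSpace.single i (1 : ℝ)⟩ :
      TangentBundle (𝓡 n) (EuclideanSpace ℝ (Fin n))))
    (contMDiffOn_chart_symm (I := 𝓡 n) (n := 2) (x := x₀))
    (chartAt (EuclideanSpace ℝ (Fin n)) x₀).open_target (by norm_num) ?_ (fun z hz => hz)
  · exact h
  · exact (contMDiff_vectorSpace_iff_contDiff.2 contDiff_const).contMDiffOn

lemma mfderiv_chart_symm_injective [IsManifold (𝓡 n) 2 M] (x₀ : M) {y : EuclideanSpace ℝ (Fin n)}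
    (hy : y ∈ (chartAt (EuclideanSpace ℝ (Fin n)) x₀).target) :
    Function.Injective
      (mfderiv (𝓡 n) (𝓡 n) (chartAt (EuclideanSpace ℝ (Fin n)) x₀).symm y) :=
  (mdifferentiable_chart (I := 𝓡 n) x₀).symm.mfderiv_injective hy

lemma linearIndependent_coordVector [IsManifold (𝓡 n) 2 M] (x₀ : M)
    {y : EuclideanSpace ℝ (Fin n)}
    (hy : y ∈ (chartAt (EuclideanSpace ℝ (Fin n)) x₀).target) :
    LinearIndependent ℝ (coordVector x₀ y) := by
  have h : LinearIndependent ℝ fun i : Fin n => EuclideanSpace.single i (1 : ℝ) := by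
    have e : (fun i : Fin n => EuclideanSpace.single i (1 : ℝ)) =
        (EuclideanSpace.basisFun (Fin n) ℝ).toBasis := by
      ext1 i
      simp
    rw [e]
    exact (EuclideanSpace.basisFun (Fin n) ℝ).toBasis.linearIndependent
  exact h.map' (mfderiv (𝓡 n) (𝓡 n) (chartAt (EuclideanSpace ℝ (Fin n)) x₀).symm y).toLinearMap
    (LinearMap.ker_eq_bot.2 (mfderiv_chart_symm_injective x₀ hy))

lemma contDiffOn_coordField [IsManifold (𝓡 n) 2 M] (x₀ : M) {X : ∀ x : M, TangentSpace (𝓡 n) x}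
    {B : Set M}
    (hX : ContMDiffOn (𝓡 n) ((𝓡 n).prod 𝓘(ℝ, EuclideanSpace ℝ (Fin n))) 1 (toSection X) B) :
    ContDiffOn ℝ 1 (coordField x₀ X) ((chartAt (EuclideanSpace ℝ (Fin n)) x₀).target ∩
      (chartAt (EuclideanSpace ℝ (Fin n)) x₀).symm ⁻¹' B) := by
  have hsymm := contMDiffOn_chart_symm (I := 𝓡 n) (n := 2) (x := x₀)
  have h := contMDiffOn_mfderiv_apply (J := 𝓡 n) (m := 1)
    (S := (chartAt (EuclideanSpace ℝ (Fin n)) x₀).target ∩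
      (chartAt (EuclideanSpace ℝ (Fin n)) x₀).symm ⁻¹' B)
    (s := fun y => toSection X ((chartAt (EuclideanSpace ℝ (Fin n)) x₀).symm y))
    (contMDiffOn_chart (I := 𝓡 n) (n := 2) (x := x₀))
    (chartAt (EuclideanSpace ℝ (Fin n)) x₀).open_source (by norm_num)
    (hX.comp ((hsymm.of_le (by norm_num)).mono Set.inter_subset_left) fun y hy => hy.2)
    (fun z hz => (chartAt (EuclideanSpace ℝ (Fin n)) x₀).map_target hz.1)
  exact h.contDiffOn

variable [RiemannianBundle (fun x : M => TangentSpace (𝓡 n) x)]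

lemma det_gram_coordVector_pos [IsManifold (𝓡 n) 2 M] (x₀ : M) {y : EuclideanSpace ℝ (Fin n)}
    (hy : y ∈ (chartAt (EuclideanSpace ℝ (Fin n)) x₀).target) :
    0 < (Matrix.gram ℝ (coordVector x₀ y)).det :=

  det_gram_pos (linearIndependent_coordVector x₀ hy)

lemma chartDensity_pos [IsManifold (𝓡 n) 2 M] (x₀ : M) {y : EuclideanSpace ℝ (Fin n)}
    (hy : y ∈ (chartAt (EuclideanSpace ℝ (Fin n)) x₀).target) : 0 < chartDensity x₀ y :=
  Real.sqrt_pos.2 (det_gram_coordVector_pos x₀ hy)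

lemma contDiffOn_chartDensity [IsManifold (𝓡 n) 2 M]
    [IsContMDiffRiemannianBundle (𝓡 n) 1 (EuclideanSpace ℝ (Fin n))
      (fun x : M => TangentSpace (𝓡 n) x)] (x₀ : M) :
    ContDiffOn ℝ 1 (chartDensity x₀) (chartAt (EuclideanSpace ℝ (Fin n)) x₀).target := by
  have : IsManifold (𝓡 n) (1 + 1) M := by norm_num; infer_instance
  have hg : ∀ i j, ContDiffOn ℝ 1
      (fun y => inner ℝ (coordVector x₀ y i) (coordVector x₀ y j))
      (chartAt (EuclideanSpace ℝ (Fin n)) x₀).target := fun i j =>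
    (ContMDiffOn.inner_bundle (contMDiffOn_coordVector x₀ i)
      (contMDiffOn_coordVector x₀ j)).contDiffOn
  have hdet : ContDiffOn ℝ 1 (fun y => (Matrix.gram ℝ (coordVector x₀ y)).det)
      (chartAt (EuclideanSpace ℝ (Fin n)) x₀).target := by
    simp only [Matrix.det_apply]
    refine ContDiffOn.sum fun σ _ => ContDiffOn.const_smul _ (contDiffOn_prod fun i _ => hg _ _)
  exact hdet.sqrt fun y hy => (det_gram_coordVector_pos x₀ hy).ne'

end Charts

lemma gram_sum_smul {E ι : Type*} [NormedAddCommGroup E] [InnerProductSpace ℝ E] [Fintype ι]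
    (w : ι → E) (J : Matrix ι ι ℝ) :
    Matrix.gram ℝ (fun i => ∑ k, J k i • w k) = J.transpose * Matrix.gram ℝ w * J := by
  ext i j
  simp only [Matrix.gram_apply, Matrix.mul_apply, Matrix.transpose_apply, sum_inner, inner_sum,
    inner_smul_left, inner_smul_right, Finset.sum_mul, conj_trivial]
  refine Finset.sum_congr rfl fun a _ => ?_
  rw [Finset.mul_sum]
  refine Finset.sum_congr rfl fun b _ => ?_
  rw [real_inner_comm]
  ring

/-! ### The Riemannian volume measure -/

section Measure

variable {n : ℕ} {M : Type*} [TopologicalSpace M] [ChartedSpace (EuclideanSpace ℝ (Fin n)) M]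

lemma measurableSet_target (x₀ : M) :
    MeasurableSet (chartAt (EuclideanSpace ℝ (Fin n)) x₀).target :=
  (chartAt (EuclideanSpace ℝ (Fin n)) x₀).open_target.measurableSet

lemma measurableSet_source [MeasurableSpace M] [BorelSpace M] (x₀ : M) :
    MeasurableSet (chartAt (EuclideanSpace ℝ (Fin n)) x₀).source :=
  (chartAt (EuclideanSpace ℝ (Fin n)) x₀).open_source.measurableSet

lemma measurableSet_target_inter_preimage [MeasurableSpace M] [BorelSpace M] (x₀ : M) {A : Set M}
    (hA : MeasurableSet A) :
    MeasurableSet ((chartAt (EuclideanSpace ℝ (Fin n)) x₀).target ∩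
      (chartAt (EuclideanSpace ℝ (Fin n)) x₀).symm ⁻¹' A) := by
  have h := (chartAt (EuclideanSpace ℝ (Fin n)) x₀).continuousOn_symm.domRestrict.measurable hA
  convert (measurableSet_target x₀).subtype_image h using 1
  ext y
  simp [and_comm]

variable
  [RiemannianBundle (fun x : M => TangentSpace (𝓡 n) x)]

/-- Gram matrices from two charts live in tangent spaces at base points that are only
propositionally equal. The free point `x` puts both into one inner product space. -/
lemma chartDensity_eq_sqrt_det_gram (x₀ : M) (y : EuclideanSpace ℝ (Fin n)) {x : M}
    (_ : (chartAt (EuclideanSpace ℝ (Fin n)) x₀).symm y = x) :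
    chartDensity x₀ y = Real.sqrt (Matrix.gram (E := TangentSpace (𝓡 n) x) ℝ fun i : Fin n =>
      ((mfderiv (𝓡 n) (𝓡 n) (chartAt (EuclideanSpace ℝ (Fin n)) x₀).symm y
        (EuclideanSpace.single i (1 : ℝ)) : EuclideanSpace ℝ (Fin n)) :
          TangentSpace (𝓡 n) x)).det := by
  subst x
  rfl

/-- By the chain rule the two coordinate frames differ by the Jacobian `J` of the transition map, so
the Gram matrices satisfy G₀ = Jᵀ G₁ J; take square roots of determinants. -/
lemma chartDensity_eq_abs_det_mul [IsManifold (𝓡 n) 2 M] (x₀ x₁ : M)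
    {y : EuclideanSpace ℝ (Fin n)}
    (hy : y ∈ (chartAt (EuclideanSpace ℝ (Fin n)) x₀).target)
    (hy' : (chartAt (EuclideanSpace ℝ (Fin n)) x₀).symm y ∈
      (chartAt (EuclideanSpace ℝ (Fin n)) x₁).source) :
    chartDensity x₀ y = |(fderiv ℝ (chartAt (EuclideanSpace ℝ (Fin n)) x₁ ∘
        (chartAt (EuclideanSpace ℝ (Fin n)) x₀).symm) y).det| *
      chartDensity x₁ (chartAt (EuclideanSpace ℝ (Fin n)) x₁
        ((chartAt (EuclideanSpace ℝ (Fin n)) x₀).symm y)) := by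
  set φ₀ := chartAt (EuclideanSpace ℝ (Fin n)) x₀
  set φ₁ := chartAt (EuclideanSpace ℝ (Fin n)) x₁
  set T := φ₁ ∘ φ₀.symm
  have hx : φ₁.symm (T y) = φ₀.symm y := φ₁.left_inv hy'
  have hd₀ := (mdifferentiable_chart (I := 𝓡 n) x₀).mdifferentiableAt_symm hy
  have hd₁ := (mdifferentiable_chart (I := 𝓡 n) x₁).mdifferentiableAt hy'
  have hd₁' := (mdifferentiable_chart (I := 𝓡 n) x₁).mdifferentiableAt_symm
    (φ₁.map_source hy')
  have hT : MDifferentiableAt (𝓡 n) (𝓡 n) T y := hd₁.comp y hd₀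
  have hev : φ₀.symm =ᶠ[𝓝 y] φ₁.symm ∘ T := by
    have : φ₀.symm ⁻¹' φ₁.source ∈ 𝓝 y :=
      (φ₀.continuousAt_symm hy).preimage_mem_nhds (φ₁.open_source.mem_nhds hy')
    filter_upwards [this] with z hz
    exact (φ₁.left_inv hz).symm
  have hchain : ∀ v : EuclideanSpace ℝ (Fin n),
      (mfderiv (𝓡 n) (𝓡 n) φ₀.symm y v : EuclideanSpace ℝ (Fin n)) =
      (mfderiv (𝓡 n) (𝓡 n) φ₁.symm (T y) (fderiv ℝ T y v) : EuclideanSpace ℝ (Fin n)) := by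
    intro v
    have h1 : (mfderiv (𝓡 n) (𝓡 n) φ₀.symm y :
        EuclideanSpace ℝ (Fin n) →L[ℝ] EuclideanSpace ℝ (Fin n)) =
        mfderiv (𝓡 n) (𝓡 n) (φ₁.symm ∘ T) y := hev.mfderiv_eq
    have h2 := mfderiv_comp y hd₁' hT
    have h3 : mfderiv (𝓡 n) (𝓡 n) T y = fderiv ℝ T y := mfderiv_eq_fderiv
    rw [h3] at h2
    exact (congrArg (fun A : EuclideanSpace ℝ (Fin n) →L[ℝ] EuclideanSpace ℝ (Fin n) => A v)
      (h1.trans h2))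
  set J : Matrix (Fin n) (Fin n) ℝ := LinearMap.toMatrix (EuclideanSpace.basisFun (Fin n) ℝ).toBasis
    (EuclideanSpace.basisFun (Fin n) ℝ).toBasis (fderiv ℝ T y).toLinearMap
  have hJ : J.det = (fderiv ℝ T y).det := LinearMap.det_toMatrix _ _
  change chartDensity x₀ y = _ * chartDensity x₁ (T y)
  rw [chartDensity_eq_sqrt_det_gram x₁ (T y) hx, chartDensity_eq_sqrt_det_gram x₀ y rfl]
  set w : Fin n → TangentSpace (𝓡 n) (φ₀.symm y) := fun i =>
    ((mfderiv (𝓡 n) (𝓡 n) φ₁.symm (T y)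
        (EuclideanSpace.single i (1 : ℝ)) : EuclideanSpace ℝ (Fin n)) :
          TangentSpace (𝓡 n) (φ₀.symm y))
  have hw : (fun i : Fin n => ((mfderiv (𝓡 n) (𝓡 n) φ₀.symm y
        (EuclideanSpace.single i (1 : ℝ)) : EuclideanSpace ℝ (Fin n)) :
          TangentSpace (𝓡 n) (φ₀.symm y))) = fun i => ∑ k, J k i • w k := by
    ext1 i
    rw [hchain]
    have h1 : fderiv ℝ T y (EuclideanSpace.single i 1) =
        ∑ k, J k i • EuclideanSpace.single k (1 : ℝ) := by
      rw [← (EuclideanSpace.basisFun (Fin n) ℝ).toBasis.sum_repr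
        (fderiv ℝ T y (EuclideanSpace.single i 1))]
      refine Finset.sum_congr rfl fun k _ => ?_
      simp [J, LinearMap.toMatrix_apply]
    rw [h1]
    have h2 := map_sum (mfderiv (𝓡 n) (𝓡 n) φ₁.symm (T y))
      (fun k => J k i • EuclideanSpace.single k (1 : ℝ)) Finset.univ
    refine Eq.trans h2 ?_
    refine Finset.sum_congr rfl fun k _ => ?_
    exact map_smul (mfderiv (𝓡 n) (𝓡 n) φ₁.symm (T y)) _ _
  rw [hw, gram_sum_smul, Matrix.det_mul, Matrix.det_mul, Matrix.det_transpose, hJ,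
    mul_right_comm, ← sq, Real.sqrt_mul (sq_nonneg _), Real.sqrt_sq_eq_abs]

variable [MeasurableSpace M] [BorelSpace M]

lemma aemeasurable_chart_symm (x₀ : M) {ν : Measure (EuclideanSpace ℝ (Fin n))} :
    AEMeasurable (chartAt (EuclideanSpace ℝ (Fin n)) x₀).symm
      ((ν.restrict (chartAt (EuclideanSpace ℝ (Fin n)) x₀).target).withDensity
      fun y => ENNReal.ofReal (chartDensity x₀ y)) :=
  ((chartAt (EuclideanSpace ℝ (Fin n)) x₀).continuousOn_symm.aemeasurable
    (measurableSet_target x₀)).mono_ac (withDensity_absolutelyContinuous _ _)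

lemma chartVolume_apply (x₀ : M) {A : Set M} (hA : MeasurableSet A) :
    chartVolume (n := n) x₀ A = ∫⁻ y in (chartAt (EuclideanSpace ℝ (Fin n)) x₀).target ∩
      (chartAt (EuclideanSpace ℝ (Fin n)) x₀).symm ⁻¹' A, ENNReal.ofReal (chartDensity x₀ y) := by
  have hm : NullMeasurableSet ((chartAt (EuclideanSpace ℝ (Fin n)) x₀).symm ⁻¹' A)
      (volume.restrict (chartAt (EuclideanSpace ℝ (Fin n)) x₀).target) :=
    ((chartAt (EuclideanSpace ℝ (Fin n)) x₀).continuousOn_symm.aemeasurable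
      (measurableSet_target x₀)).nullMeasurable hA
  rw [chartVolume, Measure.map_apply_of_aemeasurable (aemeasurable_chart_symm x₀) hA,
    withDensity_apply₀ _ hm, Measure.restrict_restrict₀ hm, Set.inter_comm]

lemma chartVolume_compl_source (x₀ : M) :
    chartVolume (n := n) x₀ (chartAt (EuclideanSpace ℝ (Fin n)) x₀).sourceᶜ = 0 := by
  rw [chartVolume_apply x₀ (measurableSet_source x₀).compl]
  have : (chartAt (EuclideanSpace ℝ (Fin n)) x₀).target ∩
      (chartAt (EuclideanSpace ℝ (Fin n)) x₀).symm ⁻¹'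
        (chartAt (EuclideanSpace ℝ (Fin n)) x₀).sourceᶜ = ∅ := by
    ext y
    simp only [Set.mem_inter_iff, Set.mem_preimage, Set.mem_compl_iff, Set.mem_empty_iff_false,
      iff_false, not_and, not_not]
    exact (chartAt (EuclideanSpace ℝ (Fin n)) x₀).map_target
  rw [this]
  simp

variable [IsManifold (𝓡 n) 2 M]

/-- The chart measures agree on overlaps. -/
lemma chartVolume_congr (x₀ x₁ : M) {A : Set M} (hA : MeasurableSet A)
    (h₀ : A ⊆ (chartAt (EuclideanSpace ℝ (Fin n)) x₀).source)
    (h₁ : A ⊆ (chartAt (EuclideanSpace ℝ (Fin n)) x₁).source) :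
    chartVolume (n := n) x₀ A = chartVolume (n := n) x₁ A := by
  rw [chartVolume_apply x₀ hA, chartVolume_apply x₁ hA]
  set φ₀ := chartAt (EuclideanSpace ℝ (Fin n)) x₀
  set φ₁ := chartAt (EuclideanSpace ℝ (Fin n)) x₁
  have him : φ₁.target ∩ φ₁.symm ⁻¹' A = (φ₁ ∘ φ₀.symm) '' (φ₀.target ∩ φ₀.symm ⁻¹' A) := by
    ext z
    constructor
    · rintro ⟨hz, hzA⟩
      refine ⟨φ₀ (φ₁.symm z), ⟨φ₀.map_source (h₀ hzA), ?_⟩, ?_⟩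
      · simpa [φ₀.left_inv (h₀ hzA)] using hzA
      · simp [φ₀.left_inv (h₀ hzA), φ₁.right_inv hz]
    · rintro ⟨y, ⟨hy, hyA⟩, rfl⟩
      exact ⟨φ₁.map_source (h₁ hyA), by simpa [φ₁.left_inv (h₁ hyA)] using hyA⟩
  have hmeas : MeasurableSet (φ₀.target ∩ φ₀.symm ⁻¹' A) :=
    measurableSet_target_inter_preimage x₀ hA
  rw [him, lintegral_image_eq_lintegral_abs_det_fderiv_mul volume hmeas
    (f' := fun y => fderiv ℝ (φ₁ ∘ φ₀.symm) y)]
  · refine setLIntegral_congr_fun hmeas fun y hy => ?_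
    rw [chartDensity_eq_abs_det_mul x₀ x₁ hy.1 (h₁ hy.2), ENNReal.ofReal_mul (abs_nonneg _)]
    rfl
  · intro y hy
    have hd₀ := (mdifferentiable_chart (I := 𝓡 n) x₀).mdifferentiableAt_symm hy.1
    have hd₁ := (mdifferentiable_chart (I := 𝓡 n) x₁).mdifferentiableAt (h₁ hy.2)
    have hT : MDifferentiableAt (𝓡 n) (𝓡 n) (φ₁ ∘ φ₀.symm) y := hd₁.comp y hd₀
    exact hT.differentiableAt.hasFDerivAt.hasFDerivWithinAt
  · intro y hy z hz h
    have h2 : φ₀.symm y = φ₀.symm z := φ₁.injOn (h₁ hy.2) (h₁ hz.2) h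
    exact φ₀.symm.injOn hy.1 hz.1 h2

/-- This is what makes the supremum of the chart measures the right definition: on a chart domain no
other chart measure contributes more, as they agree on overlaps and each vanishes off its own
domain. -/
lemma riemannianVolume_restrict_source (x₀ : M) :
    (riemannianVolume n M).restrict (chartAt (EuclideanSpace ℝ (Fin n)) x₀).source =
      chartVolume (n := n) x₀ := by
  set U := (chartAt (EuclideanSpace ℝ (Fin n)) x₀).source
  have hU : MeasurableSet U := measurableSet_source x₀
  have hres : (chartVolume (n := n) x₀).restrict U = chartVolume (n := n) x₀ :=
    Measure.restrict_eq_self_of_ae_mem (by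
      rw [ae_iff]; exact chartVolume_compl_source x₀)
  apply le_antisymm
  -- An upper bound for the supremum must be a measure dominating every chart measure globally; off
  -- `U` the infinite measure `⊤` serves, and it disappears on restriction to `U`.
  · have hle : riemannianVolume n M ≤ chartVolume (n := n) x₀ + (⊤ : Measure M).restrict Uᶜ := by
      refine iSup_le fun x₁ => Measure.le_iff.2 fun A hA => ?_
      set V := (chartAt (EuclideanSpace ℝ (Fin n)) x₁).source
      have hV : MeasurableSet V := measurableSet_source x₁
      rw [← measure_inter_add_sdiff A hU, Measure.add_apply]
      refine add_le_add ?_ ?_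
      · calc chartVolume (n := n) x₁ (A ∩ U)
            ≤ chartVolume (n := n) x₁ (A ∩ U ∩ V) + chartVolume (n := n) x₁ Vᶜ := by
              refine (measure_mono ?_).trans (measure_union_le _ _)
              intro z hz
              by_cases hzV : z ∈ V
              · exact Or.inl ⟨hz, hzV⟩
              · exact Or.inr hzV
          _ = chartVolume (n := n) x₀ (A ∩ U ∩ V) := by
              rw [chartVolume_compl_source x₁, add_zero]
              exact chartVolume_congr x₁ x₀ ((hA.inter hU).inter hV) (fun z hz => hz.2)
                fun z hz => hz.1.2
          _ ≤ chartVolume (n := n) x₀ A := measure_mono fun z hz => hz.1.1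
      · rw [Measure.restrict_apply hA, ← Set.sdiff_eq]
        exact (le_top : chartVolume (n := n) x₁ ≤ ⊤) _
    refine (Measure.restrict_mono le_rfl hle).trans ?_
    rw [Measure.restrict_add, hres, Measure.restrict_restrict hU, Set.inter_compl_self,
      Measure.restrict_empty, add_zero]
  · rw [← hres]
    exact Measure.restrict_mono le_rfl (le_iSup (fun x : M => chartVolume (n := n) x) x₀)

lemma riemannianVolume_apply_of_subset (x₀ : M) {A : Set M} (hA : MeasurableSet A)
    (h : A ⊆ (chartAt (EuclideanSpace ℝ (Fin n)) x₀).source) :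
    riemannianVolume n M A = ∫⁻ y in (chartAt (EuclideanSpace ℝ (Fin n)) x₀).target ∩
      (chartAt (EuclideanSpace ℝ (Fin n)) x₀).symm ⁻¹' A, ENNReal.ofReal (chartDensity x₀ y) := by
  rw [← chartVolume_apply x₀ hA, ← riemannianVolume_restrict_source, Measure.restrict_apply hA,
    Set.inter_eq_self_of_subset_left h]

variable [IsContMDiffRiemannianBundle (𝓡 n) 1 (EuclideanSpace ℝ (Fin n))
  (fun x : M => TangentSpace (𝓡 n) x)]

lemma aemeasurable_chartDensity (x₀ : M) :
    AEMeasurable (fun y => ENNReal.ofReal (chartDensity x₀ y))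
      (volume.restrict (chartAt (EuclideanSpace ℝ (Fin n)) x₀).target) :=
  (((contDiffOn_chartDensity x₀).continuousOn.aemeasurable
    (measurableSet_target x₀))).ennreal_ofReal

instance isLocallyFiniteMeasure_riemannianVolume :
    IsLocallyFiniteMeasure (riemannianVolume n M) := by
  refine ⟨fun x => ?_⟩
  set φ := chartAt (EuclideanSpace ℝ (Fin n)) x
  have hx : φ x ∈ φ.target := mem_chart_target _ x
  have hc : ContinuousAt (chartDensity x) (φ x) :=
    (contDiffOn_chartDensity x).continuousOn.continuousAt (φ.open_target.mem_nhds hx)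
  have h1 : ∀ᶠ y in 𝓝 (φ x), chartDensity x y < chartDensity x (φ x) + 1 :=
    hc.eventually_lt continuousAt_const (by linarith)
  obtain ⟨ε, hε, hball⟩ := Metric.mem_nhds_iff.1 (h1.and (φ.open_target.mem_nhds hx))
  refine ⟨φ.source ∩ φ ⁻¹' Metric.ball (φ x) ε,
    Filter.inter_mem (chart_source_mem_nhds _ x)
      ((φ.continuousAt (mem_chart_source _ x)).preimage_mem_nhds (Metric.ball_mem_nhds _ hε)), ?_⟩
  rw [riemannianVolume_apply_of_subset x
    ((φ.isOpen_inter_preimage Metric.isOpen_ball).measurableSet) Set.inter_subset_left]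
  have hsub : φ.target ∩ φ.symm ⁻¹' (φ.source ∩ φ ⁻¹' Metric.ball (φ x) ε) ⊆
      Metric.ball (φ x) ε := by
    rintro y ⟨hy, -, hy2⟩
    simpa [φ.right_inv hy] using hy2
  calc _ ≤ ∫⁻ y in Metric.ball (φ x) ε, ENNReal.ofReal (chartDensity x y) :=
        lintegral_mono_set hsub
    _ ≤ ∫⁻ y in Metric.ball (φ x) ε, ENNReal.ofReal (chartDensity x (φ x) + 1) := by
        refine setLIntegral_mono' Metric.isOpen_ball.measurableSet fun y hy => ?_
        exact ENNReal.ofReal_le_ofReal (hball hy).1.le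
    _ < ⊤ := by
        rw [setLIntegral_const]
        exact ENNReal.mul_lt_top ENNReal.ofReal_lt_top Metric.isBounded_ball.measure_lt_top

/-- Needed to detect a nonzero continuous function by an integral, both for the chart independence
of the divergence and for an admissible Rayleigh quotient. -/
instance isOpenPosMeasure_riemannianVolume :
    (riemannianVolume n M).IsOpenPosMeasure := by
  refine ⟨fun U hU hne h0 => ?_⟩
  obtain ⟨x, hx⟩ := hne
  set φ := chartAt (EuclideanSpace ℝ (Fin n)) x
  have h1 : riemannianVolume n M (φ.source ∩ U) = 0 :=
    measure_mono_null Set.inter_subset_right h0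
  rw [riemannianVolume_apply_of_subset x (φ.open_source.inter hU).measurableSet
    Set.inter_subset_left] at h1
  have hopen : IsOpen (φ.target ∩ φ.symm ⁻¹' (φ.source ∩ U)) :=
    φ.isOpen_inter_preimage_symm (φ.open_source.inter hU)
  have hpos : volume (φ.target ∩ φ.symm ⁻¹' (φ.source ∩ U)) ≠ 0 :=
    hopen.measure_ne_zero _ ⟨φ x, mem_chart_target _ x, by
      simp [φ, hx]⟩
  rw [lintegral_eq_zero_iff'] at h1
  · have := ae_neBot.2 (mt Measure.restrict_eq_zero.1 hpos)
    obtain ⟨y, hy1, hy2⟩ := (h1.and (ae_restrict_mem hopen.measurableSet)).exists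
    have := chartDensity_pos x hy2.1
    simp only [Pi.zero_apply, ENNReal.ofReal_eq_zero] at hy1
    linarith
  · exact (aemeasurable_chartDensity x).mono_measure
      (Measure.restrict_mono Set.inter_subset_left le_rfl)

/-- Makes the centre `p`, where `rho` need not be differentiable, negligible. In dimension zero
points have positive volume, hence `1 ≤ n`. -/
lemma riemannianVolume_singleton (hn : 1 ≤ n) (x : M) [T1Space M] :
    riemannianVolume n M {x} = 0 := by
  rw [riemannianVolume_apply_of_subset x (measurableSet_singleton x)
    (Set.singleton_subset_iff.2 (mem_chart_source _ x))]
  set φ := chartAt (EuclideanSpace ℝ (Fin n)) x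
  have hsub : φ.target ∩ φ.symm ⁻¹' {x} ⊆ {φ x} := by
    rintro y ⟨hy, hy2⟩
    rw [Set.mem_preimage, Set.mem_singleton_iff] at hy2
    simp [← hy2, φ.right_inv hy]
  have : Nonempty (Fin n) := ⟨⟨0, hn⟩⟩
  have h0 : (volume : Measure (EuclideanSpace ℝ (Fin n))) (φ.target ∩ φ.symm ⁻¹' {x}) = 0 :=
    measure_mono_null hsub (measure_singleton _)
  exact setLIntegral_measure_zero _ _ h0

end Measure

/-! ### Covector inner products in a continuous frame -/

section Frames

variable {n : ℕ} {M : Type*} [TopologicalSpace M] [ChartedSpace (EuclideanSpace ℝ (Fin n)) M]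
  [RiemannianBundle (fun x : M => TangentSpace (𝓡 n) x)] [IsManifold (𝓡 n) 2 M]
  [IsContMDiffRiemannianBundle (𝓡 n) 1 (EuclideanSpace ℝ (Fin n))
      (fun x : M => TangentSpace (𝓡 n) x)]

/-- Expresses the inner product by pairings with a continuous frame and the inverse Gram matrix, all
of which are continuous or measurable in `x`; the defining sum over `stdOrthonormalBasis` shows
neither. -/
lemma covectorInner_eq_gram_of_frame {ι : Type*} [Fintype ι] [DecidableEq ι] {S : Set M}
    {Y : ι → ∀ x : M, TangentSpace (𝓡 n) x}
    (hYb : ∀ x ∈ S, ∃ b : Module.Basis ι ℝ (TangentSpace (𝓡 n) x), ∀ i, b i = Y i x)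
    {α β : ∀ x : M, TangentSpace (𝓡 n) x →L[ℝ] ℝ} {x : M} (hx : x ∈ S) :
    covectorInner (α x) (β x) = ∑ i, α x (Y i x) *
      ∑ j, (Matrix.gram ℝ (fun i => Y i x))⁻¹ i j * β x (Y j x) := by
  obtain ⟨b, hb⟩ := hYb x hx
  rw [covectorInner_eq_gram b]
  have : (b : ι → TangentSpace (𝓡 n) x) = fun i => Y i x := funext hb
  rw [this]
  rfl

lemma continuousOn_gram_inv_of_frame {ι : Type*} [Fintype ι] [DecidableEq ι] {S : Set M}
    {Y : ι → ∀ x : M, TangentSpace (𝓡 n) x} (hY : ∀ i, ContinuousOn (toSection (Y i)) S)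
    (hYb : ∀ x ∈ S, ∃ b : Module.Basis ι ℝ (TangentSpace (𝓡 n) x), ∀ i, b i = Y i x) (i j : ι) :
    ContinuousOn (fun x => (Matrix.gram ℝ (fun i => Y i x))⁻¹ i j) S := by
  have h := continuousOn_gram_inv hY fun x hx => by
    obtain ⟨b, hb⟩ := hYb x hx
    have : (fun i => Y i x) = b := (funext hb).symm
    rw [this]
    exact b.linearIndependent
  exact continuousOn_pi.1 (continuousOn_pi.1 h i) j

lemma continuousOn_covectorInner_of_frame {ι : Type*} [Fintype ι] {S : Set M}
    {Y : ι → ∀ x : M, TangentSpace (𝓡 n) x} (hY : ∀ i, ContinuousOn (toSection (Y i)) S)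
    (hYb : ∀ x ∈ S, ∃ b : Module.Basis ι ℝ (TangentSpace (𝓡 n) x), ∀ i, b i = Y i x)
    {α β : ∀ x : M, TangentSpace (𝓡 n) x →L[ℝ] ℝ}
    (hα : ∀ i, ContinuousOn (fun x => α x (Y i x)) S)
    (hβ : ∀ i, ContinuousOn (fun x => β x (Y i x)) S) :
    ContinuousOn (fun x => covectorInner (α x) (β x)) S := by
  classical
  refine ContinuousOn.congr ?_ fun x hx => covectorInner_eq_gram_of_frame hYb hx
  refine continuousOn_finsetSum _ fun i _ => (hα i).mul ?_
  exact continuousOn_finsetSum _ fun j _ => (continuousOn_gram_inv_of_frame hY hYb i j).mul (hβ j)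

lemma aestronglyMeasurable_covectorInner_of_frame [MeasurableSpace M] [BorelSpace M]
    {ι : Type*} [Fintype ι] {S : Set M} (hS : MeasurableSet S) {μ : Measure M}
    {Y : ι → ∀ x : M, TangentSpace (𝓡 n) x} (hY : ∀ i, ContinuousOn (toSection (Y i)) S)
    (hYb : ∀ x ∈ S, ∃ b : Module.Basis ι ℝ (TangentSpace (𝓡 n) x), ∀ i, b i = Y i x)
    {α β : ∀ x : M, TangentSpace (𝓡 n) x →L[ℝ] ℝ}
    (hα : ∀ i, AEStronglyMeasurable (fun x => α x (Y i x)) (μ.restrict S))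
    (hβ : ∀ i, AEStronglyMeasurable (fun x => β x (Y i x)) (μ.restrict S)) :
    AEStronglyMeasurable (fun x => covectorInner (α x) (β x)) (μ.restrict S) := by
  classical
  have h : AEStronglyMeasurable (fun x => ∑ i, α x (Y i x) *
      ∑ j, (Matrix.gram ℝ (fun i => Y i x))⁻¹ i j * β x (Y j x)) (μ.restrict S) := by
    refine Finset.aestronglyMeasurable_fun_sum _ fun i _ => (hα i).mul ?_
    exact Finset.aestronglyMeasurable_fun_sum _ fun j _ =>
      ((continuousOn_gram_inv_of_frame hY hYb i j).aemeasurable hS).aestronglyMeasurable.mul (hβ j)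
  refine h.congr ?_
  filter_upwards [ae_restrict_mem hS] with x hx
  exact (covectorInner_eq_gram_of_frame hYb hx).symm

end Frames

/-! ### Exponential coordinates and the distance function -/

namespace IsExpDiffeo

variable {n : ℕ} {M : Type*} [TopologicalSpace M] [ChartedSpace (EuclideanSpace ℝ (Fin n)) M]
  [RiemannianBundle (fun x : M => TangentSpace (𝓡 n) x)]
  {p : M} {R r : ℝ} {Φ : OpenPartialHomeomorph (TangentSpace (𝓡 n) p) M}

/-- The vector field obtained by pushing forward a constant vector by the exponential map. -/
def _root_.GeodesicBall.pushforward (Φ : OpenPartialHomeomorph (TangentSpace (𝓡 n) p) M)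
    (v : TangentSpace (𝓡 n) p) (x : M) : TangentSpace (𝓡 n) x :=
  (mfderiv 𝓘(ℝ, TangentSpace (𝓡 n) p) (𝓡 n) Φ (Φ.symm x) v : EuclideanSpace ℝ (Fin n))

section

variable (hΦ : IsExpDiffeo p R Φ)
include hΦ

lemma mem_source {v : TangentSpace (𝓡 n) p} : v ∈ Φ.source ↔ ‖v‖ < R := by
  rw [hΦ.source_eq, mem_ball_zero_iff]

lemma riemannianEDist_eq {v : TangentSpace (𝓡 n) p} (hv : ‖v‖ < R) :
    riemannianEDist (𝓡 n) p (Φ v) = ENNReal.ofReal ‖v‖ := by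
  have h := hΦ.minimizing v (by simpa using hv) 0 (by simp) 1 (by simp)
  simpa [hΦ.map_zero] using h

lemma rho_apply {v : TangentSpace (𝓡 n) p} (hv : ‖v‖ < R) : rho (n := n) p (Φ v) = ‖v‖ := by
  rw [rho, hΦ.riemannianEDist_eq hv, ENNReal.toReal_ofReal (norm_nonneg v)]

lemma norm_symm_lt {x : M} (hx : x ∈ Φ.target) : ‖Φ.symm x‖ < R :=
  hΦ.mem_source.1 (Φ.map_target hx)

lemma rho_eq_norm_symm {x : M} (hx : x ∈ Φ.target) : rho (n := n) p x = ‖Φ.symm x‖ := by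
  conv_lhs => rw [← Φ.right_inv hx]
  exact hΦ.rho_apply (hΦ.norm_symm_lt hx)

lemma center_mem_target (hR : 0 < R) : p ∈ Φ.target := by
  have h : (0 : TangentSpace (𝓡 n) p) ∈ Φ.source := hΦ.mem_source.2 (by simpa using hR)
  simpa [hΦ.map_zero] using Φ.map_source h

lemma symm_center (hR : 0 < R) : Φ.symm p = 0 := by
  have h : (0 : TangentSpace (𝓡 n) p) ∈ Φ.source := hΦ.mem_source.2 (by simpa using hR)
  simpa [hΦ.map_zero] using Φ.left_inv h

lemma symm_ne_zero {x : M} (hx : x ∈ Φ.target) (hxp : x ≠ p) :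
    Φ.symm x ≠ 0 := by
  intro h
  apply hxp
  rw [← Φ.right_inv hx, h, hΦ.map_zero]

/-- A geodesic ball within the injectivity radius is the image of a Euclidean ball. -/
lemma geodBall_eq_image [IsManifold (𝓡 n) 2 M]
    [IsContMDiffRiemannianBundle (𝓡 n) 1 (EuclideanSpace ℝ (Fin n))
      (fun x : M => TangentSpace (𝓡 n) x)] [T2Space M] (hr : 0 < r) (hrR : r < R) :
    geodBall n p r = Φ '' Metric.ball 0 r := by
  have hball : Metric.ball (0 : TangentSpace (𝓡 n) p) r ⊆ Φ.source := fun v hv =>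
    hΦ.mem_source.2 ((mem_ball_zero_iff.1 hv).trans hrR)
  have hcball : Metric.closedBall (0 : TangentSpace (𝓡 n) p) r ⊆ Φ.source := fun v hv =>
    hΦ.mem_source.2 ((mem_closedBall_zero_iff.1 hv).trans_lt hrR)
  apply Set.Subset.antisymm
  · intro x hx
    by_contra hxU
    -- A point at distance less than `r` is joined to `p` by a curve of length less than `r`. If it
    -- lay outside the image, the curve would cross the image of the sphere of radius `r`, whose
    -- points have distance exactly `r`.
    obtain ⟨γ, hγ0, hγ1, hγ, hlen⟩ := exists_lt_of_riemannianEDist_lt hx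
    have hγc : ContinuousOn γ (Set.Icc 0 1) := hγ.continuousOn
    have hconn : IsPreconnected (γ '' Set.Icc 0 1) := isPreconnected_Icc.image _ hγc
    have hU : IsOpen (Φ '' Metric.ball 0 r) :=
      Φ.isOpen_image_of_subset_source Metric.isOpen_ball hball
    have hV : IsOpen (Φ '' Metric.closedBall 0 r)ᶜ :=
      ((isCompact_closedBall _ _).image_of_continuousOn
        (Φ.continuousOn.mono hcball)).isClosed.isOpen_compl
    -- Otherwise the connected curve would be covered by two disjoint open sets, the image of the
    -- open ball and the complement of the image of the closed ball. The latter is open because the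
    -- closed ball is compact and, as `r < R`, inside the source.
    have hsphere : ∃ t ∈ Set.Icc (0 : ℝ) 1, ∃ w : TangentSpace (𝓡 n) p, ‖w‖ = r ∧ Φ w = γ t := by
      by_contra hcon
      push Not at hcon
      have hcover : γ '' Set.Icc 0 1 ⊆ Φ '' Metric.ball 0 r ∪ (Φ '' Metric.closedBall 0 r)ᶜ := by
        rintro _ ⟨t, ht, rfl⟩
        by_cases h : γ t ∈ Φ '' Metric.closedBall 0 r
        · obtain ⟨w, hw, hwt⟩ := h
          refine Or.inl ⟨w, mem_ball_zero_iff.2 (lt_of_le_of_ne (mem_closedBall_zero_iff.1 hw) ?_),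
            hwt⟩
          exact fun h => hcon t ht w h hwt
        · exact Or.inr h
      obtain ⟨z, -, hzU, hzV⟩ := hconn _ _ hU hV hcover
        ⟨γ 0, ⟨0, by simp, rfl⟩, 0, by simpa using hr, by rw [hΦ.map_zero, hγ0]⟩
        ⟨γ 1, ⟨1, by simp, rfl⟩, by
          rcases hcover ⟨1, by simp, rfl⟩ with h | h
          · rw [hγ1] at h; exact absurd h hxU
          · exact h⟩
      exact hzV (Set.image_mono Metric.ball_subset_closedBall hzU)
    obtain ⟨t, ht, w, hw, hwt⟩ := hsphere
    have h1 : riemannianEDist (𝓡 n) p (γ t) = ENNReal.ofReal r := by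
      rw [← hwt, hΦ.riemannianEDist_eq (by rw [hw]; exact hrR), hw]
    have h2 : riemannianEDist (𝓡 n) p (γ t) ≤ pathELength (𝓡 n) γ 0 t :=
      riemannianEDist_le_pathELength (hγ.mono (Set.Icc_subset_Icc_right ht.2)) hγ0 rfl ht.1
    have h3 : pathELength (𝓡 n) γ 0 t ≤ pathELength (𝓡 n) γ 0 1 := pathELength_mono le_rfl ht.2
    exact absurd (h1 ▸ h2.trans h3) (not_le.2 hlen)
  · rintro _ ⟨v, hv, rfl⟩
    have hv' := mem_ball_zero_iff.1 hv
    change riemannianEDist (𝓡 n) p (Φ v) < _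
    rw [hΦ.riemannianEDist_eq (hv'.trans hrR)]
    exact (ENNReal.ofReal_lt_ofReal_iff hr).2 hv'

lemma contMDiffOn_rho : ContMDiffOn (𝓡 n) 𝓘(ℝ, ℝ) 1 (rho (n := n) p) (Φ.target \ {p}) := by
  have h : ContMDiffOn (𝓡 n) 𝓘(ℝ, ℝ) 1 (fun x => ‖Φ.symm x‖) (Φ.target \ {p}) := by
    intro x hx
    have h1 : ContMDiffAt 𝓘(ℝ, TangentSpace (𝓡 n) p) 𝓘(ℝ, ℝ) 1
        (fun v : TangentSpace (𝓡 n) p => ‖v‖) (Φ.symm x) :=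
      (contDiffAt_norm ℝ (hΦ.symm_ne_zero hx.1 hx.2)).contMDiffAt
    exact h1.comp_contMDiffWithinAt x ((hΦ.contMDiffOn_symm x hx.1).mono Set.sdiff_subset)
  exact h.congr fun x hx => hΦ.rho_eq_norm_symm hx.1

/-- As `Φ` is only C¹, its pushed-forward fields are only continuous. That suffices for a frame
against which covector fields are tested. -/
lemma continuousOn_pushforward [IsManifold (𝓡 n) 2 M] (v : TangentSpace (𝓡 n) p) :
    ContinuousOn (toSection (pushforward Φ v)) Φ.target := by
  have h := contMDiffOn_tangentMap_comp (J := 𝓡 n) (m := 0) (S := Φ.target)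
    (s := fun x => (⟨Φ.symm x, v⟩ : TangentBundle 𝓘(ℝ, TangentSpace (𝓡 n) p) _))
    hΦ.contMDiffOn Φ.open_source (by simp) ?_ (fun z hz => Φ.map_target hz)
  · refine h.continuousOn.congr fun x hx => ?_
    -- The tangent map lands over `Φ (Φ.symm x)`; this moves it to the equal base point `x`.
    have key : ∀ (a : M) (w : EuclideanSpace ℝ (Fin n)), a = x →
        (⟨x, w⟩ : TangentBundle (𝓡 n) M) = ⟨a, w⟩ := by
      rintro a w rfl; rfl
    exact key _ _ (Φ.right_inv hx)
  · have h1 : ContMDiff 𝓘(ℝ, TangentSpace (𝓡 n) p) 𝓘(ℝ, TangentSpace (𝓡 n) p).tangent 1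
        (fun w => (⟨w, v⟩ : TangentBundle 𝓘(ℝ, TangentSpace (𝓡 n) p) _)) :=
      contMDiff_vectorSpace_iff_contDiff.2 contDiff_const
    exact (h1.comp_contMDiffOn hΦ.contMDiffOn_symm).of_le zero_le_one

lemma mdifferentiable : Φ.MDifferentiable 𝓘(ℝ, TangentSpace (𝓡 n) p) (𝓡 n) :=
  ⟨hΦ.contMDiffOn.mdifferentiableOn one_ne_zero,
    hΦ.contMDiffOn_symm.mdifferentiableOn one_ne_zero⟩

lemma exists_basis_pushforward {ι : Type*} (e : Module.Basis ι ℝ (TangentSpace (𝓡 n) p))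
    {x : M} (hx : x ∈ Φ.target) :
    ∃ b : Module.Basis ι ℝ (TangentSpace (𝓡 n) x), ∀ i, b i = pushforward Φ (e i) x := by
  have hbij := hΦ.mdifferentiable.mfderiv_bijective (Φ.map_target hx)
  exact ⟨e.map (LinearEquiv.ofBijective
    (mfderiv 𝓘(ℝ, TangentSpace (𝓡 n) p) (𝓡 n) Φ (Φ.symm x)).toLinearMap hbij), fun i => rfl⟩

variable [IsManifold (𝓡 n) 2 M]
    [IsContMDiffRiemannianBundle (𝓡 n) 1 (EuclideanSpace ℝ (Fin n))
      (fun x : M => TangentSpace (𝓡 n) x)]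

lemma continuousOn_covectorInner_mfderiv {U : Set M} (hU : IsOpen U) (hUt : U ⊆ Φ.target)
    {f g : M → ℝ} (hf : ContMDiffOn (𝓡 n) 𝓘(ℝ, ℝ) 1 f U)
    (hg : ContMDiffOn (𝓡 n) 𝓘(ℝ, ℝ) 1 g U) :
    ContinuousOn (fun x => covectorInner (mfderiv (𝓡 n) 𝓘(ℝ, ℝ) f x)
      (mfderiv (𝓡 n) 𝓘(ℝ, ℝ) g x)) U := by
  refine continuousOn_covectorInner_of_frame
    (Y := fun i => pushforward Φ ((stdOrthonormalBasis ℝ (TangentSpace (𝓡 n) p)).toBasis i))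
    (fun i => (hΦ.continuousOn_pushforward _).mono hUt)
    (fun x hx => hΦ.exists_basis_pushforward _ (hUt hx)) ?_ ?_
  · exact fun i => continuousOn_mfderiv_apply hf hU ((hΦ.continuousOn_pushforward _).mono hUt)
  · exact fun i => continuousOn_mfderiv_apply hg hU ((hΦ.continuousOn_pushforward _).mono hUt)

/-- The distance function has gradient of norm at least one. -/
lemma one_le_covectorInner_rho [T2Space M] {x : M} (hx : x ∈ Φ.target) (hxp : x ≠ p) :
    1 ≤ covectorInner (mfderiv (𝓡 n) 𝓘(ℝ, ℝ) (rho (n := n) p) x)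
      (mfderiv (𝓡 n) 𝓘(ℝ, ℝ) (rho (n := n) p) x) := by
  have : IsContinuousRiemannianBundle (EuclideanSpace ℝ (Fin n))
      (fun x : M => TangentSpace (𝓡 n) x) := isContinuousRiemannianBundle_tangentSpace
  have : LocallyCompactSpace M := Manifold.locallyCompact_of_finiteDimensional (𝓡 n)
  set N : M → ℝ := fun y => covectorInner (mfderiv (𝓡 n) 𝓘(ℝ, ℝ) (rho (n := n) p) y)
      (mfderiv (𝓡 n) 𝓘(ℝ, ℝ) (rho (n := n) p) y)
  -- If |dρ|² < 1 at `x`, then |dρ|² < q < 1 near `x` by continuity, so ρ varies along short curves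
  -- near `x` by at most √q times the length. But along the radial geodesic through `x` it varies at
  -- the full rate one.
  by_contra! hlt
  have hopen : IsOpen (Φ.target \ {p}) := Φ.open_target.sdiff isClosed_singleton
  have hNc : ContinuousOn N (Φ.target \ {p}) :=
    hΦ.continuousOn_covectorInner_mfderiv hopen Set.sdiff_subset hΦ.contMDiffOn_rho
      hΦ.contMDiffOn_rho
  -- The maximum with `0` ensures q > 0, since √q is divided by below.
  obtain ⟨q, hq1, hq2⟩ := exists_between (show max (N x) 0 < 1 from max_lt hlt one_pos)
  have hq0 : 0 < q := (le_max_right _ _).trans_lt hq1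
  have hnhds : {y | y ∈ Φ.target \ {p} ∧ N y < q} ∈ 𝓝 x := by
    have h1 : ∀ᶠ y in 𝓝 x, N y < q :=
      (hNc.continuousAt (hopen.mem_nhds ⟨hx, hxp⟩)).eventually_lt continuousAt_const
        ((le_max_left _ _).trans_lt hq1)
    exact Filter.inter_mem (hopen.mem_nhds ⟨hx, hxp⟩) h1
  obtain ⟨δ, hδ, hδU⟩ := setOfPred_riemannianEDist_lt_subset_nhds (𝓡 n) hnhds
  set v := Φ.symm x
  have hv0 : 0 < ‖v‖ := norm_pos_iff.2 (hΦ.symm_ne_zero hx hxp)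
  have hvR : ‖v‖ < R := hΦ.norm_symm_lt hx
  have hΦv : Φ v = x := Φ.right_inv hx
  obtain ⟨h, hh0, hh1⟩ : ∃ h : ℝ, 0 < h ∧ h < min 1 ((δ : ℝ) / ‖v‖) :=
    exists_between (lt_min one_pos (div_pos hδ hv0))
  have hhv : h * ‖v‖ < δ := (lt_div_iff₀ hv0).1 (hh1.trans_le (min_le_right _ _))
  have hh1' : h < 1 := hh1.trans_le (min_le_left _ _)
  set c := Real.sqrt q
  have hc0 : 0 < c := Real.sqrt_pos.2 hq0
  have hc1 : c < 1 := by
    rw [← Real.sqrt_one]; exact Real.sqrt_lt_sqrt hq0.le hq2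
  have hpos : 0 < h * ‖v‖ := mul_pos hh0 hv0
  -- The bound `l` for the length of the comparison curve exceeds the distance h‖v‖ of its
  -- endpoints; l < δ keeps the curve near `x`, and l < h‖v‖/√q gives the contradiction.
  obtain ⟨l, hl0, hl1⟩ : ∃ l : ℝ, h * ‖v‖ < l ∧ l < min (δ : ℝ) (h * ‖v‖ / c) := by
    refine exists_between (lt_min hhv ?_)
    rw [lt_div_iff₀ hc0]
    nlinarith
  have hdist : riemannianEDist (𝓡 n) x (Φ ((1 - h) • v)) = ENNReal.ofReal (h * ‖v‖) := by
    have := hΦ.minimizing v (by simpa using hvR) 1 (by simp) (1 - h)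
      ⟨by linarith, by linarith⟩
    rw [one_smul, hΦv] at this
    rw [this]
    congr 2
    rw [sub_sub_cancel, abs_of_pos hh0]
  have hv' : ‖(1 - h) • v‖ = (1 - h) * ‖v‖ := by
    rw [norm_smul, Real.norm_of_nonneg (by linarith)]
  -- This version yields a curve that is C¹ on the whole line, so it has two-sided derivatives also
  -- at the endpoints of the interval.
  obtain ⟨γ, hγ0, hγ1, hγ, hlen, -, -⟩ := exists_lt_locally_constant_of_riemannianEDist_lt
    (hdist.trans_lt ((ENNReal.ofReal_lt_ofReal_iff (hpos.trans hl0)).2 hl0)) zero_lt_one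
  have hmem : ∀ t ∈ Set.Icc (0 : ℝ) 1, γ t ∈ Φ.target \ {p} ∧ N (γ t) < q := by
    intro t ht
    refine hδU ?_
    have h2 : riemannianEDist (𝓡 n) x (γ t) ≤ pathELength (𝓡 n) γ 0 t :=
      riemannianEDist_le_pathELength hγ.contMDiffOn hγ0 rfl ht.1
    have h3 : pathELength (𝓡 n) γ 0 t ≤ pathELength (𝓡 n) γ 0 1 := pathELength_mono le_rfl ht.2
    refine ((h2.trans h3).trans_lt hlen).trans_le ?_
    rw [← ENNReal.ofReal_coe_nnreal]
    exact ENNReal.ofReal_le_ofReal (hl1.le.trans (min_le_left _ _))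
  have hcomp : ContDiffOn ℝ 1 (rho (n := n) p ∘ γ) (Set.Icc 0 1) :=
    (hΦ.contMDiffOn_rho.comp hγ.contMDiffOn fun t ht => (hmem t ht).1).contDiffOn
  have hFTC := enorm_sub_le_lintegral_deriv_of_contDiffOn_Icc hcomp zero_le_one
  have hderiv : ∀ t ∈ Set.Icc (0 : ℝ) 1, ‖deriv (rho (n := n) p ∘ γ) t‖ₑ ≤
      ENNReal.ofReal c * ‖mfderiv 𝓘(ℝ, ℝ) (𝓡 n) γ t 1‖ₑ := by
    intro t ht
    have hd1 : MDifferentiableAt (𝓡 n) 𝓘(ℝ, ℝ) (rho (n := n) p) (γ t) :=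
      (hΦ.contMDiffOn_rho.contMDiffAt (hopen.mem_nhds (hmem t ht).1)).mdifferentiableAt
        one_ne_zero
    have hd2 : MDifferentiableAt 𝓘(ℝ, ℝ) (𝓡 n) γ t := hγ.mdifferentiableAt one_ne_zero
    have e : deriv (rho (n := n) p ∘ γ) t = mfderiv (𝓡 n) 𝓘(ℝ, ℝ) (rho (n := n) p) (γ t)
        (mfderiv 𝓘(ℝ, ℝ) (𝓡 n) γ t 1) := by
      rw [← fderiv_apply_one_eq_deriv, ← mfderiv_eq_fderiv, mfderiv_comp t hd1 hd2]
      rfl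
    have habs : |deriv (rho (n := n) p ∘ γ) t| ≤ c * ‖mfderiv 𝓘(ℝ, ℝ) (𝓡 n) γ t 1‖ := by
      rw [e]
      refine (abs_apply_le_sqrt_covectorInner_mul_norm _ _).trans ?_
      exact mul_le_mul_of_nonneg_right (Real.sqrt_le_sqrt (hmem t ht).2.le) (norm_nonneg _)
    rw [← ofReal_norm, ← ofReal_norm, ← ENNReal.ofReal_mul hc0.le]
    exact ENNReal.ofReal_le_ofReal habs
  -- The left side is the change of ρ between the endpoints, the right side bounds the integral of
  -- |dρ(γ')|. So h‖v‖ ≤ √q l, contrary to the choice of `l`.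
  have hle : ENNReal.ofReal (h * ‖v‖) ≤ ENNReal.ofReal (c * l) := by
    calc ENNReal.ofReal (h * ‖v‖)
        = ‖(rho (n := n) p ∘ γ) 1 - (rho (n := n) p ∘ γ) 0‖ₑ := by
          rw [Function.comp_apply, Function.comp_apply, hγ0, hγ1, ← hΦv,
            hΦ.rho_apply hvR, hΦ.rho_apply (by rw [hv']; nlinarith), hv', ← ofReal_norm,
            Real.norm_eq_abs, abs_of_neg (by nlinarith)]
          congr 1
          ring
      _ ≤ ∫⁻ t in Set.Icc 0 1, ENNReal.ofReal c * ‖mfderiv 𝓘(ℝ, ℝ) (𝓡 n) γ t 1‖ₑ :=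
          hFTC.trans (setLIntegral_mono' measurableSet_Icc hderiv)
      _ = ENNReal.ofReal c * pathELength (𝓡 n) γ 0 1 := by
          rw [lintegral_const_mul' _ _ ENNReal.ofReal_ne_top,
            pathELength_eq_lintegral_mfderiv_Icc]
      _ ≤ ENNReal.ofReal (c * l) := by
          rw [ENNReal.ofReal_mul hc0.le]
          gcongr
  have h1 := (ENNReal.ofReal_le_ofReal_iff (mul_pos hc0 (hpos.trans hl0)).le).1 hle
  have h2 : l < h * ‖v‖ / c := hl1.trans_le (min_le_right _ _)
  rw [lt_div_iff₀ hc0] at h2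
  linarith

end

end IsExpDiffeo

/-! ### The Riccati profile k tan(kt) and its cutoff -/

section Profile

/-- A cutoff that vanishes on `(-∞, 1 / (j + 1)]` and tends to one on the positive half-line. -/
def cutoff (j : ℕ) (t : ℝ) : ℝ := Real.smoothTransition ((j + 1) * t - 1)

/-- The solution `k tan (k t)` of `η' = η² + k²`, cut off near zero. -/
def profile (k : ℝ) (j : ℕ) (t : ℝ) : ℝ := cutoff j t * (k * Real.tan (k * t))

lemma cutoff_nonneg (j : ℕ) (t : ℝ) : 0 ≤ cutoff j t := Real.smoothTransition.nonneg _

lemma cutoff_le_one (j : ℕ) (t : ℝ) : cutoff j t ≤ 1 := Real.smoothTransition.le_one _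

lemma contDiff_cutoff (j : ℕ) : ContDiff ℝ 1 (cutoff j) :=
  Real.smoothTransition.contDiff.comp (by fun_prop)

lemma monotone_cutoff (j : ℕ) : Monotone (cutoff j) := by
  intro a b hab
  refine Real.smoothTransition.monotone ?_
  have : (0 : ℝ) ≤ j + 1 := by positivity
  nlinarith

lemma cutoff_eq_zero {j : ℕ} {t : ℝ} (ht : (j + 1) * t ≤ 1) : cutoff j t = 0 :=
  Real.smoothTransition.zero_of_nonpos (by linarith)

lemma tendsto_cutoff {t : ℝ} (ht : 0 < t) :
    Filter.Tendsto (fun j => cutoff j t) Filter.atTop (𝓝 1) := by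
  refine tendsto_const_nhds.congr' ?_
  obtain ⟨N, hN⟩ := exists_nat_gt (2 / t)
  filter_upwards [Filter.eventually_ge_atTop N] with j hj
  refine (Real.smoothTransition.one_of_one_le ?_).symm
  have h1 : 2 / t < j := hN.trans_le (by exact_mod_cast hj)
  rw [div_lt_iff₀ ht] at h1
  linarith

lemma profile_eq_zero {k : ℝ} {j : ℕ} {t : ℝ} (ht : (j + 1) * t ≤ 1) : profile k j t = 0 := by
  rw [profile, cutoff_eq_zero ht, zero_mul]

variable {k t : ℝ} (hk : 0 < k) (ht0 : 0 ≤ t) (ht : k * t < Real.pi / 2)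
include hk ht0 ht

lemma cos_mul_pos_of_lt : 0 < Real.cos (k * t) :=
  Real.cos_pos_of_mem_Ioo ⟨by have := mul_nonneg hk.le ht0; linarith [Real.pi_pos], ht⟩

lemma profile_nonneg (j : ℕ) : 0 ≤ profile k j t :=
  mul_nonneg (cutoff_nonneg _ _) (mul_nonneg hk.le
    (Real.tan_nonneg_of_nonneg_of_le_pi_div_two (mul_nonneg hk.le ht0) ht.le))

lemma contDiffAt_profile (j : ℕ) : ContDiffAt ℝ 1 (profile k j) t := by
  have h1 : ContDiffAt ℝ 1 (fun t => Real.tan (k * t)) t :=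
    ContDiffAt.comp (f := fun t => k * t) (g := Real.tan) t
      (Real.contDiffAt_tan.2 (cos_mul_pos_of_lt hk ht0 ht).ne')
      (contDiff_const.mul contDiff_id).contDiffAt
  exact (contDiff_cutoff j).contDiffAt.mul (contDiffAt_const.mul h1)

/-- The differential inequality `η' ≥ η² + k²` for the cut off profile. -/
lemma sq_add_le_deriv_profile (j : ℕ) :
    profile k j t ^ 2 + k ^ 2 * cutoff j t ≤ deriv (profile k j) t := by
  have hc := cos_mul_pos_of_lt hk ht0 ht
  have h1 : HasDerivAt (fun t => k * Real.tan (k * t)) (k * (1 / Real.cos (k * t) ^ 2 * k)) t := by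
    have h2 : HasDerivAt (fun t => k * t) k t := by simpa using (hasDerivAt_id t).const_mul k
    exact ((Real.hasDerivAt_tan hc.ne').comp t h2).const_mul k
  have h3 : HasDerivAt (cutoff j) (deriv (cutoff j) t) t :=
    ((contDiff_cutoff j).differentiable one_ne_zero t).hasDerivAt
  have h4 : deriv (profile k j) t = deriv (cutoff j) t * (k * Real.tan (k * t)) +
      cutoff j t * (k * (1 / Real.cos (k * t) ^ 2 * k)) := (h3.mul h1).deriv
  have h5 : 0 ≤ deriv (cutoff j) t := (monotone_cutoff j).deriv_nonneg
  have h6 : 0 ≤ k * Real.tan (k * t) := mul_nonneg hk.le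
    (Real.tan_nonneg_of_nonneg_of_le_pi_div_two (mul_nonneg hk.le ht0) ht.le)
  have h7 : 1 / Real.cos (k * t) ^ 2 = 1 + Real.tan (k * t) ^ 2 := by
    rw [Real.tan_eq_sin_div_cos]
    field_simp
    linarith [Real.sin_sq_add_cos_sq (k * t)]
  have h8 := cutoff_nonneg j t
  have h9 := cutoff_le_one j t
  rw [h4, h7, profile]
  -- With cutoff χ and η = k tan(kt), (χη)' = χ'η + χ(η² + k²). Here χ'η ≥ 0, and χη² ≥ (χη)²
  -- because 0 ≤ χ ≤ 1.
  have h10 : 0 ≤ cutoff j t * (1 - cutoff j t) * (k * Real.tan (k * t)) ^ 2 :=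
    mul_nonneg (mul_nonneg h8 (by linarith)) (sq_nonneg _)
  have h11 := mul_nonneg h5 h6
  nlinarith

end Profile

/-! ### Completing the square -/

section Algebra

variable {n : ℕ} {M : Type*} [TopologicalSpace M] [ChartedSpace (EuclideanSpace ℝ (Fin n)) M]
  [RiemannianBundle (fun x : M => TangentSpace (𝓡 n) x)] {x : M}

/-- Summing |η dρ(e) z + D(e)|² ≥ 0 over an orthonormal basis, the cross terms are those of ⟨dρ, df⟩
and the remainder is |dρ|²|z|²(η' - η²) ≥ c|dρ|²|z|². Because c ≥ 0, only the lower bound |dρ| ≥ 1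
is needed. -/
lemma le_covectorInner_add_covectorNormSq {dρ df : TangentSpace (𝓡 n) x →L[ℝ] ℝ}
    {D : TangentSpace (𝓡 n) x →L[ℝ] ℂ} {z : ℂ} {η η' c : ℝ} (hρ : 1 ≤ covectorInner dρ dρ)
    (hc : 0 ≤ c) (hη : η ^ 2 + c ≤ η')
    (hdf : ∀ w, df w = η' * dρ w * ‖z‖ ^ 2 + η * (2 * ((starRingEnd ℂ) z * D w).re)) :
    c * ‖z‖ ^ 2 ≤ covectorInner dρ df + covectorNormSq D := by
  have h1 : covectorInner dρ dρ * (c * ‖z‖ ^ 2) ≤ covectorInner dρ df + covectorNormSq D := by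
    simp only [covectorInner, covectorNormSq, ← Finset.sum_add_distrib, Finset.sum_mul]
    refine Finset.sum_le_sum fun a _ => ?_
    set e := stdOrthonormalBasis ℝ (TangentSpace (𝓡 n) x) a
    rw [hdf]
    have h2 : 0 ≤ ‖((η * dρ e : ℝ) : ℂ) * z + D e‖ ^ 2 := sq_nonneg _
    simp only [Complex.sq_norm, Complex.normSq_apply, Complex.add_re, Complex.add_im,
      Complex.mul_re, Complex.mul_im, Complex.ofReal_re, Complex.ofReal_im, Complex.conj_re,
      Complex.conj_im] at h2 ⊢
    have h3 : 0 ≤ (dρ e) ^ 2 * (z.re * z.re + z.im * z.im) * (η' - η ^ 2 - c) :=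
      mul_nonneg (mul_nonneg (sq_nonneg _) (by nlinarith [sq_nonneg z.re, sq_nonneg z.im]))
        (by linarith)
    nlinarith
  have h2 : 0 ≤ c * ‖z‖ ^ 2 := mul_nonneg hc (sq_nonneg _)
  nlinarith

end Algebra

/-- No integrability is assumed: the integral of a non-integrable function is zero by convention. -/
lemma ofReal_integral_le_lintegral {α : Type*} [MeasurableSpace α] {μ : Measure α} (f : α → ℝ) :
    ENNReal.ofReal (∫ x, f x ∂μ) ≤ ∫⁻ x, ENNReal.ofReal (f x) ∂μ := by
  by_cases hf : Integrable f μ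
  · rw [integral_eq_lintegral_pos_part_sub_lintegral_neg_part hf]
    refine (ENNReal.ofReal_le_ofReal (sub_le_self _ ENNReal.toReal_nonneg)).trans ?_
    exact ENNReal.ofReal_toReal_le
  · rw [integral_undef hf]
    simp

section TestFunction

variable {n : ℕ} {M : Type*} [TopologicalSpace M] [ChartedSpace (EuclideanSpace ℝ (Fin n)) M]

/-- The differential of a real-valued function, as a covector field. -/
def realDifferential (f : M → ℝ) (x : M) : TangentSpace (𝓡 n) x →L[ℝ] ℝ :=
  mfderiv (𝓡 n) 𝓘(ℝ, ℝ) f x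

/-- Besides the main test function η(ρ)|u|², this covers |u|² (η constant) and f|u|² (η the
identity), which enter the divergence theorem. -/
lemma realDifferential_comp_mul_norm_sq {ρ : M → ℝ} {u : M → ℂ} {η : ℝ → ℝ} {x : M}
    (hρ : MDifferentiableAt (𝓡 n) 𝓘(ℝ, ℝ) ρ x) (hu : MDifferentiableAt (𝓡 n) 𝓘(ℝ, ℂ) u x)
    (hη : DifferentiableAt ℝ η (ρ x)) (w : TangentSpace (𝓡 n) x) :
    realDifferential (n := n) (fun y => η (ρ y) * ‖u y‖ ^ 2) x w =
      deriv η (ρ x) * realDifferential (n := n) ρ x w * ‖u x‖ ^ 2 +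
        η (ρ x) * (2 * ((starRingEnd ℂ) (u x) * differential (n := n) u x w).re) := by
  have h1 : HasFDerivAt (fun q : ℝ × ℂ => η q.1 * ‖q.2‖ ^ 2) _ (ρ x, u x) :=
    ((hη.hasDerivAt.hasFDerivAt).comp (ρ x, u x) (hasFDerivAt_fst)).mul
      ((hasFDerivAt_snd (𝕜 := ℝ) (p := (ρ x, u x))).norm_sq)
  have hp : HasMFDerivAt (𝓡 n) 𝓘(ℝ, ℝ × ℂ) (fun y => (ρ y, u y)) x
      ((realDifferential (n := n) ρ x).prod (differential (n := n) u x)) :=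
    ⟨hρ.hasMFDerivAt.1.prodMk hu.hasMFDerivAt.1, hρ.hasMFDerivAt.2.prodMk hu.hasMFDerivAt.2⟩
  have h2 := HasMFDerivAt.comp (f := fun y => (ρ y, u y)) x h1.hasMFDerivAt hp
  have h3 : realDifferential (n := n) (fun y => η (ρ y) * ‖u y‖ ^ 2) x = _ := h2.mfderiv
  rw [h3]
  change η (ρ x) * (2 • inner ℝ (u x) (differential (n := n) u x w)) +
    ‖u x‖ ^ 2 * (realDifferential (n := n) ρ x w • deriv η (ρ x)) = _
  rw [Complex.inner, smul_eq_mul, nsmul_eq_mul]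
  push_cast
  ring_nf

end TestFunction

/-- A function which is continuous on an open set that contains a compact set off which it
vanishes is integrable. -/
lemma integrable_of_continuousOn_of_support {X : Type*} [TopologicalSpace X] [T2Space X]
    [MeasurableSpace X] [BorelSpace X] {μ : Measure X} [IsFiniteMeasureOnCompacts μ]
    {f : X → ℝ} {K : Set X} (hK : IsCompact K) (hf : ContinuousOn f K)
    (h0 : ∀ x ∉ K, f x = 0) : Integrable f μ := by
  have h1 : IntegrableOn f K μ := hf.integrableOn_compact hK
  rw [← integrable_indicator_iff hK.measurableSet] at h1
  refine h1.congr (Filter.Eventually.of_forall fun x => ?_)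
  by_cases hx : x ∈ K
  · simp [hx]
  · simp [hx, h0 x hx]

/-! ### The Poincaré inequality for test functions -/

namespace IsExpDiffeo

variable {n : ℕ} {M : Type*} [TopologicalSpace M] [ChartedSpace (EuclideanSpace ℝ (Fin n)) M]
  [RiemannianBundle (fun x : M => TangentSpace (𝓡 n) x)]
  {p : M} {R r : ℝ} {Φ : OpenPartialHomeomorph (TangentSpace (𝓡 n) p) M}
  (hΦ : IsExpDiffeo p R Φ)
  [IsManifold (𝓡 n) 2 M]
  [IsContMDiffRiemannianBundle (𝓡 n) 1 (EuclideanSpace ℝ (Fin n))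
      (fun x : M => TangentSpace (𝓡 n) x)] [T2Space M] (hr : 0 < r) (hrR : r < R)

include hΦ hr hrR

lemma isOpen_geodBall : IsOpen (geodBall n p r) := by
  rw [hΦ.geodBall_eq_image hr hrR]
  refine Φ.isOpen_image_of_subset_source Metric.isOpen_ball fun v hv => ?_
  exact hΦ.mem_source.2 ((mem_ball_zero_iff.1 hv).trans hrR)

lemma geodBall_subset_target : geodBall n p r ⊆ Φ.target := by
  rw [hΦ.geodBall_eq_image hr hrR]
  rintro _ ⟨v, hv, rfl⟩
  exact Φ.map_source (hΦ.mem_source.2 ((mem_ball_zero_iff.1 hv).trans hrR))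

lemma rho_lt {x : M} (hx : x ∈ geodBall n p r) : rho (n := n) p x < r :=
  (ENNReal.toReal_lt_of_lt_ofReal hx)

lemma mul_rho_lt {x : M} (hx : x ∈ geodBall n p r) :
    Real.pi / (2 * r) * rho (n := n) p x < Real.pi / 2 := by
  have h := mul_lt_mul_of_pos_left (hΦ.rho_lt hr hrR hx) Real.pi_pos
  rw [div_mul_eq_mul_div, div_lt_div_iff₀ (by positivity) (by positivity)]
  linarith

lemma continuousOn_rho : ContinuousOn (rho (n := n) p) Φ.target :=
  (Φ.continuousOn_symm.norm).congr fun _ hx => hΦ.rho_eq_norm_symm hx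

lemma eventually_rho_lt {ε : ℝ} (hε : 0 < ε) : ∀ᶠ x in 𝓝 p, rho (n := n) p x < ε := by
  have hp := hΦ.center_mem_target (hr.trans hrR)
  have hc := (hΦ.continuousOn_rho hr hrR).continuousAt (Φ.open_target.mem_nhds hp)
  refine hc.eventually_lt continuousAt_const ?_
  rw [hΦ.rho_eq_norm_symm hp, hΦ.symm_center (hr.trans hrR), norm_zero]
  exact hε

lemma rho_pos {x : M} (hx : x ∈ geodBall n p r) (hxp : x ≠ p) : 0 < rho (n := n) p x := by
  have hx' := hΦ.geodBall_subset_target hr hrR hx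
  rw [hΦ.rho_eq_norm_symm hx']
  exact norm_pos_iff.2 (hΦ.symm_ne_zero hx' hxp)

variable {u : M → ℂ} (hu : ContMDiff (𝓡 n) 𝓘(ℝ, ℂ) 1 u) (hc : HasCompactSupport u)
  (hsupp : tsupport u ⊆ geodBall n p r)
include hu hc hsupp

/-- The test function of the vector field argument. -/
lemma eventuallyEq_zero_testFunction (k : ℝ) (j : ℕ) :
    (fun x => profile k j (rho (n := n) p x) * ‖u x‖ ^ 2) =ᶠ[𝓝 p] 0 := by
  filter_upwards [hΦ.eventually_rho_lt hr hrR (ε := 1 / (j + 1)) (by positivity)] with x hx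
  rw [lt_div_iff₀ (by positivity)] at hx
  rw [profile_eq_zero (by linarith), zero_mul, Pi.zero_apply]

lemma tsupport_testFunction_subset (k : ℝ) (j : ℕ) :
    tsupport (fun x => profile k j (rho (n := n) p x) * ‖u x‖ ^ 2) ⊆ tsupport u \ {p} := by
  intro x hx
  refine ⟨?_, ?_⟩
  · refine closure_mono (fun y hy => ?_) hx
    rw [Function.mem_support] at hy ⊢
    exact fun h => hy (by simp [h])
  · rintro rfl
    exact (notMem_tsupport_iff_eventuallyEq.2
      (hΦ.eventuallyEq_zero_testFunction hr hrR hu hc hsupp k j)) hx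

/-- The three possible singularities are avoided: the cutoff makes the function vanish near `p`,
where ρ is not smooth; on the support of `u` one has kρ < π/2, away from the pole of the tangent;
off that support the function vanishes. -/
lemma contMDiff_testFunction (j : ℕ) :
    ContMDiff (𝓡 n) 𝓘(ℝ, ℝ) 1
      (fun x => profile (Real.pi / (2 * r)) j (rho (n := n) p x) * ‖u x‖ ^ 2) := by
  have hk : 0 < Real.pi / (2 * r) := by positivity
  intro x
  by_cases hxs : x ∈ tsupport u
  · by_cases hxp : x = p
    · subst hxp
      exact contMDiffAt_const.congr_of_eventuallyEq
        (hΦ.eventuallyEq_zero_testFunction hr hrR hu hc hsupp _ j)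
    · have hxB := hsupp hxs
      have hopen : IsOpen (Φ.target \ {p}) := Φ.open_target.sdiff isClosed_singleton
      have h1 : ContMDiffAt (𝓡 n) 𝓘(ℝ, ℝ) 1 (rho (n := n) p) x :=
        hΦ.contMDiffOn_rho.contMDiffAt
          (hopen.mem_nhds ⟨hΦ.geodBall_subset_target hr hrR hxB, hxp⟩)
      have h2 : ContDiffAt ℝ 1 (profile (Real.pi / (2 * r)) j) (rho (n := n) p x) :=
        contDiffAt_profile hk ENNReal.toReal_nonneg (hΦ.mul_rho_lt hr hrR hxB) j
      have h3 : ContDiff ℝ 1 fun z : ℂ => ‖z‖ ^ 2 := contDiff_norm_sq ℝ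
      exact (h2.contMDiffAt.comp x h1).mul (h3.contMDiff.contMDiffAt.comp x (hu x))
  · have h0 := notMem_tsupport_iff_eventuallyEq.1 hxs
    refine contMDiffAt_const (c := (0 : ℝ)).congr_of_eventuallyEq ?_
    filter_upwards [h0] with y hy
    simp [hy]

lemma integrable_norm_sq [MeasurableSpace M] [BorelSpace M] :
    Integrable (fun x => ‖u x‖ ^ 2) (riemannianVolume n M) := by
  have h1 : Continuous fun x => ‖u x‖ ^ 2 := hu.continuous.norm.pow 2
  have h2 : HasCompactSupport fun x => ‖u x‖ ^ 2 :=
    hc.comp_left (g := fun z : ℂ => ‖z‖ ^ 2) (by simp)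
  exact h1.integrable_of_hasCompactSupport h2

variable [MeasurableSpace M] [BorelSpace M]

/-- Mean-convexity is tested against η(ρ)|u|². The hypothesis on `D` is all that the square needs
and admits D = du - iθu for real θ. The right side is a lower integral so that `D` need not be
measurable. -/
lemma mul_integral_cutoff_le_lintegral (hconv : IsWeaklyMeanConvexBall (n := n) p r)
    {D : ∀ x : M, TangentSpace (𝓡 n) x →L[ℝ] ℂ}
    (hD : ∀ x ∈ geodBall n p r, ∀ w, ((starRingEnd ℂ) (u x) * D x w).re =
      ((starRingEnd ℂ) (u x) * differential (n := n) u x w).re) (j : ℕ) :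
    ENNReal.ofReal (∫ x in geodBall n p r, (Real.pi / (2 * r)) ^ 2 * cutoff j (rho (n := n) p x) *
        ‖u x‖ ^ 2 ∂(riemannianVolume n M)) ≤
      ∫⁻ x in geodBall n p r, ENNReal.ofReal (covectorNormSq (D x)) ∂(riemannianVolume n M) := by
  set k := Real.pi / (2 * r)
  have hk : 0 < k := by positivity
  set f : M → ℝ := fun x => profile k j (rho (n := n) p x) * ‖u x‖ ^ 2
  have hB := hΦ.isOpen_geodBall hr hrR
  have hBt := hΦ.geodBall_subset_target hr hrR
  have hopen : IsOpen (Φ.target \ {p}) := Φ.open_target.sdiff isClosed_singleton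
  have hfsupp : tsupport f ⊆ tsupport u \ {p} :=
    hΦ.tsupport_testFunction_subset hr hrR hu hc hsupp k j
  have hfc : HasCompactSupport f := hc.of_isClosed_subset (isClosed_tsupport _)
    (hfsupp.trans Set.sdiff_subset)
  have hf : ContMDiff (𝓡 n) 𝓘(ℝ, ℝ) 1 f := hΦ.contMDiff_testFunction hr hrR hu hc hsupp j
  have hfKt : tsupport f ⊆ Φ.target \ {p} := fun x hx =>
    ⟨hBt (hsupp (hfsupp hx).1), (hfsupp hx).2⟩
  have hf0 : ∀ x ∈ geodBall n p r, 0 ≤ f x := fun x hx =>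
    mul_nonneg (profile_nonneg hk ENNReal.toReal_nonneg (hΦ.mul_rho_lt hr hrR hx) j) (sq_nonneg _)
  set F : M → ℝ := fun x => covectorInner (realDifferential (n := n) (rho (n := n) p) x)
    (realDifferential (n := n) f x)
  have hdf0 : ∀ x ∉ tsupport f, realDifferential (n := n) f x = 0 := by
    intro x hx
    have h := (notMem_tsupport_iff_eventuallyEq.1 hx).mfderiv_eq (I := 𝓡 n) (I' := 𝓘(ℝ, ℝ))
    refine Eq.trans h ?_
    exact mfderiv_const
  have hF0 : ∀ x ∉ tsupport f, F x = 0 := by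
    intro x hx
    simp [F, hdf0 x hx, covectorInner]
  have hFint : Integrable F (riemannianVolume n M) :=
    integrable_of_continuousOn_of_support hfc
      ((hΦ.continuousOn_covectorInner_mfderiv hopen Set.sdiff_subset hΦ.contMDiffOn_rho
        hf.contMDiffOn).mono hfKt) hF0
  have hFle : ∫ x in geodBall n p r, F x ∂(riemannianVolume n M) ≤ 0 := by
    have := hconv f hf hfc (fun x hx => ⟨hsupp (hfsupp hx).1, (hfsupp hx).2⟩) fun x => by
      by_cases hx : x ∈ tsupport u
      · exact hf0 x (hsupp hx)
      · have : u x = 0 := image_eq_zero_of_notMem_tsupport hx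
        simp [f, this]
    exact neg_nonneg.1 this
  set h : M → ℝ := fun x => k ^ 2 * cutoff j (rho (n := n) p x) * ‖u x‖ ^ 2
  have hhint : IntegrableOn h (geodBall n p r) (riemannianVolume n M) := by
    refine Integrable.mono' (((hΦ.integrable_norm_sq hr hrR hu hc hsupp).const_mul
      (k ^ 2)).integrableOn) ?_ (Filter.Eventually.of_forall fun x => ?_)
    · refine ContinuousOn.aestronglyMeasurable ?_ hB.measurableSet
      refine (continuousOn_const.mul ?_).mul (hu.continuous.norm.pow 2).continuousOn
      exact (contDiff_cutoff j).continuous.comp_continuousOn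
        ((hΦ.continuousOn_rho hr hrR).mono hBt)
    · have h1 := cutoff_nonneg j (rho (n := n) p x)
      have h2 := cutoff_le_one j (rho (n := n) p x)
      rw [Real.norm_of_nonneg (mul_nonneg (mul_nonneg (sq_nonneg _) h1) (sq_nonneg _)), mul_assoc]
      exact mul_le_mul_of_nonneg_left (mul_le_of_le_one_left (sq_nonneg _) h2) (sq_nonneg _)
  have hpt : ∀ x ∈ geodBall n p r, h x - F x ≤ covectorNormSq (D x) := by
    intro x hx
    -- At the centre nothing is known about dρ, but both the cutoff and `F` vanish there.
    by_cases hxp : x = p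
    · have hxs : x ∉ tsupport f := fun hxs => (hfsupp hxs).2 hxp
      have hx0 : rho (n := n) p x = 0 := by rw [hxp, rho, riemannianEDist_self]; rfl
      have : cutoff j (rho (n := n) p x) = 0 := cutoff_eq_zero (by rw [hx0]; simp)
      rw [hF0 x hxs]
      simpa [h, this] using covectorNormSq_nonneg (D x)
    · have hrd : MDifferentiableAt (𝓡 n) 𝓘(ℝ, ℝ) (rho (n := n) p) x :=
        (hΦ.contMDiffOn_rho.contMDiffAt (hopen.mem_nhds ⟨hBt hx, hxp⟩)).mdifferentiableAt
          one_ne_zero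
      have hkr := hΦ.mul_rho_lt hr hrR hx
      have hkr0 : 0 ≤ rho (n := n) p x := ENNReal.toReal_nonneg
      have := le_covectorInner_add_covectorNormSq (D := D x) (z := u x)
        (hΦ.one_le_covectorInner_rho (hBt hx) hxp)
        (mul_nonneg (sq_nonneg k) (cutoff_nonneg j (rho (n := n) p x)))
        (sq_add_le_deriv_profile hk hkr0 hkr j) (df := realDifferential (n := n) f x) (by
          intro w
          rw [hD x hx]
          exact realDifferential_comp_mul_norm_sq hrd (hu.mdifferentiableAt one_ne_zero)
            ((contDiffAt_profile hk hkr0 hkr j).differentiableAt one_ne_zero) w)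
      exact sub_le_iff_le_add'.2 this
  -- Mean-convexity says that `F` has nonpositive integral, so subtracting it can only increase the
  -- left side.
  calc ENNReal.ofReal (∫ x in geodBall n p r, h x ∂(riemannianVolume n M))
      ≤ ENNReal.ofReal (∫ x in geodBall n p r, (h x - F x) ∂(riemannianVolume n M)) := by
        rw [integral_sub hhint hFint.integrableOn]
        exact ENNReal.ofReal_le_ofReal (by linarith)
    _ ≤ ∫⁻ x in geodBall n p r, ENNReal.ofReal (h x - F x) ∂(riemannianVolume n M) :=
        ofReal_integral_le_lintegral _
    _ ≤ _ := setLIntegral_mono' hB.measurableSet fun x hx => ENNReal.ofReal_le_ofReal (hpt x hx)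

/-- The Poincaré inequality on a weakly mean-convex geodesic ball, for covector fields that have
the same real part as the differential of the test function. -/
lemma mul_integral_norm_sq_le_lintegral (hn : 1 ≤ n)
    (hconv : IsWeaklyMeanConvexBall (n := n) p r)
    {D : ∀ x : M, TangentSpace (𝓡 n) x →L[ℝ] ℂ}
    (hD : ∀ x ∈ geodBall n p r, ∀ w, ((starRingEnd ℂ) (u x) * D x w).re =
      ((starRingEnd ℂ) (u x) * differential (n := n) u x w).re) :
    ENNReal.ofReal ((Real.pi / (2 * r)) ^ 2 * ∫ x in geodBall n p r, ‖u x‖ ^ 2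
        ∂(riemannianVolume n M)) ≤
      ∫⁻ x in geodBall n p r, ENNReal.ofReal (covectorNormSq (D x)) ∂(riemannianVolume n M) := by
  set k := Real.pi / (2 * r)
  have hB := hΦ.isOpen_geodBall hr hrR
  have hBt := hΦ.geodBall_subset_target hr hrR
  have hlim : Filter.Tendsto (fun j => ∫ x in geodBall n p r,
      k ^ 2 * cutoff j (rho (n := n) p x) * ‖u x‖ ^ 2 ∂(riemannianVolume n M)) Filter.atTop
      (𝓝 (∫ x in geodBall n p r, k ^ 2 * 1 * ‖u x‖ ^ 2 ∂(riemannianVolume n M))) := by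
    refine tendsto_integral_of_dominated_convergence (fun x => k ^ 2 * ‖u x‖ ^ 2) ?_
      ((hΦ.integrable_norm_sq hr hrR hu hc hsupp).const_mul (k ^ 2)).integrableOn ?_ ?_
    · intro j
      refine ContinuousOn.aestronglyMeasurable ?_ hB.measurableSet
      refine (continuousOn_const.mul ?_).mul (hu.continuous.norm.pow 2).continuousOn
      exact (contDiff_cutoff j).continuous.comp_continuousOn
        ((hΦ.continuousOn_rho hr hrR).mono hBt)
    · refine fun j => Filter.Eventually.of_forall fun x => ?_
      have h1 := cutoff_nonneg j (rho (n := n) p x)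
      have h2 := cutoff_le_one j (rho (n := n) p x)
      rw [Real.norm_of_nonneg (mul_nonneg (mul_nonneg (sq_nonneg _) h1) (sq_nonneg _)), mul_assoc]
      exact mul_le_mul_of_nonneg_left (mul_le_of_le_one_left (sq_nonneg _) h2) (sq_nonneg _)
    -- At `p` every cutoff is zero, so the pointwise limit is one only off this null set.
    · have hp : ∀ᵐ x ∂(riemannianVolume n M).restrict (geodBall n p r), x ≠ p := by
        refine ae_restrict_of_ae ?_
        rw [ae_iff]
        simpa using riemannianVolume_singleton hn p
      filter_upwards [hp, ae_restrict_mem hB.measurableSet] with x hxp hx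
      exact ((tendsto_cutoff (hΦ.rho_pos hr hrR hx hxp)).const_mul _).mul_const _
  have := le_of_tendsto (ENNReal.tendsto_ofReal hlim) (Filter.Eventually.of_forall fun j =>
    hΦ.mul_integral_cutoff_le_lintegral hr hrR hu hc hsupp hconv hD j)
  simpa only [mul_one, integral_const_mul] using this

end IsExpDiffeo

/-! ### Real test functions and bump functions -/

section TestFunctions

variable {n : ℕ} {M : Type*} [TopologicalSpace M] [ChartedSpace (EuclideanSpace ℝ (Fin n)) M]

variable (n) in
/-- Real-valued continuously differentiable functions with compact support in `W`. -/
structure IsTestFunction (W : Set M) (φ : M → ℝ) : Prop where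
  contMDiff : ContMDiff (𝓡 n) 𝓘(ℝ, ℝ) 1 φ
  hasCompactSupport : HasCompactSupport φ
  tsupport_subset : tsupport φ ⊆ W

lemma realDifferential_eq_zero {φ : M → ℝ} {x : M} (hx : x ∉ tsupport φ) :
    realDifferential (n := n) φ x = 0 := by
  have h := (notMem_tsupport_iff_eventuallyEq.1 hx).mfderiv_eq (I := 𝓡 n) (I' := 𝓘(ℝ, ℝ))
  exact Eq.trans h mfderiv_const

namespace IsTestFunction

variable {W W' : Set M} {φ ψ : M → ℝ}

lemma mono (hφ : IsTestFunction n W φ) (h : W ⊆ W') : IsTestFunction n W' φ :=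
  ⟨hφ.contMDiff, hφ.hasCompactSupport, hφ.tsupport_subset.trans h⟩

lemma zero : IsTestFunction n W (0 : M → ℝ) :=
  ⟨contMDiff_const, HasCompactSupport.zero, by simp⟩

lemma add (hφ : IsTestFunction n W φ) (hψ : IsTestFunction n W ψ) :
    IsTestFunction n W (φ + ψ) :=
  ⟨hφ.contMDiff.add hψ.contMDiff, hφ.hasCompactSupport.add hψ.hasCompactSupport,
    (tsupport_add φ ψ).trans (Set.union_subset hφ.tsupport_subset hψ.tsupport_subset)⟩

/-- A continuously differentiable function on an open set `U` times a test function supported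
in `U`. -/
lemma mul_contMDiffOn {U : Set M} {g : M → ℝ} (hφ : IsTestFunction n W φ) (hU : IsOpen U)
    (hWU : tsupport φ ⊆ U) (hg : ContMDiffOn (𝓡 n) 𝓘(ℝ, ℝ) 1 g U) :
    IsTestFunction n W (fun x => g x * φ x) := by
  refine ⟨fun x => ?_, hφ.hasCompactSupport.mul_left, ?_⟩
  · by_cases hx : x ∈ tsupport φ
    · exact (hg.contMDiffAt (hU.mem_nhds (hWU hx))).mul (hφ.contMDiff x)
    · have h0 := notMem_tsupport_iff_eventuallyEq.1 hx
      refine contMDiffAt_const (c := (0 : ℝ)).congr_of_eventuallyEq ?_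
      filter_upwards [h0] with y hy
      simp [hy]
  · exact (tsupport_mul_subset_right).trans hφ.tsupport_subset

lemma realDifferential_add (hφ : IsTestFunction n W φ) (hψ : IsTestFunction n W ψ) (x : M) :
    realDifferential (n := n) (φ + ψ) x =
      realDifferential (n := n) φ x + realDifferential (n := n) ψ x :=
  mfderiv_add (hφ.contMDiff.mdifferentiableAt one_ne_zero)
    (hψ.contMDiff.mdifferentiableAt one_ne_zero)

end IsTestFunction

end TestFunctions

namespace IsExpDiffeo

variable {n : ℕ} {M : Type*} [TopologicalSpace M] [ChartedSpace (EuclideanSpace ℝ (Fin n)) M]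
  [RiemannianBundle (fun x : M => TangentSpace (𝓡 n) x)]
  {p : M} {R r : ℝ} {Φ : OpenPartialHomeomorph (TangentSpace (𝓡 n) p) M}

/-- Bump functions, obtained from bump functions in exponential coordinates. -/
lemma exists_isTestFunction [T2Space M] (hΦ : IsExpDiffeo p R Φ) {W : Set M} (hW : IsOpen W)
    {x : M} (hxW : x ∈ W) (hx : x ∈ Φ.target) :
    ∃ χ : M → ℝ, IsTestFunction n W χ ∧ (∀ y, 0 ≤ χ y) ∧ χ x = 1 := by
  have hO : IsOpen (Φ.source ∩ Φ ⁻¹' W) := Φ.isOpen_inter_preimage hW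
  have hxO : Φ.symm x ∈ Φ.source ∩ Φ ⁻¹' W :=
    ⟨Φ.map_target hx, by rw [Set.mem_preimage, Φ.right_inv hx]; exact hxW⟩
  obtain ⟨ε, hε, hball⟩ := Metric.isOpen_iff.1 hO _ hxO
  let b : ContDiffBump (Φ.symm x) := ⟨ε / 3, ε / 2, by positivity, by linarith⟩
  have hcb : Metric.closedBall (Φ.symm x) (ε / 2) ⊆ Φ.source ∩ Φ ⁻¹' W :=
    (Metric.closedBall_subset_ball (by linarith)).trans hball
  -- The values of `Φ.symm` off its domain are arbitrary, hence the extension by zero. It is C¹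
  -- because the support of the bump corresponds to a compact subset of the target, closed as `M` is
  -- Hausdorff.
  set χ : M → ℝ := Φ.target.indicator (b ∘ Φ.symm)
  set K : Set M := Φ '' Metric.closedBall (Φ.symm x) (ε / 2)
  have hK : IsCompact K := (isCompact_closedBall _ _).image_of_continuousOn
    (Φ.continuousOn.mono fun v hv => (hcb hv).1)
  have h0 : ∀ y ∉ K, χ y = 0 := by
    intro y hy
    by_cases hyt : y ∈ Φ.target
    · refine (Set.indicator_of_mem hyt _).trans (b.zero_of_le_dist ?_)
      by_contra! hlt
      exact hy ⟨Φ.symm y, Metric.mem_closedBall.2 hlt.le, Φ.right_inv hyt⟩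
    · exact Set.indicator_of_notMem hyt _
  have hts : tsupport χ ⊆ K := closure_minimal (fun y hy => by
    by_contra h; exact hy (h0 y h)) hK.isClosed
  have hKt : K ⊆ Φ.target := by
    rintro _ ⟨v, hv, rfl⟩; exact Φ.map_source (hcb hv).1
  refine ⟨χ, ⟨fun y => ?_, hK.of_isClosed_subset (isClosed_tsupport _) hts, hts.trans ?_⟩,
    fun y => Set.indicator_nonneg (fun _ _ => b.nonneg) y, ?_⟩
  · by_cases hy : y ∈ K
    · have h1 : ContMDiffAt (𝓡 n) 𝓘(ℝ, ℝ) 1 (b ∘ Φ.symm) y :=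
        (b.contDiff.contMDiff.contMDiffAt).comp y
          (hΦ.contMDiffOn_symm.contMDiffAt (Φ.open_target.mem_nhds (hKt hy)))
      refine h1.congr_of_eventuallyEq ?_
      filter_upwards [Φ.open_target.mem_nhds (hKt hy)] with z hz
      exact Set.indicator_of_mem hz _
    · refine contMDiffAt_const (c := (0 : ℝ)).congr_of_eventuallyEq ?_
      filter_upwards [hK.isClosed.isOpen_compl.mem_nhds hy] with z hz
      exact h0 z hz
  · rintro _ ⟨v, hv, rfl⟩; exact (hcb hv).2
  · refine (Set.indicator_of_mem hx _).trans ?_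
    exact b.one_of_mem_closedBall (Metric.mem_closedBall_self (by positivity))

end IsExpDiffeo

/-! ### The divergence in a fixed chart -/

section ChartDivergence

variable {n : ℕ} {M : Type*} [TopologicalSpace M] [ChartedSpace (EuclideanSpace ℝ (Fin n)) M]

lemma contDiff_of_contDiffOn_of_zero {E : Type*} [NormedAddCommGroup E] [NormedSpace ℝ E]
    {H : E → ℝ} {O K : Set E} (hO : IsOpen O) (hK : IsClosed K) (hKO : K ⊆ O)
    (hH : ContDiffOn ℝ 1 H O) (h0 : ∀ y ∉ K, H y = 0) : ContDiff ℝ 1 H := by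
  refine contDiff_iff_contDiffAt.2 fun y => ?_
  by_cases hy : y ∈ K
  · exact hH.contDiffAt (hO.mem_nhds (hKO hy))
  · refine contDiffAt_const (c := (0 : ℝ)).congr_of_eventuallyEq ?_
    filter_upwards [hK.isOpen_compl.mem_nhds hy] with z hz
    exact h0 z hz

lemma continuous_of_continuousOn_of_zero {X Y : Type*} [TopologicalSpace X]
    [TopologicalSpace Y] [Zero Y] {H : X → Y} {O K : Set X}
    (hO : IsOpen O) (hK : IsClosed K) (hKO : K ⊆ O)
    (hH : ContinuousOn H O) (h0 : ∀ y ∉ K, H y = 0) : Continuous H := by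
  refine continuous_iff_continuousAt.2 fun y => ?_
  by_cases hy : y ∈ K
  · exact hH.continuousAt (hO.mem_nhds (hKO hy))
  · refine (continuousAt_const (y := (0 : Y))).congr ?_
    filter_upwards [hK.isOpen_compl.mem_nhds hy] with z hz
    exact (h0 z hz).symm

/-- Integration by parts against the constant function one. -/
lemma integral_fderiv_apply_eq_zero {E : Type*} [NormedAddCommGroup E] [NormedSpace ℝ E]
    [FiniteDimensional ℝ E] [MeasurableSpace E] [BorelSpace E] (μ : Measure E)
    [μ.IsAddHaarMeasure] {H : E → ℝ} (hH : ContDiff ℝ 1 H) (hc : HasCompactSupport H) (v : E) :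
    Integrable (fun y => fderiv ℝ H y v) μ ∧ ∫ y, fderiv ℝ H y v ∂μ = 0 := by
  have h1 : Integrable (fun y => fderiv ℝ H y v) μ :=
    ((hH.continuous_fderiv one_ne_zero).clm_apply continuous_const).integrable_of_hasCompactSupport
      (hc.fderiv_apply ℝ v)
  refine ⟨h1, ?_⟩
  have h := integral_mul_fderiv_eq_neg_fderiv_mul_of_integrable (μ := μ) (𝕜 := ℝ)
    (f := fun _ : E => (1 : ℝ)) (g := H) (v := v) (by simp) (by simpa using h1)
    (by simpa using hH.continuous.integrable_of_hasCompactSupport hc)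
    (fun _ _ => differentiableAt_const _) (fun x _ => hH.differentiable one_ne_zero x)
  simpa using h

variable [RiemannianBundle (fun x : M => TangentSpace (𝓡 n) x)]

/-- The divergence of a vector field, computed in the preferred chart at `x₀`. -/
def chartDivergence (x₀ : M) (X : ∀ x : M, TangentSpace (𝓡 n) x) (x : M) : ℝ :=
  (chartDensity x₀ (chartAt (EuclideanSpace ℝ (Fin n)) x₀ x))⁻¹ *
    ∑ i : Fin n,
      fderiv ℝ (fun y : EuclideanSpace ℝ (Fin n) => chartDensity x₀ y * coordField x₀ X y i)
        (chartAt (EuclideanSpace ℝ (Fin n)) x₀ x) (EuclideanSpace.single i (1 : ℝ))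

variable [IsManifold (𝓡 n) 2 M]
    [IsContMDiffRiemannianBundle (𝓡 n) 1 (EuclideanSpace ℝ (Fin n))
      (fun x : M => TangentSpace (𝓡 n) x)] {B : Set M} {X : ∀ x : M, TangentSpace (𝓡 n) x}

lemma contDiffOn_density_mul_coordField (x₀ : M)
    (hX : ContMDiffOn (𝓡 n) ((𝓡 n).prod 𝓘(ℝ, EuclideanSpace ℝ (Fin n))) 1 (toSection X) B)
    (i : Fin n) :
    ContDiffOn ℝ 1 (fun y => chartDensity x₀ y * coordField x₀ X y i)
      ((chartAt (EuclideanSpace ℝ (Fin n)) x₀).target ∩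
        (chartAt (EuclideanSpace ℝ (Fin n)) x₀).symm ⁻¹' B) := by
  refine ((contDiffOn_chartDensity x₀).mono Set.inter_subset_left).mul ?_
  exact contDiffOn_euclidean.1 (contDiffOn_coordField x₀ hX) i

lemma continuousOn_chartDivergence (x₀ : M) (hB : IsOpen B)
    (hX : ContMDiffOn (𝓡 n) ((𝓡 n).prod 𝓘(ℝ, EuclideanSpace ℝ (Fin n))) 1 (toSection X) B) :
    ContinuousOn (chartDivergence x₀ X)
      (B ∩ (chartAt (EuclideanSpace ℝ (Fin n)) x₀).source) := by
  set φ := chartAt (EuclideanSpace ℝ (Fin n)) x₀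
  have hφ : ContinuousOn φ (B ∩ φ.source) := φ.continuousOn.mono Set.inter_subset_right
  have hO : IsOpen (φ.target ∩ φ.symm ⁻¹' B) := φ.isOpen_inter_preimage_symm hB
  have hm : Set.MapsTo φ (B ∩ φ.source) (φ.target ∩ φ.symm ⁻¹' B) := fun x hx =>
    ⟨φ.map_source hx.2, by rw [Set.mem_preimage, φ.left_inv hx.2]; exact hx.1⟩
  refine ContinuousOn.mul (ContinuousOn.inv₀ ?_ fun x hx => ?_)
    (continuousOn_finsetSum _ fun i _ => ?_)
  · exact (contDiffOn_chartDensity x₀).continuousOn.comp hφ fun x hx => φ.map_source hx.2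
  · exact (chartDensity_pos x₀ (φ.map_source hx.2)).ne'
  · exact ((((contDiffOn_density_mul_coordField x₀ hX i).continuousOn_fderiv_of_isOpen hO
      le_rfl)).comp
      hφ hm).clm_apply continuousOn_const

lemma realDifferential_apply_chart (x₀ : M) {φ : M → ℝ} (hφ : ContMDiff (𝓡 n) 𝓘(ℝ, ℝ) 1 φ)
    {y : EuclideanSpace ℝ (Fin n)} (hy : y ∈ (chartAt (EuclideanSpace ℝ (Fin n)) x₀).target) :
    realDifferential (n := n) φ ((chartAt (EuclideanSpace ℝ (Fin n)) x₀).symm y)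
      (X ((chartAt (EuclideanSpace ℝ (Fin n)) x₀).symm y)) =
    fderiv ℝ (φ ∘ (chartAt (EuclideanSpace ℝ (Fin n)) x₀).symm) y (coordField x₀ X y) := by
  set c := chartAt (EuclideanSpace ℝ (Fin n)) x₀
  have hd₁ := (mdifferentiable_chart (I := 𝓡 n) x₀).mdifferentiableAt (c.map_target hy)
  have hd₂ : MDifferentiableAt (𝓡 n) 𝓘(ℝ, ℝ) (φ ∘ c.symm) y :=
    (hφ.mdifferentiableAt one_ne_zero).comp y
      ((mdifferentiable_chart (I := 𝓡 n) x₀).mdifferentiableAt_symm hy)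
  have hd₂' : MDifferentiableAt (𝓡 n) 𝓘(ℝ, ℝ) (φ ∘ c.symm) (c (c.symm y)) := by
    rw [c.right_inv hy]; exact hd₂
  have hev : φ =ᶠ[𝓝 (c.symm y)] (φ ∘ c.symm) ∘ c := by
    filter_upwards [c.open_source.mem_nhds (c.map_target hy)] with z hz
    simp [c.left_inv hz]
  have h1 : realDifferential (n := n) φ (c.symm y) =
      (mfderiv (𝓡 n) 𝓘(ℝ, ℝ) ((φ ∘ c.symm) ∘ c) (c.symm y) :
        TangentSpace (𝓡 n) (c.symm y) →L[ℝ] ℝ) := hev.mfderiv_eq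
  rw [h1]
  have h2 := mfderiv_comp (c.symm y) hd₂' hd₁
  rw [c.right_inv hy, mfderiv_eq_fderiv] at h2
  exact congrArg (fun A : EuclideanSpace ℝ (Fin n) →L[ℝ] ℝ => A (X (c.symm y))) h2

variable [MeasurableSpace M] [BorelSpace M]

lemma integral_source_eq (x₀ : M) {g : M → ℝ}
    (hg : AEStronglyMeasurable g (riemannianVolume n M)) :
    ∫ x in (chartAt (EuclideanSpace ℝ (Fin n)) x₀).source, g x ∂(riemannianVolume n M) =
      ∫ y in (chartAt (EuclideanSpace ℝ (Fin n)) x₀).target,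
        chartDensity x₀ y * g ((chartAt (EuclideanSpace ℝ (Fin n)) x₀).symm y) := by
  have hg' := hg.restrict (s := (chartAt (EuclideanSpace ℝ (Fin n)) x₀).source)
  rw [riemannianVolume_restrict_source] at hg' ⊢
  rw [chartVolume] at hg' ⊢
  rw [integral_map (aemeasurable_chart_symm x₀) hg',
    integral_withDensity_eq_integral_toReal_smul₀ (aemeasurable_chartDensity x₀)
      (Filter.Eventually.of_forall fun _ => ENNReal.ofReal_lt_top)]
  refine setIntegral_congr_fun (measurableSet_target x₀) fun y hy => ?_
  simp [ENNReal.toReal_ofReal (chartDensity_pos x₀ hy).le]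

end ChartDivergence

/-! ### Integration by parts in one chart -/

section IntegrationByParts

variable {n : ℕ} {M : Type*} [TopologicalSpace M] [ChartedSpace (EuclideanSpace ℝ (Fin n)) M]
  [RiemannianBundle (fun x : M => TangentSpace (𝓡 n) x)] [IsManifold (𝓡 n) 2 M]
    [IsContMDiffRiemannianBundle (𝓡 n) 1 (EuclideanSpace ℝ (Fin n))
      (fun x : M => TangentSpace (𝓡 n) x)] {B : Set M} {X : ∀ x : M, TangentSpace (𝓡 n) x}

lemma continuous_realDifferential_apply {W U : Set M} {φ : M → ℝ} (hφ : IsTestFunction n W φ)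
    (hU : IsOpen U) (hWU : tsupport φ ⊆ U) (hX : ContinuousOn (toSection X) U) :
    Continuous (fun x => realDifferential (n := n) φ x (X x)) :=
  continuous_of_continuousOn_of_zero hU (isClosed_tsupport φ) hWU
    (continuousOn_mfderiv_apply hφ.contMDiff.contMDiffOn hU hX)
    fun x hx => by rw [realDifferential_eq_zero hx]; rfl

lemma hasCompactSupport_realDifferential_apply [T2Space M] {W : Set M} {φ : M → ℝ}
    (hφ : IsTestFunction n W φ) :
    HasCompactSupport (fun x => realDifferential (n := n) φ x (X x)) :=
  HasCompactSupport.intro hφ.hasCompactSupport fun x hx => by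
    rw [realDifferential_eq_zero hx]; rfl

variable [T2Space M] [MeasurableSpace M] [BorelSpace M]

/-- Integration by parts in a chart. -/
lemma integral_add_mul_chartDivergence_eq_zero (x₀ : M) (hB : IsOpen B)
    (hX : ContMDiffOn (𝓡 n) ((𝓡 n).prod 𝓘(ℝ, EuclideanSpace ℝ (Fin n))) 1 (toSection X) B)
    {φ : M → ℝ}
    (hφ : IsTestFunction n (B ∩ (chartAt (EuclideanSpace ℝ (Fin n)) x₀).source) φ) :
    ∫ x, (realDifferential (n := n) φ x (X x) + φ x * chartDivergence x₀ X x)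
      ∂(riemannianVolume n M) = 0 := by
  set c := chartAt (EuclideanSpace ℝ (Fin n)) x₀
  have hU : IsOpen (B ∩ c.source) := hB.inter c.open_source
  set g : M → ℝ := fun x => realDifferential (n := n) φ x (X x) + φ x * chartDivergence x₀ X x
  have hg0 : ∀ x ∉ tsupport φ, g x = 0 := fun x hx => by
    simp [g, realDifferential_eq_zero hx, image_eq_zero_of_notMem_tsupport hx]
  have hgc : Continuous g := by
    refine (continuous_realDifferential_apply hφ hU hφ.tsupport_subset
      (hX.continuousOn.mono Set.inter_subset_left)).add ?_
    exact continuous_of_continuousOn_of_zero hU (isClosed_tsupport φ) hφ.tsupport_subset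
      (hφ.contMDiff.continuous.continuousOn.mul (continuousOn_chartDivergence x₀ hB hX))
      fun x hx => by simp [image_eq_zero_of_notMem_tsupport hx]
  set O := c.target ∩ c.symm ⁻¹' B
  have hO : IsOpen O := c.isOpen_inter_preimage_symm hB
  set K := c '' tsupport φ
  have hK : IsCompact K := hφ.hasCompactSupport.isCompact.image_of_continuousOn
    (c.continuousOn.mono fun x hx => (hφ.tsupport_subset hx).2)
  have hKO : K ⊆ O := by
    rintro _ ⟨x, hx, rfl⟩
    have := hφ.tsupport_subset hx
    exact ⟨c.map_source this.2, by rw [Set.mem_preimage, c.left_inv this.2]; exact this.1⟩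
  have hKφ : ∀ y ∈ c.target, y ∉ K → c.symm y ∉ tsupport φ := fun y hy hyK hφy =>
    hyK ⟨c.symm y, hφy, c.right_inv hy⟩
  set V : Fin n → EuclideanSpace ℝ (Fin n) → ℝ := fun i y => chartDensity x₀ y * coordField x₀ X y i
  -- The components of the field φ√|h| X in coordinates, extended by zero to all of Euclidean space.
  -- Its flat divergence is √|h| times the integrand, so the integral is that of a sum of
  -- derivatives of compactly supported C¹ functions.
  set H : Fin n → EuclideanSpace ℝ (Fin n) → ℝ := fun i => O.indicator fun y => φ (c.symm y) * V i y
  have hφc : ContDiffOn ℝ 1 (φ ∘ c.symm) c.target :=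
    (hφ.contMDiff.comp_contMDiffOn
      ((contMDiffOn_chart_symm (I := 𝓡 n) (n := 2) (x := x₀)).of_le (by norm_num))).contDiffOn
  have hV : ∀ i, ContDiffOn ℝ 1 (V i) O := contDiffOn_density_mul_coordField x₀ hX
  have hH0 : ∀ i, ∀ y ∉ K, H i y = 0 := by
    intro i y hy
    by_cases hyO : y ∈ O
    · refine (Set.indicator_of_mem hyO _).trans ?_
      rw [image_eq_zero_of_notMem_tsupport (hKφ y hyO.1 hy), zero_mul]
    · exact Set.indicator_of_notMem hyO _
  have hHc : ∀ i, ContDiff ℝ 1 (H i) := fun i =>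
    contDiff_of_contDiffOn_of_zero hO hK.isClosed hKO
      (((hφc.mono Set.inter_subset_left).mul (hV i)).congr fun y hy => Set.indicator_of_mem hy _)
      (hH0 i)
  have hHs : ∀ i, HasCompactSupport (H i) := fun i => HasCompactSupport.intro hK (hH0 i)
  have hint := fun i => integral_fderiv_apply_eq_zero volume (hHc i) (hHs i)
    (EuclideanSpace.single i (1 : ℝ))
  have hpt : ∀ y ∈ c.target, chartDensity x₀ y * g (c.symm y) =
      ∑ i, fderiv ℝ (H i) y (EuclideanSpace.single i (1 : ℝ)) := by
    intro y hy
    by_cases hyO : y ∈ O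
    · have hfd : ∀ i, fderiv ℝ (H i) y (EuclideanSpace.single i (1 : ℝ)) =
          φ (c.symm y) * fderiv ℝ (V i) y (EuclideanSpace.single i (1 : ℝ)) +
          V i y * fderiv ℝ (φ ∘ c.symm) y (EuclideanSpace.single i (1 : ℝ)) := by
        intro i
        have hev : H i =ᶠ[𝓝 y] fun y => (φ ∘ c.symm) y * V i y := by
          filter_upwards [hO.mem_nhds hyO] with z hz
          exact Set.indicator_of_mem hz _
        rw [hev.fderiv_eq, fderiv_fun_mul
          ((hφc.contDiffAt (c.open_target.mem_nhds hy)).differentiableAt one_ne_zero)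
          (((hV i).contDiffAt (hO.mem_nhds hyO)).differentiableAt one_ne_zero)]
        rfl
      have hdφ : fderiv ℝ (φ ∘ c.symm) y (coordField x₀ X y) =
          ∑ i, coordField x₀ X y i *
            fderiv ℝ (φ ∘ c.symm) y (EuclideanSpace.single i (1 : ℝ)) := by
        conv_lhs => rw [← (EuclideanSpace.basisFun (Fin n) ℝ).sum_repr (coordField x₀ X y)]
        simp
      have hd := (chartDensity_pos x₀ hy).ne'
      simp only [g, hfd, Finset.sum_add_distrib]
      rw [realDifferential_apply_chart x₀ hφ.contMDiff hy, hdφ, chartDivergence, c.right_inv hy,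
        mul_add, add_comm]
      congr 1
      · rw [← Finset.mul_sum]
        field_simp
        rfl
      · rw [Finset.mul_sum]
        exact Finset.sum_congr rfl fun i _ => by simp only [V]; ring
    · have hyK : y ∉ K := fun h => hyO (hKO h)
      rw [hg0 _ (hKφ y hy hyK), mul_zero]
      refine (Finset.sum_eq_zero fun i _ => ?_).symm
      have hev : H i =ᶠ[𝓝 y] fun _ => 0 := by
        filter_upwards [hK.isClosed.isOpen_compl.mem_nhds hyK] with z hz
        exact hH0 i z hz
      rw [hev.fderiv_eq]
      simp
  have hout : ∀ y ∉ c.target, ∑ i, fderiv ℝ (H i) y (EuclideanSpace.single i (1 : ℝ)) = 0 := by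
    intro y hy
    have hyK : y ∉ K := fun h => hy (hKO h).1
    refine Finset.sum_eq_zero fun i _ => ?_
    have hev : H i =ᶠ[𝓝 y] fun _ => 0 := by
      filter_upwards [hK.isClosed.isOpen_compl.mem_nhds hyK] with z hz
      exact hH0 i z hz
    rw [hev.fderiv_eq]
    simp
  calc ∫ x, g x ∂(riemannianVolume n M) = ∫ x in c.source, g x ∂(riemannianVolume n M) :=
        (setIntegral_eq_integral_of_forall_compl_eq_zero fun x hx =>
          hg0 x fun h => hx (hφ.tsupport_subset h).2).symm
    _ = ∫ y in c.target, chartDensity x₀ y * g (c.symm y) :=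
        integral_source_eq x₀ (hgc.stronglyMeasurable_of_hasCompactSupport
          (HasCompactSupport.intro hφ.hasCompactSupport hg0)).aestronglyMeasurable
    _ = ∫ y in c.target, ∑ i, fderiv ℝ (H i) y (EuclideanSpace.single i (1 : ℝ)) :=
        setIntegral_congr_fun (measurableSet_target x₀) hpt
    _ = ∫ y, ∑ i, fderiv ℝ (H i) y (EuclideanSpace.single i (1 : ℝ)) :=
        setIntegral_eq_integral_of_forall_compl_eq_zero hout
    _ = 0 := by
        rw [integral_finsetSum _ fun i _ => (hint i).1]
        exact Finset.sum_eq_zero fun i _ => (hint i).2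

end IntegrationByParts

/-! ### Chart independence of the divergence and the divergence theorem -/

namespace IsExpDiffeo

variable {n : ℕ} {M : Type*} [TopologicalSpace M] [ChartedSpace (EuclideanSpace ℝ (Fin n)) M]
  [RiemannianBundle (fun x : M => TangentSpace (𝓡 n) x)] [IsManifold (𝓡 n) 2 M]
    [IsContMDiffRiemannianBundle (𝓡 n) 1 (EuclideanSpace ℝ (Fin n))
      (fun x : M => TangentSpace (𝓡 n) x)] {B : Set M} {X : ∀ x : M, TangentSpace (𝓡 n) x}
  [T2Space M] [MeasurableSpace M] [BorelSpace M]
  {p : M} {R : ℝ} {Φ : OpenPartialHomeomorph (TangentSpace (𝓡 n) p) M}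
  (hΦ : IsExpDiffeo p R Φ) (hB : IsOpen B) (hBt : B ⊆ Φ.target)
  (hX : ContMDiffOn (𝓡 n) ((𝓡 n).prod 𝓘(ℝ, EuclideanSpace ℝ (Fin n))) 1 (toSection X) B)
include hΦ hB hBt hX

/-- The divergence does not depend on the chart. -/
lemma chartDivergence_eq (x₀ x₁ : M) {x : M} (hxB : x ∈ B)
    (hx₀ : x ∈ (chartAt (EuclideanSpace ℝ (Fin n)) x₀).source)
    (hx₁ : x ∈ (chartAt (EuclideanSpace ℝ (Fin n)) x₁).source) :
    chartDivergence x₀ X x = chartDivergence x₁ X x := by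
  by_contra hne
  set s₀ := (chartAt (EuclideanSpace ℝ (Fin n)) x₀).source
  set s₁ := (chartAt (EuclideanSpace ℝ (Fin n)) x₁).source
  set W := B ∩ s₀ ∩ s₁
  have hW : IsOpen W := (hB.inter (chartAt (EuclideanSpace ℝ (Fin n)) x₀).open_source).inter
    (chartAt (EuclideanSpace ℝ (Fin n)) x₁).open_source
  set d : M → ℝ := fun y => chartDivergence x₀ X y - chartDivergence x₁ X y
  have hc₀ : ContinuousOn (chartDivergence x₀ X) W :=
    (continuousOn_chartDivergence x₀ hB hX).mono fun y hy => hy.1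
  have hc₁ : ContinuousOn (chartDivergence x₁ X) W :=
    (continuousOn_chartDivergence x₁ hB hX).mono fun y hy => ⟨hy.1.1, hy.2⟩
  have hd : ContinuousOn d W := hc₀.sub hc₁
  have hdx : d x ≠ 0 := sub_ne_zero.2 hne
  have hxW : x ∈ W := ⟨⟨hxB, hx₀⟩, hx₁⟩
  -- On this neighbourhood of `x` the difference `d` of the two divergences keeps the sign of `d x`.
  -- A bump function supported there has ∫ χ d = 0, since both divergences satisfy the same
  -- integration by parts formula, whereas positivity of the volume on open sets gives ∫ χ d · d(x)
  -- > 0.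
  have hW' : IsOpen (W ∩ (fun y => d y * d x) ⁻¹' Set.Ioi 0) :=
    (hd.mul continuousOn_const).isOpen_inter_preimage hW isOpen_Ioi
  obtain ⟨χ, hχ, hχ0, hχx⟩ := hΦ.exists_isTestFunction hW'
    (⟨hxW, mul_self_pos.2 hdx⟩ : x ∈ W ∩ (fun y => d y * d x) ⁻¹' Set.Ioi 0) (hBt hxB)
  have hχW : tsupport χ ⊆ W := hχ.tsupport_subset.trans Set.inter_subset_left
  have hcs : ∀ g : M → ℝ, HasCompactSupport fun y => χ y * g y := fun g =>
    hχ.hasCompactSupport.mul_right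
  have hcc : ∀ g : M → ℝ, ContinuousOn g W → Continuous fun y => χ y * g y := fun g hg =>
    continuous_of_continuousOn_of_zero hW (isClosed_tsupport χ) hχW
      (hχ.contMDiff.continuous.continuousOn.mul hg)
      fun y hy => by simp [image_eq_zero_of_notMem_tsupport hy]
  have hdiff : Integrable (fun y => realDifferential (n := n) χ y (X y))
      (riemannianVolume n M) :=
    (continuous_realDifferential_apply hχ hW hχW
      (hX.continuousOn.mono fun y hy => hy.1.1)).integrable_of_hasCompactSupport
      (hasCompactSupport_realDifferential_apply hχ)
  have h₀ := integral_add_mul_chartDivergence_eq_zero x₀ hB hX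
    (hχ.mono (W' := B ∩ s₀) fun y hy => hy.1.1)
  have h₁ := integral_add_mul_chartDivergence_eq_zero x₁ hB hX
    (hχ.mono (W' := B ∩ s₁) fun y hy => ⟨hy.1.1.1, hy.1.2⟩)
  have hi₀ := (hcc _ hc₀).integrable_of_hasCompactSupport (μ := riemannianVolume n M) (hcs _)
  have hi₁ := (hcc _ hc₁).integrable_of_hasCompactSupport (μ := riemannianVolume n M) (hcs _)
  rw [integral_add hdiff hi₀] at h₀
  rw [integral_add hdiff hi₁] at h₁
  have hzero : ∫ y, χ y * (d y * d x) ∂(riemannianVolume n M) = 0 := by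
    have : ∀ y, χ y * (d y * d x) =
        (χ y * chartDivergence x₀ X y - χ y * chartDivergence x₁ X y) * d x := fun y => by
      simp only [d]; ring
    simp_rw [this]
    rw [integral_mul_const, integral_sub hi₀ hi₁]
    have : ∫ y, χ y * chartDivergence x₀ X y ∂(riemannianVolume n M) =
      ∫ y, χ y * chartDivergence x₁ X y ∂(riemannianVolume n M) := by linarith
    rw [this, sub_self, zero_mul]
  have hpos : 0 < ∫ y, χ y * (d y * d x) ∂(riemannianVolume n M) := by
    refine (hcc _ (hd.mul continuousOn_const)).integral_pos_of_hasCompactSupport_nonneg_nonzero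
      (hcs _) (fun y => ?_) (x := x) ?_
    · by_cases hy : y ∈ tsupport χ
      · exact mul_nonneg (hχ0 y) (le_of_lt (hχ.tsupport_subset hy).2)
      · simp [image_eq_zero_of_notMem_tsupport hy]
    · simp [hχx, hdx]
  exact hpos.ne' hzero

lemma chartDivergence_eq_divergence (x₀ : M) {x : M} (hxB : x ∈ B)
    (hx₀ : x ∈ (chartAt (EuclideanSpace ℝ (Fin n)) x₀).source) :
    chartDivergence x₀ X x = divergence X x :=
  hΦ.chartDivergence_eq hB hBt hX x₀ x hxB hx₀ (mem_chart_source _ x)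

/-- The definition of `divergence` changes chart with the point, so even continuity rests on chart
independence. -/
lemma continuousOn_divergence : ContinuousOn (divergence X) B := by
  intro x hx
  have h := (continuousOn_chartDivergence x hB hX).continuousAt
    ((hB.inter (chartAt (EuclideanSpace ℝ (Fin n)) x).open_source).mem_nhds
      ⟨hx, mem_chart_source _ x⟩)
  refine (h.congr ?_).continuousWithinAt
  filter_upwards [(hB.inter (chartAt (EuclideanSpace ℝ (Fin n)) x).open_source).mem_nhds
      ⟨hx, mem_chart_source _ x⟩] with y hy
  exact hΦ.chartDivergence_eq_divergence hB hBt hX x hy.1 hy.2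

lemma integrable_realDifferential_apply {φ : M → ℝ} (hφ : IsTestFunction n B φ) :
    Integrable (fun x => realDifferential (n := n) φ x (X x)) (riemannianVolume n M) :=
  (continuous_realDifferential_apply hφ hB hφ.tsupport_subset
    hX.continuousOn).integrable_of_hasCompactSupport (hasCompactSupport_realDifferential_apply hφ)

lemma integrable_mul_divergence {φ : M → ℝ} (hφ : IsTestFunction n B φ) :
    Integrable (fun x => φ x * divergence X x) (riemannianVolume n M) := by
  refine (continuous_of_continuousOn_of_zero hB (isClosed_tsupport φ) hφ.tsupport_subset
    (hφ.contMDiff.continuous.continuousOn.mul (hΦ.continuousOn_divergence hB hBt hX))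
    fun y hy => ?_).integrable_of_hasCompactSupport hφ.hasCompactSupport.mul_right
  simp [image_eq_zero_of_notMem_tsupport hy]

/-- The divergence theorem for vector fields on a geodesic ball. -/
lemma integral_realDifferential_add_mul_divergence {φ : M → ℝ} (hφ : IsTestFunction n B φ) :
    ∫ x, (realDifferential (n := n) φ x (X x) + φ x * divergence X x)
      ∂(riemannianVolume n M) = 0 := by
  have hcov : ∀ z ∈ B, ∃ χ : M → ℝ, IsTestFunction n
      (B ∩ (chartAt (EuclideanSpace ℝ (Fin n)) z).source) χ ∧ (∀ y, 0 ≤ χ y) ∧ χ z = 1 :=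
    fun z hz => hΦ.exists_isTestFunction
      (hB.inter (chartAt (EuclideanSpace ℝ (Fin n)) z).open_source)
      ⟨hz, mem_chart_source _ z⟩ (hBt hz)
  -- A finite partition of unity on the support of `φ` is built by hand: finitely many of these
  -- bumps have positive sum there, and φ is divided by the sum.
  choose! χ hχ hχ0 hχ1 using hcov
  obtain ⟨t, htK, ht⟩ := hφ.hasCompactSupport.isCompact.elim_nhds_subcover
    (fun z => {y | 0 < χ z y}) fun z hz => by
      have hzB := hφ.tsupport_subset hz
      refine (isOpen_lt continuous_const (hχ z hzB).contMDiff.continuous).mem_nhds ?_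
      simp [hχ1 z hzB]
  have htB : ∀ z ∈ t, z ∈ B := fun z hz => hφ.tsupport_subset (htK z hz)
  set S : M → ℝ := fun y => ∑ z ∈ t, χ z y
  have hS : ContMDiff (𝓡 n) 𝓘(ℝ, ℝ) 1 S :=
    contMDiff_finsetSum fun z hz => (hχ z (htB z hz)).contMDiff
  have hSpos : ∀ y ∈ tsupport φ, 0 < S y := by
    intro y hy
    obtain ⟨z, hz, hzy⟩ := Set.mem_iUnion₂.1 (ht hy)
    exact Finset.sum_pos' (fun w hw => hχ0 w (htB w hw) y) ⟨z, hz, hzy⟩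
  set ψ : M → ℝ := fun y => (S y)⁻¹ * φ y
  have hψ : IsTestFunction n B ψ := by
    refine hφ.mul_contMDiffOn (U := {y | 0 < S y}) (isOpen_lt continuous_const hS.continuous)
      hSpos ?_
    exact hS.contMDiffOn.inv₀ fun y hy => ne_of_gt hy
  have hsum : φ = ∑ z ∈ t, fun y => χ z y * ψ y := by
    ext y
    rw [Finset.sum_apply, ← Finset.sum_mul]
    by_cases hy : y ∈ tsupport φ
    · exact (mul_inv_cancel_left₀ (hSpos y hy).ne' _).symm
    · simp [ψ, image_eq_zero_of_notMem_tsupport hy]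
  have hpiece : ∀ z ∈ t, IsTestFunction n
      (B ∩ (chartAt (EuclideanSpace ℝ (Fin n)) z).source) (fun y => χ z y * ψ y) := by
    intro z hz
    have h := (hχ z (htB z hz)).mul_contMDiffOn isOpen_univ (Set.subset_univ _)
      hψ.contMDiff.contMDiffOn
    simpa only [mul_comm] using h
  -- Each piece lies in one chart domain, where the chart formula applies. Its test function
  -- property is carried through the induction to supply differentiability and integrability for
  -- additivity.
  have hind : ∀ s ⊆ t, IsTestFunction n B (∑ z ∈ s, fun y => χ z y * ψ y) ∧
      ∫ x, (realDifferential (n := n) (∑ z ∈ s, fun y => χ z y * ψ y) x (X x) +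
        (∑ z ∈ s, fun y => χ z y * ψ y) x * divergence X x) ∂(riemannianVolume n M) = 0 := by
    classical
    intro s
    induction s using Finset.induction_on with
    | empty =>
      intro _
      refine ⟨by simpa using IsTestFunction.zero, ?_⟩
      have : ∀ x, realDifferential (n := n) (0 : M → ℝ) x = 0 := fun x =>
        realDifferential_eq_zero (by simp)
      simp [this]
    | insert z s hzs ih =>
      intro hst
      have hz : z ∈ t := hst (Finset.mem_insert_self _ _)
      obtain ⟨ih1, ih2⟩ := ih fun w hw => hst (Finset.mem_insert_of_mem hw)
      have hz1 := (hpiece z hz).mono (W' := B) Set.inter_subset_left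
      rw [Finset.sum_insert hzs]
      refine ⟨hz1.add ih1, ?_⟩
      have hz2 : ∫ x, (realDifferential (n := n) (fun y => χ z y * ψ y) x (X x) +
          (fun y => χ z y * ψ y) x * divergence X x) ∂(riemannianVolume n M) = 0 := by
        rw [← integral_add_mul_chartDivergence_eq_zero z hB hX (hpiece z hz)]
        refine integral_congr_ae (Filter.Eventually.of_forall fun x => ?_)
        by_cases hx : x ∈ tsupport (fun y => χ z y * ψ y)
        · have := (hpiece z hz).tsupport_subset hx
          simp only
          rw [hΦ.chartDivergence_eq_divergence hB hBt hX z this.1 this.2]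
        · have h0 : χ z x * ψ x = 0 :=
            image_eq_zero_of_notMem_tsupport (f := fun y => χ z y * ψ y) hx
          simp [h0]
      have hadd : ∀ x, realDifferential (n := n)
            ((fun y => χ z y * ψ y) + ∑ w ∈ s, fun y => χ w y * ψ y) x (X x) +
          ((fun y => χ z y * ψ y) + ∑ w ∈ s, fun y => χ w y * ψ y) x * divergence X x =
          (realDifferential (n := n) (fun y => χ z y * ψ y) x (X x) +
            (fun y => χ z y * ψ y) x * divergence X x) +
          (realDifferential (n := n) (∑ w ∈ s, fun y => χ w y * ψ y) x (X x) +
            (∑ w ∈ s, fun y => χ w y * ψ y) x * divergence X x) := fun x => by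
        rw [hz1.realDifferential_add ih1, Pi.add_apply, add_apply]
        ring
      simp_rw [hadd]
      rw [integral_add, hz2, ih2, add_zero]
      · exact (hΦ.integrable_realDifferential_apply hB hBt hX hz1).add
          (hΦ.integrable_mul_divergence hB hBt hX hz1)
      · exact (hΦ.integrable_realDifferential_apply hB hBt hX ih1).add
          (hΦ.integrable_mul_divergence hB hBt hX ih1)
  rw [hsum]
  exact (hind t subset_rfl).2

end IsExpDiffeo

/-! ### Passing to limits in L² -/

section Limits

variable {α : Type*} [MeasurableSpace α] {ν : Measure α}

/-- A quadratic inequality passes to limits in the mean. -/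
lemma mul_lintegral_le_lintegral_of_tendsto {c : ℝ≥0∞} (hc : c ≠ ⊤) {a b : α → ℝ≥0∞}
    {ak bk e e' : ℕ → α → ℝ≥0∞}
    (hle : ∀ k, c * ∫⁻ x, ak k x ∂ν ≤ ∫⁻ x, bk k x ∂ν)
    (hak : ∀ k, AEMeasurable (ak k) ν) (hb : AEMeasurable b ν)
    (ha : ∀ k, ∀ δ : ℝ, 0 < δ → ∀ᵐ x ∂ν,
      a x ≤ ENNReal.ofReal (1 + δ) * ak k x + ENNReal.ofReal (1 + δ⁻¹) * e k x)
    (hbk : ∀ k, ∀ δ : ℝ, 0 < δ → ∀ᵐ x ∂ν,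
      bk k x ≤ ENNReal.ofReal (1 + δ) * b x + ENNReal.ofReal (1 + δ⁻¹) * e' k x)
    (he : Filter.Tendsto (fun k => ∫⁻ x, e k x ∂ν) Filter.atTop (𝓝 0))
    (he' : Filter.Tendsto (fun k => ∫⁻ x, e' k x ∂ν) Filter.atTop (𝓝 0)) :
    c * ∫⁻ x, a x ∂ν ≤ ∫⁻ x, b x ∂ν := by
  -- For fixed δ the error terms vanish as k → ∞, although their factor 1 + 1/δ is large; afterwards
  -- δ → 0. This replaces the triangle inequality in L² and allows infinite integrals.
  have key : ∀ δ : ℝ, 0 < δ → c * ∫⁻ x, a x ∂ν ≤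
      ENNReal.ofReal (1 + δ) * (ENNReal.ofReal (1 + δ) * ∫⁻ x, b x ∂ν) := by
    intro δ hδ
    have hk : ∀ k, c * ∫⁻ x, a x ∂ν ≤
        ENNReal.ofReal (1 + δ) * (ENNReal.ofReal (1 + δ) * ∫⁻ x, b x ∂ν +
          ENNReal.ofReal (1 + δ⁻¹) * ∫⁻ x, e' k x ∂ν) +
          c * (ENNReal.ofReal (1 + δ⁻¹) * ∫⁻ x, e k x ∂ν) := by
      intro k
      calc c * ∫⁻ x, a x ∂ν
          ≤ c * (ENNReal.ofReal (1 + δ) * ∫⁻ x, ak k x ∂ν +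
              ENNReal.ofReal (1 + δ⁻¹) * ∫⁻ x, e k x ∂ν) := by
            gcongr
            refine (lintegral_mono_ae (ha k δ hδ)).trans_eq ?_
            rw [lintegral_add_left' ((hak k).const_mul _),
              lintegral_const_mul' _ _ ENNReal.ofReal_ne_top,
              lintegral_const_mul' _ _ ENNReal.ofReal_ne_top]
        _ = ENNReal.ofReal (1 + δ) * (c * ∫⁻ x, ak k x ∂ν) +
              c * (ENNReal.ofReal (1 + δ⁻¹) * ∫⁻ x, e k x ∂ν) := by ring
        _ ≤ _ := by
            gcongr
            refine (hle k).trans ((lintegral_mono_ae (hbk k δ hδ)).trans_eq ?_)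
            rw [lintegral_add_left' (hb.const_mul _),
              lintegral_const_mul' _ _ ENNReal.ofReal_ne_top,
              lintegral_const_mul' _ _ ENNReal.ofReal_ne_top]
    have hlim : Filter.Tendsto (fun k =>
        ENNReal.ofReal (1 + δ) * (ENNReal.ofReal (1 + δ) * ∫⁻ x, b x ∂ν +
          ENNReal.ofReal (1 + δ⁻¹) * ∫⁻ x, e' k x ∂ν) +
          c * (ENNReal.ofReal (1 + δ⁻¹) * ∫⁻ x, e k x ∂ν)) Filter.atTop
        (𝓝 (ENNReal.ofReal (1 + δ) * (ENNReal.ofReal (1 + δ) * ∫⁻ x, b x ∂ν +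
          ENNReal.ofReal (1 + δ⁻¹) * 0) + c * (ENNReal.ofReal (1 + δ⁻¹) * 0))) := by
      refine Filter.Tendsto.add (ENNReal.Tendsto.const_mul (tendsto_const_nhds.add
        (ENNReal.Tendsto.const_mul he' (Or.inr ENNReal.ofReal_ne_top)))
        (Or.inr ENNReal.ofReal_ne_top)) ?_
      exact ENNReal.Tendsto.const_mul (ENNReal.Tendsto.const_mul he
        (Or.inr ENNReal.ofReal_ne_top)) (Or.inr hc)
    have := ge_of_tendsto' hlim hk
    simpa using this
  -- The remaining limit in δ multiplies by a fixed factor, which is treated separately when it is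
  -- infinite.
  by_cases hbtop : ∫⁻ x, b x ∂ν = ⊤
  · rw [hbtop]; exact le_top
  have h0 : Filter.Tendsto (fun δ : ℝ => ENNReal.ofReal (1 + δ)) (𝓝[>] 0) (𝓝 1) := by
    have : Filter.Tendsto (fun δ : ℝ => ENNReal.ofReal (1 + δ)) (𝓝 0)
        (𝓝 (ENNReal.ofReal (1 + 0))) :=
      (ENNReal.continuous_ofReal.comp (continuous_const.add continuous_id)).tendsto 0
    simpa using this.mono_left nhdsWithin_le_nhds
  have hlim : Filter.Tendsto (fun δ : ℝ =>
      ENNReal.ofReal (1 + δ) * (ENNReal.ofReal (1 + δ) * ∫⁻ x, b x ∂ν)) (𝓝[>] 0)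
      (𝓝 (1 * (1 * ∫⁻ x, b x ∂ν))) :=
    ENNReal.Tendsto.mul h0 (Or.inl one_ne_zero)
      (ENNReal.Tendsto.mul_const h0 (Or.inr hbtop)) (Or.inr ENNReal.one_ne_top)
  rw [one_mul, one_mul] at hlim
  refine ge_of_tendsto hlim ?_
  filter_upwards [self_mem_nhdsWithin] with δ hδ using key δ hδ

lemma eLpNorm_two_eq (f : α → ℂ) :
    eLpNorm f 2 ν = (∫⁻ x, ENNReal.ofReal (‖f x‖ ^ 2) ∂ν) ^ (1 / 2 : ℝ) := by
  rw [eLpNorm_eq_lintegral_rpow_enorm_toReal (by norm_num) (by norm_num)]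
  simp only [ENNReal.toReal_ofNat]
  congr 1
  refine lintegral_congr fun x => ?_
  rw [← ofReal_norm, ENNReal.ofReal_rpow_of_nonneg (norm_nonneg _) (by norm_num)]
  norm_cast

lemma tendsto_eLpNorm_two {f : ℕ → α → ℂ}
    (h : Filter.Tendsto (fun k => ∫⁻ x, ENNReal.ofReal (‖f k x‖ ^ 2) ∂ν) Filter.atTop (𝓝 0)) :
    Filter.Tendsto (fun k => eLpNorm (f k) 2 ν) Filter.atTop (𝓝 0) := by
  simp_rw [eLpNorm_two_eq]
  have := h.ennrpow_const (1 / 2)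
  simpa using this

lemma integral_mul_re_eq_inner {u v : α → ℂ} (hu : MemLp u 2 ν) (hv : MemLp v 2 ν) :
    ∫ x, ((starRingEnd ℂ) (u x) * v x).re ∂ν = inner ℝ (hu.toLp u) (hv.toLp v) := by
  rw [L2.inner_def]
  refine integral_congr_ae ?_
  filter_upwards [hu.coeFn_toLp, hv.coeFn_toLp] with x h1 h2
  rw [h1, h2, Complex.inner, mul_comm]

/-- Weighted products of functions that converge in `L²` converge in the mean. -/
lemma tendsto_integral_mul_re {u v : α → ℂ} {uk vk : ℕ → α → ℂ} {m : α → ℝ} {C : ℝ}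
    (hu : MemLp u 2 ν) (hv : MemLp v 2 ν) (huk : ∀ k, MemLp (uk k) 2 ν)
    (hvk : ∀ k, MemLp (vk k) 2 ν)
    (hul : Filter.Tendsto (fun k => eLpNorm (uk k - u) 2 ν) Filter.atTop (𝓝 0))
    (hvl : Filter.Tendsto (fun k => eLpNorm (vk k - v) 2 ν) Filter.atTop (𝓝 0))
    (hm : AEStronglyMeasurable m ν) (hC : ∀ᵐ x ∂ν, |m x| ≤ C) :
    Filter.Tendsto (fun k => ∫ x, m x * ((starRingEnd ℂ) (uk k x) * vk k x).re ∂ν) Filter.atTop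
      (𝓝 (∫ x, m x * ((starRingEnd ℂ) (u x) * v x).re ∂ν)) := by
  have hmul : ∀ w : α → ℂ, AEStronglyMeasurable w ν →
      AEStronglyMeasurable (fun x => (m x : ℂ) * w x) ν := fun w hw =>
    (Complex.continuous_ofReal.comp_aestronglyMeasurable hm).mul hw
  have hbd : ∀ w : α → ℂ, ∀ᵐ x ∂ν, ‖(m x : ℂ) * w x‖ ≤ C * ‖w x‖ := fun w => by
    filter_upwards [hC] with x hx
    rw [norm_mul, Complex.norm_real]
    exact mul_le_mul_of_nonneg_right hx (norm_nonneg _)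
  have hmL : ∀ w : α → ℂ, MemLp w 2 ν → MemLp (fun x => (m x : ℂ) * w x) 2 ν := fun w hw =>
    hw.of_le_mul (hmul w hw.aestronglyMeasurable) (hbd w)
  -- Moving the bounded weight onto one factor turns the integral into a real L² inner product, so
  -- convergence follows from continuity of the inner product.
  have e : ∀ f g : α → ℂ, ∀ x, m x * ((starRingEnd ℂ) (f x) * g x).re =
      ((starRingEnd ℂ) (f x) * ((m x : ℂ) * g x)).re := fun f g x => by
    rw [mul_left_comm, Complex.re_ofReal_mul]
  simp_rw [e]
  have h1 := fun k => integral_mul_re_eq_inner (huk k) (hmL _ (hvk k))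
  simp_rw [h1, integral_mul_re_eq_inner hu (hmL _ hv)]
  refine Filter.Tendsto.inner ?_ ?_
  · exact (Lp.tendsto_Lp_iff_tendsto_eLpNorm'' uk huk u hu).2 hul
  · refine (Lp.tendsto_Lp_iff_tendsto_eLpNorm'' _ (fun k => hmL _ (hvk k)) _ (hmL _ hv)).2 ?_
    have hlim : Filter.Tendsto (fun k => ENNReal.ofReal C * eLpNorm (vk k - v) 2 ν) Filter.atTop
        (𝓝 0) := by
      simpa using ENNReal.Tendsto.const_mul hvl (Or.inr ENNReal.ofReal_ne_top)
    refine tendsto_of_tendsto_of_tendsto_of_le_of_le tendsto_const_nhds hlim (fun _ => zero_le) ?_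
    intro k
    refine eLpNorm_le_mul_eLpNorm_of_ae_le_mul ?_ 2
    filter_upwards [hbd (vk k - v)] with x hx
    simpa [mul_sub] using hx

lemma integrable_mul_re {u v : α → ℂ} {m : α → ℝ} {C : ℝ}
    (hu : MemLp u 2 ν) (hv : MemLp v 2 ν)
    (hm : AEStronglyMeasurable m ν) (hC : ∀ᵐ x ∂ν, |m x| ≤ C) :
    Integrable (fun x => m x * ((starRingEnd ℂ) (u x) * v x).re) ν := by
  have h : Integrable (fun x => (starRingEnd ℂ) (u x) * v x) ν :=
    MemLp.integrable_mul hu.star hv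
  exact h.re.bdd_mul hm hC

end Limits

/-! ### Weighted inequalities for complex covectors -/

section Covectors

variable {n : ℕ} {M : Type*} [TopologicalSpace M] [ChartedSpace (EuclideanSpace ℝ (Fin n)) M]
  [RiemannianBundle (fun x : M => TangentSpace (𝓡 n) x)] {x : M}

/-- A real covector times a complex number. -/
def scaleCovector (c : ℂ) (θ : TangentSpace (𝓡 n) x →L[ℝ] ℝ) : TangentSpace (𝓡 n) x →L[ℝ] ℂ :=
  c • Complex.ofRealCLM.comp θ

lemma scaleCovector_apply (c : ℂ) (θ : TangentSpace (𝓡 n) x →L[ℝ] ℝ)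
    (w : TangentSpace (𝓡 n) x) : scaleCovector c θ w = c * (θ w : ℂ) := rfl

lemma covectorNormSq_scaleCovector (c : ℂ) (θ : TangentSpace (𝓡 n) x →L[ℝ] ℝ) :
    covectorNormSq (scaleCovector c θ) = ‖c‖ ^ 2 * covectorInner θ θ := by
  simp only [covectorNormSq, covectorInner, scaleCovector_apply, norm_mul, mul_pow,
    Complex.norm_real, Finset.mul_sum, Real.norm_eq_abs, sq_abs, ← sq]

lemma norm_add_sq_le_weighted (z w : ℂ) {δ : ℝ} (hδ : 0 < δ) :
    ‖z + w‖ ^ 2 ≤ (1 + δ) * ‖z‖ ^ 2 + (1 + δ⁻¹) * ‖w‖ ^ 2 := by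
  have h1 : ‖z + w‖ ^ 2 ≤ (‖z‖ + ‖w‖) ^ 2 := by gcongr; exact norm_add_le z w
  have h2 : 2 * ‖z‖ * ‖w‖ ≤ δ * ‖z‖ ^ 2 + δ⁻¹ * ‖w‖ ^ 2 := by
    have h3 : 0 ≤ δ⁻¹ * (δ * ‖z‖ - ‖w‖) ^ 2 := by positivity
    have h4 : δ⁻¹ * (δ * ‖z‖ - ‖w‖) ^ 2 = δ * ‖z‖ ^ 2 - 2 * ‖z‖ * ‖w‖ + δ⁻¹ * ‖w‖ ^ 2 := by
      field_simp
      ring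
    linarith
  linarith [add_sq ‖z‖ ‖w‖]

lemma covectorNormSq_add_le_weighted (α β : TangentSpace (𝓡 n) x →L[ℝ] ℂ) {δ : ℝ} (hδ : 0 < δ) :
    covectorNormSq (α + β) ≤ (1 + δ) * covectorNormSq α + (1 + δ⁻¹) * covectorNormSq β := by
  simp only [covectorNormSq, Finset.mul_sum, ← Finset.sum_add_distrib]
  exact Finset.sum_le_sum fun a _ => norm_add_sq_le_weighted _ _ hδ

end Covectors

/-! ### The Poincaré inequality on H¹₀ -/

namespace IsExpDiffeo

variable {n : ℕ} {M : Type*} [TopologicalSpace M] [ChartedSpace (EuclideanSpace ℝ (Fin n)) M]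
  [RiemannianBundle (fun x : M => TangentSpace (𝓡 n) x)] [IsManifold (𝓡 n) 2 M]
    [IsContMDiffRiemannianBundle (𝓡 n) 1 (EuclideanSpace ℝ (Fin n))
      (fun x : M => TangentSpace (𝓡 n) x)]
  [T2Space M] [MeasurableSpace M] [BorelSpace M]
  {p : M} {R r : ℝ} {Φ : OpenPartialHomeomorph (TangentSpace (𝓡 n) p) M}
  (hΦ : IsExpDiffeo p R Φ)

include hΦ

lemma aestronglyMeasurable_covectorNormSq {B : Set M} (hB : IsOpen B) (hBt : B ⊆ Φ.target)
    {α : ∀ x : M, TangentSpace (𝓡 n) x →L[ℝ] ℂ}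
    (hα : ∀ v, AEStronglyMeasurable (fun x => α x (pushforward Φ v x))
      ((riemannianVolume n M).restrict B)) :
    AEStronglyMeasurable (fun x => covectorNormSq (α x)) ((riemannianVolume n M).restrict B) := by
  simp_rw [covectorNormSq_eq_add]
  have hY := fun v => (hΦ.continuousOn_pushforward v).mono hBt
  have hre : ∀ v, AEStronglyMeasurable (fun x => (Complex.reCLM.comp (α x)) (pushforward Φ v x))
      ((riemannianVolume n M).restrict B) := fun v =>
    Complex.continuous_re.comp_aestronglyMeasurable (hα v)
  have him : ∀ v, AEStronglyMeasurable (fun x => (Complex.imCLM.comp (α x)) (pushforward Φ v x))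
      ((riemannianVolume n M).restrict B) := fun v =>
    Complex.continuous_im.comp_aestronglyMeasurable (hα v)
  have hb : ∀ x ∈ B, ∃ b : Module.Basis _ ℝ (TangentSpace (𝓡 n) x), ∀ i, b i = _ := fun x hx =>
    hΦ.exists_basis_pushforward (stdOrthonormalBasis ℝ (TangentSpace (𝓡 n) p)).toBasis (hBt hx)
  exact (aestronglyMeasurable_covectorInner_of_frame hB.measurableSet (fun i => hY _) hb
    (α := fun x => Complex.reCLM.comp (α x)) (β := fun x => Complex.reCLM.comp (α x))
    (fun i => hre _) (fun i => hre _)).add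
    (aestronglyMeasurable_covectorInner_of_frame hB.measurableSet (fun i => hY _) hb
    (α := fun x => Complex.imCLM.comp (α x)) (β := fun x => Complex.imCLM.comp (α x))
    (fun i => him _) (fun i => him _))

lemma integrable_covectorNormSq_differential {B : Set M} (hB : IsOpen B) (hBt : B ⊆ Φ.target)
    {φ : M → ℂ} (hφ : ContMDiff (𝓡 n) 𝓘(ℝ, ℂ) 1 φ) (hc : HasCompactSupport φ)
    (hsupp : tsupport φ ⊆ B) :
    Integrable (fun x => covectorNormSq (differential (n := n) φ x)) (riemannianVolume n M) := by
  have hY := fun v => (hΦ.continuousOn_pushforward v).mono hBt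
  have hd : ∀ v, ContinuousOn (fun x => differential (n := n) φ x (pushforward Φ v x)) B :=
    fun v => continuousOn_mfderiv_apply hφ.contMDiffOn hB (hY v)
  have hre : ∀ v, ContinuousOn (fun x => (Complex.reCLM.comp (differential (n := n) φ x))
      (pushforward Φ v x)) B := fun v => Complex.continuous_re.comp_continuousOn (hd v)
  have him : ∀ v, ContinuousOn (fun x => (Complex.imCLM.comp (differential (n := n) φ x))
      (pushforward Φ v x)) B := fun v => Complex.continuous_im.comp_continuousOn (hd v)
  have hb : ∀ x ∈ B, ∃ b : Module.Basis _ ℝ (TangentSpace (𝓡 n) x), ∀ i, b i = _ := fun x hx =>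
    hΦ.exists_basis_pushforward (stdOrthonormalBasis ℝ (TangentSpace (𝓡 n) p)).toBasis (hBt hx)
  have hcont : ContinuousOn (fun x => covectorNormSq (differential (n := n) φ x)) B := by
    simp_rw [covectorNormSq_eq_add]
    exact (continuousOn_covectorInner_of_frame (fun i => hY _) hb
      (α := fun x => Complex.reCLM.comp (differential (n := n) φ x))
      (β := fun x => Complex.reCLM.comp (differential (n := n) φ x))
      (fun i => hre _) (fun i => hre _)).add
      (continuousOn_covectorInner_of_frame (fun i => hY _) hb
      (α := fun x => Complex.imCLM.comp (differential (n := n) φ x))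
      (β := fun x => Complex.imCLM.comp (differential (n := n) φ x))
      (fun i => him _) (fun i => him _))
  refine integrable_of_continuousOn_of_support hc (hcont.mono hsupp) fun x hx => ?_
  have h : differential (n := n) φ x = 0 :=
    Eq.trans (notMem_tsupport_iff_eventuallyEq.1 hx).mfderiv_eq mfderiv_const
  simp [h, covectorNormSq]

variable (hr : 0 < r) (hrR : r < R)
  {ψ : M → ℂ} {G : ∀ x : M, TangentSpace (𝓡 n) x →L[ℝ] ℂ} (hH : MemH10 (geodBall n p r) ψ G)
include hr hrR hH

lemma aestronglyMeasurable_pushforward (v : TangentSpace (𝓡 n) p) :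
    AEStronglyMeasurable (fun x => G x (pushforward Φ v x))
      ((riemannianVolume n M).restrict (geodBall n p r)) :=
  hH.aestronglyMeasurable _ ((hΦ.continuousOn_pushforward v).mono
    (hΦ.geodBall_subset_target hr hrR))

/-- The Poincaré inequality on `H¹₀` with a bounded gauge potential. -/
lemma mul_lintegral_norm_sq_le (hn : 1 ≤ n) (hconv : IsWeaklyMeanConvexBall (n := n) p r)
    {θ : ∀ x : M, TangentSpace (𝓡 n) x →L[ℝ] ℝ} {C : ℝ}
    (hθ : ∀ v, AEStronglyMeasurable (fun x => θ x (pushforward Φ v x))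
      ((riemannianVolume n M).restrict (geodBall n p r)))
    (hC : ∀ x ∈ geodBall n p r, covectorInner (θ x) (θ x) ≤ C) :
    ENNReal.ofReal ((Real.pi / (2 * r)) ^ 2) * ∫⁻ x in geodBall n p r, ENNReal.ofReal (‖ψ x‖ ^ 2)
        ∂(riemannianVolume n M) ≤
      ∫⁻ x in geodBall n p r,
        ENNReal.ofReal (covectorNormSq (G x - scaleCovector (Complex.I * ψ x) (θ x)))
        ∂(riemannianVolume n M) := by
  have hB := hΦ.isOpen_geodBall hr hrR
  have hBt := hΦ.geodBall_subset_target hr hrR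
  obtain ⟨φ, hφ, hlim1, hlim2⟩ := hH.approx
  have hYc := fun v => (hΦ.continuousOn_pushforward v).mono hBt
  have hscale : ∀ (g : M → ℂ), AEStronglyMeasurable g
      ((riemannianVolume n M).restrict (geodBall n p r)) → ∀ v,
      AEStronglyMeasurable (fun x => scaleCovector (Complex.I * g x) (θ x) (pushforward Φ v x))
      ((riemannianVolume n M).restrict (geodBall n p r)) := fun g hg v =>
    (hg.const_mul _).mul (Complex.continuous_ofReal.comp_aestronglyMeasurable (hθ v))
  have hψm := hH.memLp.aestronglyMeasurable
  have hφm : ∀ k, AEStronglyMeasurable (φ k)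
      ((riemannianVolume n M).restrict (geodBall n p r)) := fun k =>
    (hφ k).1.continuous.continuousOn.aestronglyMeasurable hB.measurableSet
  -- The error between the gauged differentials of φₖ and of ψ.
  set E : ℕ → ∀ x : M, TangentSpace (𝓡 n) x →L[ℝ] ℂ := fun k x =>
    (differential (n := n) (φ k) x - G x) + scaleCovector (Complex.I * (ψ x - φ k x)) (θ x)
  have hsum : ∀ k x, differential (n := n) (φ k) x - scaleCovector (Complex.I * φ k x) (θ x) =
      (G x - scaleCovector (Complex.I * ψ x) (θ x)) + E k x := fun k x => by
    ext w
    simp only [E, add_apply, sub_apply, scaleCovector_apply]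
    ring
  refine mul_lintegral_le_lintegral_of_tendsto ENNReal.ofReal_ne_top
    (ak := fun k x => ENNReal.ofReal (‖φ k x‖ ^ 2))
    (bk := fun k x => ENNReal.ofReal (covectorNormSq
      (differential (n := n) (φ k) x - scaleCovector (Complex.I * φ k x) (θ x))))
    (e := fun k x => ENNReal.ofReal (‖φ k x - ψ x‖ ^ 2))
    (e' := fun k x => ENNReal.ofReal (covectorNormSq (E k x))) ?_ ?_ ?_ ?_ ?_ hlim1 ?_
  · intro k
    -- The gauge term adds to φ̄ₖ dφₖ only the imaginary quantity -i|φₖ|²θ, so the real part is that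
    -- of φ̄ₖ dφₖ.
    have h := hΦ.mul_integral_norm_sq_le_lintegral hr hrR (hφ k).1 (hφ k).2.1 (hφ k).2.2 hn hconv
      (D := fun x => differential (n := n) (φ k) x - scaleCovector (Complex.I * φ k x) (θ x))
      fun x _ w => by
        simp only [sub_apply, scaleCovector_apply, Complex.mul_re, Complex.mul_im,
          Complex.sub_re, Complex.sub_im, Complex.conj_re, Complex.conj_im, Complex.I_re,
          Complex.I_im, Complex.ofReal_re, Complex.ofReal_im]
        ring
    rwa [ENNReal.ofReal_mul (sq_nonneg _), ofReal_integral_eq_lintegral_ofReal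
      (hΦ.integrable_norm_sq hr hrR (hφ k).1 (hφ k).2.1 (hφ k).2.2).integrableOn
      (Filter.Eventually.of_forall fun x => sq_nonneg _)] at h
  · exact fun k => ((hφm k).norm.aemeasurable.pow_const 2).ennreal_ofReal
  · exact (hΦ.aestronglyMeasurable_covectorNormSq hB hBt fun v =>
      (hΦ.aestronglyMeasurable_pushforward hr hrR hH v).sub
        (hscale ψ hψm v)).aemeasurable.ennreal_ofReal
  · refine fun k δ hδ => Filter.Eventually.of_forall fun x => ?_
    rw [← ENNReal.ofReal_mul (by positivity), ← ENNReal.ofReal_mul (by positivity),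
      ← ENNReal.ofReal_add (by positivity) (by positivity)]
    refine ENNReal.ofReal_le_ofReal ?_
    have := norm_add_sq_le_weighted (φ k x) (ψ x - φ k x) hδ
    rwa [add_sub_cancel, norm_sub_rev (ψ x)] at this
  · refine fun k δ hδ => Filter.Eventually.of_forall fun x => ?_
    have h1 := covectorNormSq_nonneg (G x - scaleCovector (Complex.I * ψ x) (θ x))
    have h2 := covectorNormSq_nonneg (E k x)
    rw [← ENNReal.ofReal_mul (by positivity), ← ENNReal.ofReal_mul (by positivity),
      ← ENNReal.ofReal_add (by positivity) (by positivity), hsum]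
    exact ENNReal.ofReal_le_ofReal (covectorNormSq_add_le_weighted _ _ hδ)
  -- The bound |E|² ≤ 2|dφₖ - G|² + 2C|φₖ - ψ|² is where boundedness of θ enters; both terms tend to
  -- zero in the mean by the definition of H¹₀.
  · have hlim : Filter.Tendsto (fun k => ENNReal.ofReal 2 *
        (∫⁻ x in geodBall n p r, ENNReal.ofReal (covectorNormSq
          (differential (n := n) (φ k) x - G x)) ∂(riemannianVolume n M)) +
        ENNReal.ofReal (2 * C) * ∫⁻ x in geodBall n p r, ENNReal.ofReal (‖φ k x - ψ x‖ ^ 2)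
          ∂(riemannianVolume n M)) Filter.atTop (𝓝 0) := by
      simpa using (ENNReal.Tendsto.const_mul (a := ENNReal.ofReal 2) hlim2
        (Or.inr ENNReal.ofReal_ne_top)).add
        (ENNReal.Tendsto.const_mul (a := ENNReal.ofReal (2 * C)) hlim1
          (Or.inr ENNReal.ofReal_ne_top))
    refine tendsto_of_tendsto_of_tendsto_of_le_of_le tendsto_const_nhds hlim (fun _ => zero_le)
      fun k => ?_
    dsimp only
    rw [← lintegral_const_mul' _ _ ENNReal.ofReal_ne_top,
      ← lintegral_const_mul' _ _ ENNReal.ofReal_ne_top, ← lintegral_add_right']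
    · refine setLIntegral_mono' hB.measurableSet fun x hx => ?_
      have hCx := hC x hx
      have hC0 : 0 ≤ C := (covectorInner_self_nonneg _).trans hCx
      have h1 := covectorNormSq_nonneg (differential (n := n) (φ k) x - G x)
      rw [← ENNReal.ofReal_mul (by positivity), ← ENNReal.ofReal_mul (by positivity),
        ← ENNReal.ofReal_add (by positivity) (by positivity)]
      refine ENNReal.ofReal_le_ofReal ?_
      have h2 := covectorNormSq_add_le_weighted (differential (n := n) (φ k) x - G x)
        (scaleCovector (Complex.I * (ψ x - φ k x)) (θ x)) one_pos
      rw [covectorNormSq_scaleCovector, norm_mul, Complex.norm_I, one_mul,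
        norm_sub_rev (ψ x)] at h2
      refine h2.trans ?_
      norm_num
      nlinarith [mul_le_mul_of_nonneg_left hCx (sq_nonneg ‖φ k x - ψ x‖)]
    · exact ((((hφm k).sub hψm).norm.aemeasurable.pow_const 2).ennreal_ofReal).const_mul _

lemma integrableOn_covectorNormSq :
    IntegrableOn (fun x => covectorNormSq (G x)) (geodBall n p r) (riemannianVolume n M) := by
  have hB := hΦ.isOpen_geodBall hr hrR
  have hBt := hΦ.geodBall_subset_target hr hrR
  obtain ⟨φ, hφ, -, hlim2⟩ := hH.approx
  have hm := hΦ.aestronglyMeasurable_covectorNormSq hB hBt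
    (hΦ.aestronglyMeasurable_pushforward hr hrR hH)
  refine ⟨hm, ?_⟩
  -- One approximant at finite distance from `G` suffices, because its own energy is finite.
  obtain ⟨k, hk⟩ := (hlim2.eventually (gt_mem_nhds ENNReal.zero_lt_top)).exists
  set F : M → ℝ := fun x => covectorNormSq (differential (n := n) (φ k) x)
  have hFint : Integrable F (riemannianVolume n M) :=
    hΦ.integrable_covectorNormSq_differential hB hBt (hφ k).1 (hφ k).2.1 (hφ k).2.2
  rw [hasFiniteIntegral_iff_ofReal (Filter.Eventually.of_forall fun x => covectorNormSq_nonneg _)]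
  have hle : ∀ x, ENNReal.ofReal (covectorNormSq (G x)) ≤
      ENNReal.ofReal 2 * ENNReal.ofReal (F x) + ENNReal.ofReal 2 *
        ENNReal.ofReal (covectorNormSq (differential (n := n) (φ k) x - G x)) := by
    intro x
    have h1 := covectorNormSq_le_two_mul (differential (n := n) (φ k) x) (G x)
    have h2 := covectorNormSq_nonneg (differential (n := n) (φ k) x)
    have h3 := covectorNormSq_nonneg (differential (n := n) (φ k) x - G x)
    rw [← ENNReal.ofReal_mul (by positivity), ← ENNReal.ofReal_mul (by positivity),
      ← ENNReal.ofReal_add (by positivity) (by positivity)]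
    exact ENNReal.ofReal_le_ofReal (by linarith)
  refine (lintegral_mono hle).trans_lt ?_
  rw [lintegral_add_left'
      (hFint.integrableOn.aestronglyMeasurable.aemeasurable.ennreal_ofReal.const_mul _),
    lintegral_const_mul' _ _ ENNReal.ofReal_ne_top,
    lintegral_const_mul' _ _ ENNReal.ofReal_ne_top]
  refine ENNReal.add_lt_top.2 ⟨ENNReal.mul_lt_top ENNReal.ofReal_lt_top ?_,
    ENNReal.mul_lt_top ENNReal.ofReal_lt_top hk⟩
  exact (hasFiniteIntegral_iff_ofReal (Filter.Eventually.of_forall fun x =>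
    covectorNormSq_nonneg _)).1 hFint.integrableOn.hasFiniteIntegral

/-- The Poincaré inequality on `H¹₀`. -/
lemma mul_integral_norm_sq_le_integral (hn : 1 ≤ n)
    (hconv : IsWeaklyMeanConvexBall (n := n) p r) :
    (Real.pi / (2 * r)) ^ 2 * ∫ x in geodBall n p r, ‖ψ x‖ ^ 2 ∂(riemannianVolume n M) ≤
      ∫ x in geodBall n p r, covectorNormSq (G x) ∂(riemannianVolume n M) := by
  have h := hΦ.mul_lintegral_norm_sq_le hr hrR hH hn hconv (θ := fun _ => 0) (C := 0)
    (fun v => aestronglyMeasurable_const (b := (0 : ℝ))) (fun x _ => by simp [covectorInner])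
  have h0 : ∀ x, G x - scaleCovector (Complex.I * ψ x) (0 : TangentSpace (𝓡 n) x →L[ℝ] ℝ) =
      G x := fun x => by
    ext w; simp [scaleCovector_apply]
  simp_rw [h0] at h
  rw [← ofReal_integral_eq_lintegral_ofReal (hΦ.integrableOn_covectorNormSq hr hrR hH)
      (Filter.Eventually.of_forall fun x => covectorNormSq_nonneg _),
    ← ofReal_integral_eq_lintegral_ofReal (hH.memLp.integrable_norm_pow two_ne_zero)
      (Filter.Eventually.of_forall fun x => by positivity), ← ENNReal.ofReal_mul (by positivity)]
    at h
  exact (ENNReal.ofReal_le_ofReal_iff (integral_nonneg fun x => covectorNormSq_nonneg _)).1 h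

end IsExpDiffeo

/-! ### The first Dirichlet eigenvalue -/

section Eigenvalue

variable {n : ℕ} {M : Type*} [TopologicalSpace M] [ChartedSpace (EuclideanSpace ℝ (Fin n)) M]
  [RiemannianBundle (fun x : M => TangentSpace (𝓡 n) x)] [IsManifold (𝓡 n) 2 M]
    [IsContMDiffRiemannianBundle (𝓡 n) 1 (EuclideanSpace ℝ (Fin n))
      (fun x : M => TangentSpace (𝓡 n) x)]
  [T2Space M] [MeasurableSpace M] [BorelSpace M] {p : M} {R r : ℝ}
  {Φ : OpenPartialHomeomorph (TangentSpace (𝓡 n) p) M}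

lemma memH10_of_contMDiff {B : Set M} (hB : IsOpen B) {φ : M → ℂ}
    (hφ : ContMDiff (𝓡 n) 𝓘(ℝ, ℂ) 1 φ) (hc : HasCompactSupport φ) (hsupp : tsupport φ ⊆ B) :
    MemH10 B φ (differential (n := n) φ) where
  memLp := (hφ.continuous.memLp_of_hasCompactSupport hc).restrict B
  aestronglyMeasurable Y hY :=
    (continuousOn_mfderiv_apply hφ.contMDiffOn hB hY).aestronglyMeasurable hB.measurableSet
  approx := ⟨fun _ => φ, fun _ => ⟨hφ, hc, hsupp⟩, by simp, by simp [covectorNormSq]⟩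

lemma IsExpDiffeo.le_lambda1 (hΦ : IsExpDiffeo p R Φ) (hr : 0 < r) (hrR : r < R) (hn : 1 ≤ n)
    (hconv : IsWeaklyMeanConvexBall (n := n) p r) :
    Real.pi ^ 2 / (4 * r ^ 2) ≤ lambda1 n (geodBall n p r) := by
  have hB := hΦ.isOpen_geodBall hr hrR
  have hpB : p ∈ geodBall n p r := by
    change riemannianEDist (𝓡 n) p p < _
    rw [riemannianEDist_self]
    exact ENNReal.ofReal_pos.2 hr
  -- The infimum of the empty set of reals is zero, so an admissible function must be exhibited: a
  -- bump at `p`.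
  refine le_csInf ?_ ?_
  · obtain ⟨χ, hχ, -, hχp⟩ := hΦ.exists_isTestFunction hB hpB (hΦ.center_mem_target (hr.trans hrR))
    have hu : ContMDiff (𝓡 n) 𝓘(ℝ, ℂ) 1 (fun x => (χ x : ℂ)) :=
      Complex.ofRealCLM.contDiff.contMDiff.comp hχ.contMDiff
    have hc : HasCompactSupport fun x => (χ x : ℂ) :=
      hχ.hasCompactSupport.comp_left (g := fun t : ℝ => (t : ℂ)) Complex.ofReal_zero
    have hsupp : tsupport (fun x => (χ x : ℂ)) ⊆ geodBall n p r :=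
      (closure_mono fun x hx => by
        rw [Function.mem_support] at hx ⊢
        exact fun h => hx (by simp [h])).trans hχ.tsupport_subset
    refine ⟨_, _, _, memH10_of_contMDiff hB hu hc hsupp, ?_, rfl⟩
    have h1 : Continuous fun x => ‖(χ x : ℂ)‖ ^ 2 := hu.continuous.norm.pow 2
    have h2 : HasCompactSupport fun x => ‖(χ x : ℂ)‖ ^ 2 :=
      hc.comp_left (g := fun z : ℂ => ‖z‖ ^ 2) (by simp)
    rw [setIntegral_eq_integral_of_forall_compl_eq_zero fun x hx => by
      have : (fun x => (χ x : ℂ)) x = 0 :=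
        image_eq_zero_of_notMem_tsupport (f := fun x => (χ x : ℂ)) fun h => hx (hsupp h)
      simp only at this
      simp [this]]
    exact h1.integral_pos_of_hasCompactSupport_nonneg_nonzero h2 (fun x => sq_nonneg _) (x := p)
      (by simp [hχp])
  · rintro q ⟨u, G, hH, hpos, rfl⟩
    rw [le_div_iff₀ hpos]
    have h := hΦ.mul_integral_norm_sq_le_integral hr hrR hH hn hconv
    have e : (Real.pi / (2 * r)) ^ 2 = Real.pi ^ 2 / (4 * r ^ 2) := by
      rw [div_pow, mul_pow]; norm_num
    rwa [e] at h

end Eigenvalue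

/-! ### The variance of one momentum component -/

section Variance

variable {α : Type*} [MeasurableSpace α] {ν : Measure α} {ψ g : α → ℂ} {f : α → ℝ} {C : ℝ}

lemma norm_sq_eq_conj_mul_re (z : ℂ) : ‖z‖ ^ 2 = ((starRingEnd ℂ) z * z).re := by
  rw [Complex.sq_norm, Complex.normSq_apply]
  simp

/-- The hypothesis `h0`, an instance of the divergence theorem, says exactly that the real part
vanishes. This is the symmetry of the momentum operator, thanks to the term ½ f. -/
lemma integral_conj_mul_add_half_mul (hψ : MemLp ψ 2 ν) (hg : MemLp g 2 ν)
    (hf : AEStronglyMeasurable f ν) (hC : ∀ᵐ x ∂ν, |f x| ≤ C)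
    (h0 : ∫ x, f x * ((starRingEnd ℂ) (ψ x) * ψ x).re ∂ν +
      2 * ∫ x, ((starRingEnd ℂ) (ψ x) * g x).re ∂ν = 0) :
    ∫ x, (starRingEnd ℂ) (ψ x) * (g x + (1 / 2) * (f x : ℂ) * ψ x) ∂ν =
      Complex.I * ((∫ x, ((starRingEnd ℂ) (ψ x) * g x).im ∂ν : ℝ) : ℂ) := by
  have h1 : Integrable (fun x => (starRingEnd ℂ) (ψ x) * g x) ν := MemLp.integrable_mul hψ.star hg
  have h2 := integrable_mul_re hψ hψ hf hC
  have e : ∀ x, (starRingEnd ℂ) (ψ x) * (g x + (1 / 2) * (f x : ℂ) * ψ x) =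
      (starRingEnd ℂ) (ψ x) * g x +
        (1 / 2 : ℂ) * ((f x * ((starRingEnd ℂ) (ψ x) * ψ x).re : ℝ) : ℂ) := fun x => by
    have : (starRingEnd ℂ) (ψ x) * ψ x = (((starRingEnd ℂ) (ψ x) * ψ x).re : ℂ) := by
      rw [← norm_sq_eq_conj_mul_re, Complex.conj_mul']
      norm_cast
    rw [Complex.ofReal_mul, ← this]
    ring
  have h3 : Integrable (fun x => ((f x * ((starRingEnd ℂ) (ψ x) * ψ x).re : ℝ) : ℂ)) ν := h2.ofReal
  simp_rw [e]
  rw [integral_add h1 (h3.const_mul _), integral_const_mul, integral_complex_ofReal]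
  have hre := Complex.reCLM.integral_comp_comm h1
  have him := Complex.imCLM.integral_comp_comm h1
  simp only [Complex.reCLM_apply, Complex.imCLM_apply] at hre him
  rw [hre] at h0
  rw [him]
  generalize ∫ x, f x * ((starRingEnd ℂ) (ψ x) * ψ x).re ∂ν = s at h0 ⊢
  apply Complex.ext
  · simp
    linarith
  · simp

/-- The variance of `-iħ(g + ½ f ψ)` as a perturbation of a gauged Dirichlet energy. -/
lemma integral_norm_sq_sub_norm_integral_sq (ħ : ℝ) (hψ : MemLp ψ 2 ν) (hg : MemLp g 2 ν)
    (hf : AEStronglyMeasurable f ν) (hC : ∀ᵐ x ∂ν, |f x| ≤ C) (h1 : ∫ x, ‖ψ x‖ ^ 2 ∂ν = 1)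
    (h0 : ∫ x, f x * ((starRingEnd ℂ) (ψ x) * ψ x).re ∂ν +
      2 * ∫ x, ((starRingEnd ℂ) (ψ x) * g x).re ∂ν = 0) :
    ∫ x, ‖-Complex.I * (ħ : ℂ) * (g x + (1 / 2) * (f x : ℂ) * ψ x)‖ ^ 2 ∂ν -
      ‖∫ x, (starRingEnd ℂ) (ψ x) *
        (-Complex.I * (ħ : ℂ) * (g x + (1 / 2) * (f x : ℂ) * ψ x)) ∂ν‖ ^ 2 =
    ħ ^ 2 * (∫ x, ‖g x - Complex.I * ψ x *
        ((∫ y, ((starRingEnd ℂ) (ψ y) * g y).im ∂ν : ℝ) : ℂ)‖ ^ 2 ∂ν +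
      ∫ x, f x * ((starRingEnd ℂ) (ψ x) * g x).re ∂ν +
      1 / 4 * ∫ x, f x ^ 2 * ((starRingEnd ℂ) (ψ x) * ψ x).re ∂ν) := by
  have hm : ∫ x, (starRingEnd ℂ) (ψ x) *
        (-Complex.I * (ħ : ℂ) * (g x + (1 / 2) * (f x : ℂ) * ψ x)) ∂ν =
      (ħ : ℂ) * ((∫ x, ((starRingEnd ℂ) (ψ x) * g x).im ∂ν : ℝ) : ℂ) := by
    have e : ∀ x, (starRingEnd ℂ) (ψ x) *
        (-Complex.I * (ħ : ℂ) * (g x + (1 / 2) * (f x : ℂ) * ψ x)) =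
        (-Complex.I * ħ) * ((starRingEnd ℂ) (ψ x) * (g x + (1 / 2) * (f x : ℂ) * ψ x)) :=
      fun x => by ring
    simp_rw [e]
    rw [integral_const_mul, integral_conj_mul_add_half_mul hψ hg hf hC h0, ← mul_assoc]
    congr 1
    linear_combination (-(ħ : ℂ)) * Complex.I_mul_I
  rw [hm]
  set c : ℝ := ∫ x, ((starRingEnd ℂ) (ψ x) * g x).im ∂ν with hc
  have hgI : Integrable (fun x => ‖g x‖ ^ 2) ν := hg.integrable_norm_pow two_ne_zero
  have hψI : Integrable (fun x => ‖ψ x‖ ^ 2) ν := hψ.integrable_norm_pow two_ne_zero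
  have hfg := integrable_mul_re hψ hg hf hC
  have hff : Integrable (fun x => f x ^ 2 * ((starRingEnd ℂ) (ψ x) * ψ x).re) ν := by
    refine integrable_mul_re hψ hψ (hf.pow 2) (C := C ^ 2) ?_
    filter_upwards [hC] with x hx
    rw [abs_pow]
    exact pow_le_pow_left₀ (abs_nonneg _) hx 2
  have him : Integrable (fun x => ((starRingEnd ℂ) (ψ x) * g x).im) ν :=
    (show Integrable (fun x => (starRingEnd ℂ) (ψ x) * g x) ν from
      MemLp.integrable_mul hψ.star hg).im
  have e1 : ∀ x, ‖-Complex.I * (ħ : ℂ) * (g x + (1 / 2) * (f x : ℂ) * ψ x)‖ ^ 2 =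
      ħ ^ 2 * ((‖g x‖ ^ 2 + f x * ((starRingEnd ℂ) (ψ x) * g x).re) +
        1 / 4 * (f x ^ 2 * ((starRingEnd ℂ) (ψ x) * ψ x).re)) := fun x => by
    rw [norm_mul, norm_mul, norm_neg, Complex.norm_I, one_mul, Complex.norm_real, mul_pow,
      Real.norm_eq_abs, sq_abs]
    congr 1
    simp only [Complex.sq_norm, Complex.normSq_apply, Complex.add_re, Complex.add_im,
      Complex.mul_re, Complex.mul_im, Complex.conj_re, Complex.conj_im, Complex.ofReal_re,
      Complex.ofReal_im]
    norm_num
    ring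
  -- Integrated with ‖ψ‖ = 1 and c = ∫ Im(ψ̄ g), this gives ∫|g|² - 2c² + c², so the shift by icψ
  -- accounts for subtracting the squared mean.
  have e2 : ∀ x, ‖g x - Complex.I * ψ x * (c : ℂ)‖ ^ 2 =
      (‖g x‖ ^ 2 - 2 * c * ((starRingEnd ℂ) (ψ x) * g x).im) + c ^ 2 * ‖ψ x‖ ^ 2 := fun x => by
    simp only [Complex.sq_norm, Complex.normSq_apply, Complex.sub_re, Complex.sub_im,
      Complex.mul_re, Complex.mul_im, Complex.conj_re, Complex.conj_im, Complex.ofReal_re,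
      Complex.ofReal_im, Complex.I_re, Complex.I_im]
    ring
  simp_rw [e1, e2]
  have h2 : Integrable (fun x => ‖g x‖ ^ 2 + f x * ((starRingEnd ℂ) (ψ x) * g x).re) ν :=
    hgI.add hfg
  have h3 : Integrable (fun x => ‖g x‖ ^ 2 - 2 * c * ((starRingEnd ℂ) (ψ x) * g x).im) ν :=
    hgI.sub (him.const_mul _)
  rw [integral_const_mul, integral_add h2 (hff.const_mul _), integral_add hgI hfg,
    integral_const_mul, integral_add h3 (hψI.const_mul _), integral_sub hgI (him.const_mul _),
    integral_const_mul, integral_const_mul, h1, ← hc,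
    norm_mul, Complex.norm_real, Complex.norm_real, mul_pow, Real.norm_eq_abs, Real.norm_eq_abs,
    sq_abs, sq_abs]
  ring

end Variance

/-! ### Orthonormal frames -/

namespace IsOrthonormalFrameOn

variable {n : ℕ} {M : Type*} [TopologicalSpace M] [ChartedSpace (EuclideanSpace ℝ (Fin n)) M]
  [RiemannianBundle (fun x : M => TangentSpace (𝓡 n) x)] [IsManifold (𝓡 n) 1 M]
  {B : Set M} {X : Fin n → ∀ x : M, TangentSpace (𝓡 n) x} (hX : IsOrthonormalFrameOn B X)
  {x : M} (hx : x ∈ B)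
include hX hx

lemma exists_orthonormalBasis :
    ∃ b : OrthonormalBasis (Fin n) ℝ (TangentSpace (𝓡 n) x), ∀ a, b a = X a x := by
  have h := hX.orthonormal x hx
  have hfin : Module.finrank ℝ (TangentSpace (𝓡 n) x) = n :=
    finrank_euclideanSpace_fin (𝕜 := ℝ) (n := n)
  refine ⟨OrthonormalBasis.mk h (h.linearIndependent.span_eq_top_of_card_eq_finrank' ?_).ge,
    fun a => by simp⟩
  rw [hfin, Fintype.card_fin]

lemma covectorNormSq_eq (α : TangentSpace (𝓡 n) x →L[ℝ] ℂ) :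
    covectorNormSq α = ∑ a, ‖α (X a x)‖ ^ 2 := by
  obtain ⟨b, hb⟩ := hX.exists_orthonormalBasis hx
  simp_rw [covectorNormSq_eq_sum b, hb]

lemma norm_apply_sq_le (α : TangentSpace (𝓡 n) x →L[ℝ] ℂ) (a : Fin n) :
    ‖α (X a x)‖ ^ 2 ≤ covectorNormSq α := by
  rw [hX.covectorNormSq_eq hx]
  exact Finset.single_le_sum (f := fun a => ‖α (X a x)‖ ^ 2) (fun _ _ => sq_nonneg _)
    (Finset.mem_univ a)

lemma sum_smul_innerSL_apply (c : Fin n → ℝ) (a : Fin n) :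
    (∑ b, c b • innerSL ℝ (X b x)) (X a x) = c a := by
  have h := orthonormal_iff_ite.1 (hX.orthonormal x hx)
  simp [h]

/-- For constant coefficients the gauge potential has constant norm, which gives the bound that the
gauged Poincaré inequality requires. -/
lemma covectorInner_sum_smul_innerSL (c : Fin n → ℝ) :
    covectorInner (∑ a, c a • innerSL ℝ (X a x)) (∑ a, c a • innerSL ℝ (X a x)) =
      ∑ a, c a ^ 2 := by
  obtain ⟨b, hb⟩ := hX.exists_orthonormalBasis hx
  simp_rw [covectorInner_eq_sum b, hb, hX.sum_smul_innerSL_apply hx, sq]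

end IsOrthonormalFrameOn

section TestIdentities

variable {n : ℕ} {M : Type*} [TopologicalSpace M] [ChartedSpace (EuclideanSpace ℝ (Fin n)) M]
  {u : M → ℂ} {B : Set M}

lemma isTestFunction_norm_sq (hu : ContMDiff (𝓡 n) 𝓘(ℝ, ℂ) 1 u) (hc : HasCompactSupport u)
    (hsupp : tsupport u ⊆ B) : IsTestFunction n B (fun x => ‖u x‖ ^ 2) where
  contMDiff := (contDiff_norm_sq ℝ (E := ℂ) (n := 1)).contMDiff.comp hu
  hasCompactSupport := hc.comp_left (g := fun z : ℂ => ‖z‖ ^ 2) (by simp)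
  tsupport_subset := (closure_mono fun x hx => by
    rw [Function.mem_support] at hx ⊢
    exact fun h => hx (by simp [h])).trans hsupp

lemma realDifferential_norm_sq {x : M} (hu : MDifferentiableAt (𝓡 n) 𝓘(ℝ, ℂ) u x)
    (w : TangentSpace (𝓡 n) x) :
    realDifferential (n := n) (fun y => ‖u y‖ ^ 2) x w =
      2 * ((starRingEnd ℂ) (u x) * differential (n := n) u x w).re := by
  have h := realDifferential_comp_mul_norm_sq (ρ := fun _ => 0) (η := fun _ => 1)
    mdifferentiableAt_const hu (differentiableAt_const _) w
  simpa using h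

lemma realDifferential_mul_norm_sq {f : M → ℝ} {x : M}
    (hf : MDifferentiableAt (𝓡 n) 𝓘(ℝ, ℝ) f x) (hu : MDifferentiableAt (𝓡 n) 𝓘(ℝ, ℂ) u x)
    (w : TangentSpace (𝓡 n) x) :
    realDifferential (n := n) (fun y => f y * ‖u y‖ ^ 2) x w =
      realDifferential (n := n) f x w * ‖u x‖ ^ 2 +
        f x * (2 * ((starRingEnd ℂ) (u x) * differential (n := n) u x w).re) := by
  have h := realDifferential_comp_mul_norm_sq (η := id) hf hu differentiableAt_id w
  simpa using h

end TestIdentities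

/-! ### Divergence identities and the momentum uncertainty -/

namespace IsOrthonormalFrameOn

variable {n : ℕ} {M : Type*} [TopologicalSpace M] [ChartedSpace (EuclideanSpace ℝ (Fin n)) M]
  [RiemannianBundle (fun x : M => TangentSpace (𝓡 n) x)] [IsManifold (𝓡 n) 2 M]
    [IsContMDiffRiemannianBundle (𝓡 n) 1 (EuclideanSpace ℝ (Fin n))
      (fun x : M => TangentSpace (𝓡 n) x)]
  [T2Space M] [MeasurableSpace M] [BorelSpace M]
  {B : Set M} {X : Fin n → ∀ x : M, TangentSpace (𝓡 n) x}

section Measurability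

variable (hX : IsOrthonormalFrameOn B X) (hB : IsOpen B)
include hX hB

lemma aestronglyMeasurable_divergence (a : Fin n) :
    AEStronglyMeasurable (divergence (X a)) ((riemannianVolume n M).restrict B) :=
  (hX.contMDiffOn_divergence a).continuousOn.aestronglyMeasurable hB.measurableSet

lemma aestronglyMeasurable_potential :
    AEStronglyMeasurable (potential X) ((riemannianVolume n M).restrict B) := by
  refine ContinuousOn.aestronglyMeasurable ?_ hB.measurableSet
  refine (continuousOn_const.mul (continuousOn_finsetSum _ fun a _ => ?_)).add
    (continuousOn_const.mul (continuousOn_finsetSum _ fun a _ =>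
      (hX.contMDiffOn_divergence a).continuousOn.pow 2))
  exact continuousOn_mfderiv_apply (hX.contMDiffOn_divergence a) hB (hX.contMDiffOn a).continuousOn

variable {u : M → ℂ} {G : ∀ x : M, TangentSpace (𝓡 n) x →L[ℝ] ℂ}

lemma exists_abs_le : ∃ C : ℝ,
    (∀ a, ∀ᵐ x ∂((riemannianVolume n M).restrict B), |divergence (X a) x| ≤ C) ∧
    (∀ a, ∀ᵐ x ∂((riemannianVolume n M).restrict B), |divergence (X a) x ^ 2| ≤ C) ∧
    ∀ᵐ x ∂((riemannianVolume n M).restrict B), |potential X x| ≤ C := by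
  obtain ⟨C, hC⟩ := hX.bounded
  refine ⟨max C (C ^ 2), fun a => ?_, fun a => ?_, ?_⟩ <;>
    refine ae_restrict_of_forall_mem hB.measurableSet fun x hx => ?_
  · exact ((hC x hx).1 a).trans (le_max_left _ _)
  · rw [abs_pow]
    exact (pow_le_pow_left₀ (abs_nonneg _) ((hC x hx).1 a) 2).trans (le_max_right _ _)
  · exact (hC x hx).2.trans (le_max_left _ _)

end Measurability

section Test

variable {p : M} {R : ℝ} {Φ : OpenPartialHomeomorph (TangentSpace (𝓡 n) p) M}
  (hΦ : IsExpDiffeo p R Φ) (hX : IsOrthonormalFrameOn B X) (hB : IsOpen B) (hBt : B ⊆ Φ.target)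
  {u : M → ℂ} (hu : ContMDiff (𝓡 n) 𝓘(ℝ, ℂ) 1 u)
  (hc : HasCompactSupport u) (hsupp : tsupport u ⊆ B)
include hΦ hX hB hBt hu hc hsupp

lemma memLp_differential (a : Fin n) :
    MemLp (fun x => differential (n := n) u x (X a x)) 2 ((riemannianVolume n M).restrict B) := by
  set d : M → ℂ := fun x => differential (n := n) u x (X a x)
  have h0 : ∀ x ∉ tsupport u, d x = 0 := fun x hx => by
    have h : differential (n := n) u x = 0 :=
      Eq.trans (notMem_tsupport_iff_eventuallyEq.1 hx).mfderiv_eq mfderiv_const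
    simp only [d]
    rw [h]; rfl
  have hd : Continuous d := continuous_of_continuousOn_of_zero hB (isClosed_tsupport u) hsupp
    (continuousOn_mfderiv_apply hu.contMDiffOn hB (hX.contMDiffOn a).continuousOn) h0
  exact (hd.memLp_of_hasCompactSupport (HasCompactSupport.intro hc h0)).restrict B

/-- The divergence theorem for the field |u|² Xₐ. -/
lemma integral_divergence_add_test (a : Fin n) :
    ∫ x in B, divergence (X a) x * ((starRingEnd ℂ) (u x) * u x).re ∂(riemannianVolume n M) +
      2 * ∫ x in B, ((starRingEnd ℂ) (u x) * differential (n := n) u x (X a x)).re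
        ∂(riemannianVolume n M) = 0 := by
  obtain ⟨C, hC, -⟩ := hX.exists_abs_le hB
  have huL : MemLp u 2 ((riemannianVolume n M).restrict B) :=
    (hu.continuous.memLp_of_hasCompactSupport hc).restrict B
  have hdL := hX.memLp_differential hΦ hB hBt hu hc hsupp a
  have h := hΦ.integral_realDifferential_add_mul_divergence hB hBt (hX.contMDiffOn a)
    (isTestFunction_norm_sq hu hc hsupp)
  have hi1 := integrable_mul_re huL huL (hX.aestronglyMeasurable_divergence hB a) (hC a)
  have hi2 := integrable_mul_re huL hdL (aestronglyMeasurable_const (b := (2 : ℝ))) (C := 2)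
    (by simp)
  rw [← integral_const_mul, ← integral_add hi1 hi2, ← h,
    setIntegral_eq_integral_of_forall_compl_eq_zero]
  · refine integral_congr_ae (Filter.Eventually.of_forall fun x => ?_)
    dsimp only
    rw [realDifferential_norm_sq (hu.mdifferentiableAt one_ne_zero), norm_sq_eq_conj_mul_re]
    ring
  · intro x hx
    have h0 : u x = 0 := image_eq_zero_of_notMem_tsupport fun h => hx (hsupp h)
    simp [h0]

/-- The divergence theorem for the fields fₐ|u|² Xₐ with fₐ = div Xₐ, summed over a. The derivatives
Xₐ(fₐ) are then expressed by the potential through 2V = ∑ₐ (Xₐ(fₐ) + ½ fₐ²). -/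
lemma integral_potential_add_test :
    2 * ∫ x in B, potential X x * ((starRingEnd ℂ) (u x) * u x).re ∂(riemannianVolume n M) +
      ∑ a, (1 / 2 * ∫ x in B, divergence (X a) x ^ 2 * ((starRingEnd ℂ) (u x) * u x).re
        ∂(riemannianVolume n M) +
      2 * ∫ x in B, divergence (X a) x *
        ((starRingEnd ℂ) (u x) * differential (n := n) u x (X a x)).re
        ∂(riemannianVolume n M)) = 0 := by
  obtain ⟨C, hC, hC2, hCV⟩ := hX.exists_abs_le hB
  have huL : MemLp u 2 ((riemannianVolume n M).restrict B) :=
    (hu.continuous.memLp_of_hasCompactSupport hc).restrict B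
  have hdL := hX.memLp_differential hΦ hB hBt hu hc hsupp
  have hdm := hX.aestronglyMeasurable_divergence hB
  have htest : ∀ a, IsTestFunction n B (fun x => divergence (X a) x * ‖u x‖ ^ 2) := fun a =>
    (isTestFunction_norm_sq hu hc hsupp).mul_contMDiffOn hB
      (isTestFunction_norm_sq hu hc hsupp).tsupport_subset (hX.contMDiffOn_divergence a)
  have h := fun a => hΦ.integral_realDifferential_add_mul_divergence hB hBt (hX.contMDiffOn a)
    (htest a)
  have hi := fun a => (hΦ.integrable_realDifferential_apply hB hBt (hX.contMDiffOn a)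
    (htest a)).add (hΦ.integrable_mul_divergence hB hBt (hX.contMDiffOn a) (htest a))
  have hsum := (integral_finsetSum Finset.univ fun a _ => hi a).trans
    (Finset.sum_eq_zero fun a _ => h a)
  have hi1 := integrable_mul_re huL huL (hX.aestronglyMeasurable_potential hB) hCV
  have hi2 : ∀ a, Integrable (fun x => divergence (X a) x ^ 2 * ((starRingEnd ℂ) (u x) * u x).re)
      ((riemannianVolume n M).restrict B) :=
    fun a => integrable_mul_re huL huL ((hdm a).pow 2) (hC2 a)
  have hi3 := fun a => integrable_mul_re huL (hdL a) (hdm a) (hC a)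
  have e : ∀ a, 1 / 2 * ∫ x in B, divergence (X a) x ^ 2 * ((starRingEnd ℂ) (u x) * u x).re
        ∂(riemannianVolume n M) +
      2 * ∫ x in B, divergence (X a) x *
        ((starRingEnd ℂ) (u x) * differential (n := n) u x (X a x)).re
        ∂(riemannianVolume n M) = ∫ x in B, (1 / 2 * (divergence (X a) x ^ 2 *
          ((starRingEnd ℂ) (u x) * u x).re) + 2 * (divergence (X a) x *
        ((starRingEnd ℂ) (u x) * differential (n := n) u x (X a x)).re))
        ∂(riemannianVolume n M) := fun a => by
    rw [← integral_const_mul, ← integral_const_mul,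
      ← integral_add ((hi2 a).const_mul _) ((hi3 a).const_mul _)]
  simp_rw [e]
  have hi4 : ∀ a, Integrable (fun x => 1 / 2 * (divergence (X a) x ^ 2 *
          ((starRingEnd ℂ) (u x) * u x).re) + 2 * (divergence (X a) x *
        ((starRingEnd ℂ) (u x) * differential (n := n) u x (X a x)).re))
        ((riemannianVolume n M).restrict B) :=
    fun a => ((hi2 a).const_mul (1 / 2)).add ((hi3 a).const_mul 2)
  rw [← integral_finsetSum _ fun a _ => hi4 a, ← integral_const_mul, ← integral_add
    (hi1.const_mul _) (integrable_finsetSum _ fun a _ => hi4 a), ← hsum,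
    setIntegral_eq_integral_of_forall_compl_eq_zero]
  · refine integral_congr_ae (Filter.Eventually.of_forall fun x => ?_)
    dsimp only [Pi.add_apply]
    by_cases hx : x ∈ B
    · have e1 : ∀ a, realDifferential (n := n) (fun y => divergence (X a) y * ‖u y‖ ^ 2) x (X a x) =
          _ := fun a => realDifferential_mul_norm_sq
        (((hX.contMDiffOn_divergence a).contMDiffAt (hB.mem_nhds hx)).mdifferentiableAt one_ne_zero)
        (hu.mdifferentiableAt one_ne_zero) (X a x)
      simp_rw [e1, norm_sq_eq_conj_mul_re]
      have e2 : 2 * potential X x = ∑ a, (realDifferential (n := n) (divergence (X a)) x (X a x) +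
          1 / 2 * divergence (X a) x ^ 2) := by
        have h : potential X x =
          1 / 2 * ∑ a, realDifferential (n := n) (divergence (X a)) x (X a x) +
          1 / 4 * ∑ a, divergence (X a) x ^ 2 := rfl
        rw [Finset.sum_add_distrib, ← Finset.mul_sum, h]
        ring
      rw [← mul_assoc, e2, Finset.sum_mul, ← Finset.sum_add_distrib]
      exact Finset.sum_congr rfl fun a _ => by ring
    · have h0 : u x = 0 := image_eq_zero_of_notMem_tsupport fun h => hx (hsupp h)
      have h1 : ∀ a, realDifferential (n := n) (fun y => divergence (X a) y * ‖u y‖ ^ 2) x = 0 :=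
        fun a => realDifferential_eq_zero fun h => hx ((htest a).tsupport_subset h)
      simp [h0, h1]
  · intro x hx
    have h0 : u x = 0 := image_eq_zero_of_notMem_tsupport fun h => hx (hsupp h)
    simp [h0]

end Test

section Sobolev

variable {p : M} {r R : ℝ} {Φ : OpenPartialHomeomorph (TangentSpace (𝓡 n) p) M}
  (hΦ : IsExpDiffeo p R Φ) (hr : 0 < r) (hrR : r < R)
  (hX : IsOrthonormalFrameOn (geodBall n p r) X)
  {ψ : M → ℂ} {G : ∀ x : M, TangentSpace (𝓡 n) x →L[ℝ] ℂ} (hH : MemH10 (geodBall n p r) ψ G)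
include hΦ hr hrR hX hH

lemma memLp_apply (a : Fin n) :
    MemLp (fun x => G x (X a x)) 2 ((riemannianVolume n M).restrict (geodBall n p r)) := by
  have hm := hH.aestronglyMeasurable (X a) (hX.contMDiffOn a).continuousOn
  refine (memLp_two_iff_integrable_sq_norm hm).2
    ((hΦ.integrableOn_covectorNormSq hr hrR hH).mono' (hm.norm.pow 2) ?_)
  refine ae_restrict_of_forall_mem (hΦ.isOpen_geodBall hr hrR).measurableSet fun x hx => ?_
  rw [Real.norm_of_nonneg (sq_nonneg _)]
  exact hX.norm_apply_sq_le hx _ a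

lemma exists_tendsto_eLpNorm : ∃ φ : ℕ → M → ℂ,
    (∀ k, ContMDiff (𝓡 n) 𝓘(ℝ, ℂ) 1 (φ k) ∧ HasCompactSupport (φ k) ∧
      tsupport (φ k) ⊆ geodBall n p r) ∧
    Filter.Tendsto (fun k => eLpNorm (φ k - ψ) 2
      ((riemannianVolume n M).restrict (geodBall n p r))) Filter.atTop (𝓝 0) ∧
    ∀ a, Filter.Tendsto (fun k => eLpNorm ((fun x => differential (n := n) (φ k) x (X a x)) -
      fun x => G x (X a x)) 2 ((riemannianVolume n M).restrict (geodBall n p r)))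
      Filter.atTop (𝓝 0) := by
  obtain ⟨φ, hφ, hlim1, hlim2⟩ := hH.approx
  refine ⟨φ, hφ, tendsto_eLpNorm_two hlim1, fun a => tendsto_eLpNorm_two ?_⟩
  refine tendsto_of_tendsto_of_tendsto_of_le_of_le tendsto_const_nhds hlim2 (fun _ => zero_le)
    fun k => setLIntegral_mono' (hΦ.isOpen_geodBall hr hrR).measurableSet fun x hx =>
      ENNReal.ofReal_le_ofReal ?_
  exact hX.norm_apply_sq_le hx (differential (n := n) (φ k) x - G x) a

/-- The identity for test functions passes to the limit because the divergences are bounded;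
likewise the next one, with bounded potential. -/
lemma integral_divergence_add (a : Fin n) :
    ∫ x in geodBall n p r, divergence (X a) x * ((starRingEnd ℂ) (ψ x) * ψ x).re
        ∂(riemannianVolume n M) +
      2 * ∫ x in geodBall n p r, ((starRingEnd ℂ) (ψ x) * G x (X a x)).re
        ∂(riemannianVolume n M) = 0 := by
  have hB := hΦ.isOpen_geodBall hr hrR
  have hBt := hΦ.geodBall_subset_target hr hrR
  obtain ⟨φ, hφ, hlim1, hlim2⟩ := hX.exists_tendsto_eLpNorm hΦ hr hrR hH
  obtain ⟨C, hC, -⟩ := hX.exists_abs_le hB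
  have hφL : ∀ k, MemLp (φ k) 2 ((riemannianVolume n M).restrict (geodBall n p r)) := fun k =>
    ((hφ k).1.continuous.memLp_of_hasCompactSupport (hφ k).2.1).restrict _
  have hdL := fun k => hX.memLp_differential hΦ hB hBt (hφ k).1 (hφ k).2.1 (hφ k).2.2
  have hGL := hX.memLp_apply hΦ hr hrR hH
  have h1 := tendsto_integral_mul_re hH.memLp hH.memLp hφL hφL hlim1 hlim1
    (hX.aestronglyMeasurable_divergence hB a) (hC a)
  have h2 := tendsto_integral_mul_re hH.memLp (hGL a) hφL (fun k => hdL k a) hlim1 (hlim2 a)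
    (aestronglyMeasurable_const (b := (1 : ℝ))) (C := 1) (by simp)
  simp only [one_mul] at h2
  refine tendsto_nhds_unique (h1.add (h2.const_mul 2)) (tendsto_const_nhds.congr fun k => ?_)
  exact (hX.integral_divergence_add_test hΦ hB hBt (hφ k).1 (hφ k).2.1 (hφ k).2.2 a).symm

lemma integral_potential_add :
    2 * ∫ x in geodBall n p r, potential X x * ((starRingEnd ℂ) (ψ x) * ψ x).re
        ∂(riemannianVolume n M) +
      ∑ a, (1 / 2 * ∫ x in geodBall n p r, divergence (X a) x ^ 2 *
        ((starRingEnd ℂ) (ψ x) * ψ x).re ∂(riemannianVolume n M) +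
      2 * ∫ x in geodBall n p r, divergence (X a) x *
        ((starRingEnd ℂ) (ψ x) * G x (X a x)).re ∂(riemannianVolume n M)) = 0 := by
  have hB := hΦ.isOpen_geodBall hr hrR
  have hBt := hΦ.geodBall_subset_target hr hrR
  obtain ⟨φ, hφ, hlim1, hlim2⟩ := hX.exists_tendsto_eLpNorm hΦ hr hrR hH
  obtain ⟨C, hC, hC2, hCV⟩ := hX.exists_abs_le hB
  have hφL : ∀ k, MemLp (φ k) 2 ((riemannianVolume n M).restrict (geodBall n p r)) := fun k =>
    ((hφ k).1.continuous.memLp_of_hasCompactSupport (hφ k).2.1).restrict _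
  have hdL := fun k => hX.memLp_differential hΦ hB hBt (hφ k).1 (hφ k).2.1 (hφ k).2.2
  have hGL := hX.memLp_apply hΦ hr hrR hH
  have hdm := hX.aestronglyMeasurable_divergence hB
  have h1 := tendsto_integral_mul_re hH.memLp hH.memLp hφL hφL hlim1 hlim1
    (hX.aestronglyMeasurable_potential hB) hCV
  have h2 := fun a => tendsto_integral_mul_re hH.memLp hH.memLp hφL hφL hlim1 hlim1
    ((hdm a).pow 2) (hC2 a)
  have h3 := fun a => tendsto_integral_mul_re hH.memLp (hGL a) hφL (fun k => hdL k a) hlim1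
    (hlim2 a) (hdm a) (hC a)
  refine tendsto_nhds_unique ((h1.const_mul 2).add (tendsto_finsetSum Finset.univ fun a _ =>
    ((h2 a).const_mul (1 / 2)).add ((h3 a).const_mul 2))) (tendsto_const_nhds.congr fun k => ?_)
  exact (hX.integral_potential_add_test hΦ hB hBt (hφ k).1 (hφ k).2.1 (hφ k).2.2).symm

/-- The geometric variance is the Dirichlet energy with respect to a constant gauge potential. -/
lemma geometricVariance_eq (ħ : ℝ)
    (h1 : ∫ x in geodBall n p r, ‖ψ x‖ ^ 2 ∂(riemannianVolume n M) = 1) :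
    geometricVariance ħ (geodBall n p r) X ψ G = ħ ^ 2 * ∑ a, ∫ x in geodBall n p r,
      ‖G x (X a x) - Complex.I * ψ x * ((∫ y in geodBall n p r,
        ((starRingEnd ℂ) (ψ y) * G y (X a y)).im ∂(riemannianVolume n M) : ℝ) : ℂ)‖ ^ 2
        ∂(riemannianVolume n M) := by
  have hB := hΦ.isOpen_geodBall hr hrR
  obtain ⟨C, hC, -⟩ := hX.exists_abs_le hB
  have h := fun a => integral_norm_sq_sub_norm_integral_sq ħ hH.memLp
    (hX.memLp_apply hΦ hr hrR hH a) (hX.aestronglyMeasurable_divergence hB a) (hC a) h1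
    (hX.integral_divergence_add hΦ hr hrR hH a)
  -- Half of this identity says that ∫V|ψ|² cancels ∑ₐ (∫ fₐ Re(ψ̄ Xₐψ) + ¼ ∫ fₐ²|ψ|²), precisely
  -- the surplus in `h`.
  have h2 := hX.integral_potential_add hΦ hr hrR hH
  simp only [geometricVariance, naiveVariance, meanMomentum, momentum]
  rw [Finset.sum_congr rfl fun a _ => h a, ← Finset.mul_sum, Finset.sum_add_distrib,
    Finset.sum_add_distrib, ← Finset.mul_sum, ← mul_add]
  rw [Finset.sum_add_distrib, ← Finset.mul_sum, ← Finset.mul_sum] at h2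
  congr 1
  simp_rw [norm_sq_eq_conj_mul_re (ψ _)]
  linarith

lemma mul_sq_le_geometricVariance (hn : 1 ≤ n) (hconv : IsWeaklyMeanConvexBall (n := n) p r)
    (ħ : ℝ) (h1 : ∫ x in geodBall n p r, ‖ψ x‖ ^ 2 ∂(riemannianVolume n M) = 1) :
    (ħ * (Real.pi / (2 * r))) ^ 2 ≤ geometricVariance ħ (geodBall n p r) X ψ G := by
  have hB := hΦ.isOpen_geodBall hr hrR
  have hBt := hΦ.geodBall_subset_target hr hrR
  rw [hX.geometricVariance_eq hΦ hr hrR hH ħ h1, mul_pow]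
  refine mul_le_mul_of_nonneg_left ?_ (sq_nonneg _)
  -- The means divided by ħ. They are the coefficients of the gauge potential θ = ∑ₐ cₐ h(Xₐ, ·),
  -- for which the gauged Dirichlet energy is the variance divided by ħ².
  set c : Fin n → ℝ := fun a => ∫ y in geodBall n p r,
    ((starRingEnd ℂ) (ψ y) * G y (X a y)).im ∂(riemannianVolume n M)
  have hθ : ∀ v, AEStronglyMeasurable (fun x => (∑ a, c a • innerSL ℝ (X a x))
      (pushforward Φ v x)) ((riemannianVolume n M).restrict (geodBall n p r)) := fun v => by
    refine ContinuousOn.aestronglyMeasurable ?_ hB.measurableSet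
    simp only [sum_apply, smul_apply, innerSL_apply_apply, smul_eq_mul]
    exact continuousOn_finsetSum _ fun a _ => continuousOn_const.mul
      (continuousOn_inner (hX.contMDiffOn a).continuousOn
        ((hΦ.continuousOn_pushforward v).mono hBt))
  have h := hΦ.mul_lintegral_norm_sq_le hr hrR hH hn hconv hθ
    (fun x hx => (hX.covectorInner_sum_smul_innerSL hx c).le)
  have hI : ∀ a, Integrable (fun x => ‖G x (X a x) - Complex.I * ψ x * (c a : ℂ)‖ ^ 2)
      ((riemannianVolume n M).restrict (geodBall n p r)) := fun a =>
    ((hX.memLp_apply hΦ hr hrR hH a).sub ((hH.memLp.const_mul Complex.I).mul_const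
      (c a : ℂ))).integrable_norm_pow two_ne_zero
  have e : ∀ x ∈ geodBall n p r, ENNReal.ofReal (covectorNormSq (G x -
      scaleCovector (Complex.I * ψ x) (∑ a, c a • innerSL ℝ (X a x)))) =
      ENNReal.ofReal (∑ a, ‖G x (X a x) - Complex.I * ψ x * (c a : ℂ)‖ ^ 2) := fun x hx => by
    rw [hX.covectorNormSq_eq hx]
    simp_rw [sub_apply, scaleCovector_apply, hX.sum_smul_innerSL_apply hx]
  rw [setLIntegral_congr_fun hB.measurableSet e,
    ← ofReal_integral_eq_lintegral_ofReal (integrable_finsetSum _ fun a _ => hI a)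
      (Filter.Eventually.of_forall fun x => Finset.sum_nonneg fun _ _ => sq_nonneg _),
    ← ofReal_integral_eq_lintegral_ofReal (hH.memLp.integrable_norm_pow two_ne_zero)
      (Filter.Eventually.of_forall fun x => sq_nonneg _), h1, ENNReal.ofReal_one, mul_one,
    integral_finsetSum _ fun a _ => hI a] at h
  exact (ENNReal.ofReal_le_ofReal_iff (Finset.sum_nonneg fun a _ =>
    integral_nonneg fun x => sq_nonneg _)).1 h

lemma le_sigmaP_mul (hn : 1 ≤ n) (hconv : IsWeaklyMeanConvexBall (n := n) p r)
    {ħ : ℝ} (hħ : 0 < ħ) (h1 : ∫ x in geodBall n p r, ‖ψ x‖ ^ 2 ∂(riemannianVolume n M) = 1) :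
    Real.pi * ħ / 2 ≤ sigmaP ħ (geodBall n p r) X ψ G * r := by
  have h := Real.sqrt_le_sqrt (hX.mul_sq_le_geometricVariance hΦ hr hrR hH hn hconv ħ h1)
  have hpos := Real.pi_pos
  rw [Real.sqrt_sq (by positivity)] at h
  calc Real.pi * ħ / 2 = ħ * (Real.pi / (2 * r)) * r := by field_simp
    _ ≤ _ := mul_le_mul_of_nonneg_right h hr.le

end Sobolev

end IsOrthonormalFrameOn

end GeodesicBall

end

theorem corollary3 {n : ℕ} (hn : 1 ≤ n) {M : Type*} [TopologicalSpace M] [T2Space M]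
    [SecondCountableTopology M] [ChartedSpace (EuclideanSpace ℝ (Fin n)) M] [IsManifold (𝓡 n) 2 M]
    [Bundle.RiemannianBundle (fun x : M => TangentSpace (𝓡 n) x)]
    [IsContMDiffRiemannianBundle (𝓡 n) 1 (EuclideanSpace ℝ (Fin n))
      (fun x : M => TangentSpace (𝓡 n) x)]
    [MeasurableSpace M] [BorelSpace M]
    (p : M) (r : ℝ) (hr : 0 < r) (hinj : ENNReal.ofReal r < GeodesicBall.injectivityRadius n p)
    (hconv : GeodesicBall.IsWeaklyMeanConvexBall (n := n) p r) (ħ : ℝ) (hħ : 0 < ħ) :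
    Real.pi ^ 2 / (4 * r ^ 2) ≤ GeodesicBall.lambda1 n (GeodesicBall.geodBall n p r) ∧
    ∀ X : Fin n → ∀ x : M, TangentSpace (𝓡 n) x,
      GeodesicBall.IsOrthonormalFrameOn (GeodesicBall.geodBall n p r) X →
      ∀ (ψ : M → ℂ) (G : ∀ x : M, TangentSpace (𝓡 n) x →L[ℝ] ℂ),
        GeodesicBall.MemH10 (GeodesicBall.geodBall n p r) ψ G →
        ∫ x in GeodesicBall.geodBall n p r, ‖ψ x‖ ^ 2 ∂(GeodesicBall.riemannianVolume n M) = 1 →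
        Real.pi * ħ / 2 ≤
          GeodesicBall.sigmaP ħ (GeodesicBall.geodBall n p r) X ψ G * r := by
  -- Strictness below the supremum yields exponential coordinates on a ball of some radius R > r, so
  -- that the closed ball of radius `r` is inside their domain.
  simp only [GeodesicBall.injectivityRadius, lt_iSup_iff] at hinj
  obtain ⟨R, ⟨hR, Φ, hΦ⟩, hrR⟩ := hinj
  replace hrR : r < R := (ENNReal.ofReal_lt_ofReal_iff hR).1 hrR
  exact ⟨hΦ.le_lambda1 hr hrR hn hconv, fun X hX ψ G hH h1 =>
    hX.le_sigmaP_mul hΦ hr hrR hH hn hconv hħ h1⟩
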